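/- **Setting.** Let $\mu$ be a probability measure on $\mathbb R$ that is symmetric about $0$ and satisfies $\int |h|\,d\mu(h)<\infty$, and let $\theta>0$. For $S\subset[n]$ and $h\in\mathbb R^n$ let $$\mathbb P_S(\sigma\mid h)\ \propto\ \exp\Big(\frac{\theta}{2|S|}\Big(\sum_{i\in S}\sigma_i\Big)^2+\sum_{i=1}^n h_i\sigma_i\Big),\qquad \sigma\in\{-1,1\}^n,$$ and let $\mathbb P_S(\sigma)=\mathbb E_h[\mathbb P_S(\sigma\mid h)]$, where $h_1,\dots,h_n$ are i.i.d. with law $\mu$. Let $\mathbb P_0$ be the law obtained in the same way without the quadratic interaction term. One observes $m$ i.i.d. samples $\sigma^{(1)},\dots,\sigma^{(m)}$ (the fields are not observed), drawn from $\mathbb P_0$ under the null hypothesis, and from $\mathbb P_S$ for some unknown $S\subset[n]$ with $|S|=k$ under the alternative. For a (possibly randomized) test $\psi$ with values in $[0,1]$ put $$R(\psi)=\mathbb E_{\mathbb P_0^{\otimes m}}[\psi]+\sup_{|S|=k}\mathbb E_{\mathbb P_S^{\otimes m}}[1-\psi].$$ Detection is called *impossible* (all tests are asymptotically powerless) along a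 sequence $(k,m)=(k_n,m_n)$ if $\inf_\psi R(\psi)\to1$ as $n\to\infty$. **Assumptions.** The temperature is critical, $\theta=1/\mathbb E[\operatorname{sech}^2(h)]$, and $0$ is the unique global minimum, with flatness $\tau$, of $$G(x)=\frac{x^2}{2}-\mathbb E\big[\log\cosh(\sqrt{\theta}\,x+h)\big],$$ that is, $\tau\ge 1$ is an integer, $G(x)>G(0)$ for $x\ne0$, $G^{(j)}(0)=0$ for $1\le j<2\tau$, and $G^{(2\tau)}(0)>0$. **Theorem.** Write $$A=n^2k^{-\frac{2(4\tau-3)}{2\tau-1}},\qquad B=\Big(\frac{k}{\log k}\Big)^{\frac1{2\tau-1}}\log n .$$ 1. If $n^{\frac{4\tau-2}{8\tau-5}}\lesssim k\lesssim n^{\frac{2\tau-1}{4\tau-3}}$ and $m=o(A)$, then detection is impossible. 2. If $k\lesssim n^{\frac{4\tau-2}{8\tau-5}}/\log n$ and $m=o(B)$, then detection is impossible. 3. More generally, if $k=o\big(n^{\frac{4\tau-2}{8\tau-5}}\big)$ and $m=o(\min(A,B))$, then detection is impossible. -/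

import Mathlib

open MeasureTheory Filter Asymptotics Topology

noncomputable section

/-- The two values of a spin: `true` is `+1`, `false` is `-1`. -/
def spin (b : Bool) : ℝ := if b then 1 else -1

/-- Gibbs weight of the configuration `σ` of `n` spins: Curie-Weiss interaction of strength `θ` on
the clique `S`, external field `h` on all sites. -/
def gibbsWeight {n : ℕ} (θ : ℝ) (S : Finset (Fin n)) (h : Fin n → ℝ) (σ : Fin n → Bool) : ℝ :=
  Real.exp (θ / (2 * (S.card : ℝ)) * (∑ i ∈ S, spin (σ i)) ^ 2 + ∑ i, h i * spin (σ i))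

/-- Conditional law `ℙ_S(σ | h)` of the spins given the field. -/
def quenchedLaw {n : ℕ} (θ : ℝ) (S : Finset (Fin n)) (h : Fin n → ℝ) (σ : Fin n → Bool) : ℝ :=
  gibbsWeight θ S h σ / ∑ σ' : Fin n → Bool, gibbsWeight θ S h σ'

/-- Law `ℙ_S(σ)` of one observation: the field has i.i.d. coordinates of law `μ` and is not
observed. -/
def plantedLaw {n : ℕ} (μ : Measure ℝ) (θ : ℝ) (S : Finset (Fin n)) (σ : Fin n → Bool) : ℝ :=
  ∫ h, quenchedLaw θ S h σ ∂(Measure.pi fun _ : Fin n => μ)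

/-- Law `ℙ_0(σ)` of one observation under the null hypothesis: no clique, no interaction. -/
def nullLaw {n : ℕ} (μ : Measure ℝ) (σ : Fin n → Bool) : ℝ :=
  plantedLaw μ 0 (∅ : Finset (Fin n)) σ

/-- A (possibly randomized) test based on `m` observations: the probability of rejecting the null
hypothesis as a function of the data. Nonrandomized tests are those with values in `{0, 1}`. -/
def DetectionTest (n m : ℕ) : Type :=
  {ψ : (Fin m → Fin n → Bool) → ℝ // ∀ x, ψ x ∈ Set.Icc (0 : ℝ) 1}

/-- Type I error of a test, from `m` i.i.d. observations. -/
def typeIError {n m : ℕ} (μ : Measure ℝ) (ψ : DetectionTest n m) : ℝ :=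
  ∑ x : Fin m → Fin n → Bool, (∏ j, nullLaw μ (x j)) * ψ.1 x

/-- Type II error of a test when the clique is `S`, from `m` i.i.d. observations. -/
def typeIIError {n m : ℕ} (μ : Measure ℝ) (θ : ℝ) (S : Finset (Fin n))
    (ψ : DetectionTest n m) : ℝ :=
  ∑ x : Fin m → Fin n → Bool, (∏ j, plantedLaw μ θ S (x j)) * (1 - ψ.1 x)

/-- Type I error plus the worst type II error over all cliques of size `k`. -/
def testRisk {n m : ℕ} (μ : Measure ℝ) (θ : ℝ) (k : ℕ) (ψ : DetectionTest n m) : ℝ :=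
  typeIError μ ψ + ⨆ S : {S : Finset (Fin n) // S.card = k}, typeIIError μ θ S.1 ψ

/-- The smallest risk of a test for a hidden clique of size `k` among `n` spins from `m`
observations. -/
def minimaxRisk (μ : Measure ℝ) (θ : ℝ) (n k m : ℕ) : ℝ :=
  ⨅ ψ : DetectionTest n m, testRisk μ θ k ψ

/-- The mean-field functional `x ↦ x² / 2 - 𝔼[log cosh (√θ x + h)]`, `h ∼ μ`. -/
def meanFieldFunctional (μ : Measure ℝ) (θ : ℝ) (x : ℝ) : ℝ :=
  x ^ 2 / 2 - ∫ h, Real.log (Real.cosh (√θ * x + h)) ∂μ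

/-- `0` is the unique global minimum of `G`, with flatness `τ`: the expansion of `G` at `0` is
`G 0 + c x ^ (2 τ) + O(x ^ (2 τ + 1))` with `c > 0`. -/
structure IsGlobalMinWithFlatness (G : ℝ → ℝ) (τ : ℕ) : Prop where
  pos : 1 ≤ τ
  lt_of_ne : ∀ x, x ≠ 0 → G 0 < G x
  iteratedDeriv_eq_zero : ∀ j, 1 ≤ j → j < 2 * τ → iteratedDeriv j G 0 = 0
  iteratedDeriv_pos : 0 < iteratedDeriv (2 * τ) G 0

/-- The rate `n² k ^ (-2(4τ-3)/(2τ-1))`. -/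
def globalRate (τ n k : ℕ) : ℝ :=
  (n : ℝ) ^ 2 * (k : ℝ) ^ (-(2 * (4 * (τ : ℝ) - 3) / (2 * (τ : ℝ) - 1)))

/-- The rate `(k / log k) ^ (1/(2τ-1)) log n`. -/
def localRate (τ n k : ℕ) : ℝ :=
  ((k : ℝ) / Real.log (k : ℝ)) ^ (1 / (2 * (τ : ℝ) - 1)) * Real.log (n : ℝ)

end

/-! The proof is a truncated second-moment argument under the uniform prior on the clique. By
symmetry of `μ` the null law is uniform, so the risk is close to one as soon as the truncated
mixture is close to the uniform law in chi-square (`one_sub_sqrt_le_minimaxRisk`). This second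
moment is an average over the overlap `r` of two independent cliques, whose law has a Poisson-type
tail of mean `k ^ 2 / n` (`overlapLaw_le`). Put `γ = 1 / (2 τ - 1)` and `ρ = r k ^ (-γ)`.

Scale of the magnetization. A Gaussian linearization of the interaction turns the magnetization per
site of the clique into a mean-field variable `x` of weight `exp (-k (G x - G 0) + fluctuation)`.
Flatness gives `G x - G 0 ≥ g x ^ (2 τ)`, while the random field contributes a term of order `√k
|x|`. The balance is at `x ^ 2 ~ k ^ (-γ)`, and the squared magnetization has exponential moments on
this scale (`exists_magnetizationMomentBound`).

Inner products of likelihood ratios. In the Walsh expansion only characters supported in the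
intersection of the cliques survive, and those of odd degree vanish. Permutation symmetry bounds a
coefficient of degree `p` by a moment of order `p` of the magnetization (`abs_sum_mul_walsh_le`).
Hence the inner product is `1 + O(ρ ^ 2)` for small `ρ`, and `m` samples give `exp (O(m ρ ^ 2))`.
For larger `ρ` the law is truncated where the empirical second moment of the magnetization is at
most `D m k ^ (-γ)`; a Gaussian tilt converts the truncation into the bound `exp (O(m ρ))`.

Summation over `r` (`exists_sum_overlap_le`). Typical overlaps, `r ~ k ^ 2 / n`, are harmless when
`m` is small against `n ^ 2 k ^ (2 γ - 4)`, the global rate. Overlaps far above the mean have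
probability about `exp (-r log n)`, which beats `exp (O(m r k ^ (-γ)))` when `m` is small against `k
^ γ log n`, a quantity at least of the order of the local rate. The ranges of `k` in the theorem
decide which condition implies the other. -/

/-! ### Calculus of `log cosh` and smoothness of the mean-field functional. -/

theorem abs_tanh_le_one (x : ℝ) : |Real.tanh x| ≤ 1 := by
  rw [Real.tanh_eq_sinh_div_cosh, abs_div, abs_of_pos (Real.cosh_pos x), div_le_one (Real.cosh_pos x)]
  rw [abs_le]
  constructor
  · have := Real.cosh_add_sinh x
    linarith [Real.exp_pos x]
  · exact (Real.sinh_lt_cosh x).le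

theorem hasDerivAt_log_cosh (x : ℝ) :
    HasDerivAt (fun x => Real.log (Real.cosh x)) (Real.tanh x) x := by
  rw [Real.tanh_eq_sinh_div_cosh]
  exact (Real.hasDerivAt_cosh x).log (Real.cosh_pos x).ne'

theorem one_sub_tanh_sq (x : ℝ) : 1 - Real.tanh x ^ 2 = 1 / Real.cosh x ^ 2 := by
  have h := Real.cosh_sq x
  have hc := (Real.cosh_pos x).ne'
  rw [Real.tanh_eq_sinh_div_cosh]
  field_simp
  linarith

theorem hasDerivAt_tanh (x : ℝ) : HasDerivAt Real.tanh (1 - Real.tanh x ^ 2) x := by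
  have hc := (Real.cosh_pos x).ne'
  have h := (Real.hasDerivAt_sinh x).div (Real.hasDerivAt_cosh x) hc
  have e : Real.tanh = Real.sinh / Real.cosh := by
    ext y; exact Real.tanh_eq_sinh_div_cosh y
  rw [e]
  refine h.congr_deriv ?_
  simp only [Pi.div_apply]
  field_simp

theorem continuous_tanh_real : Continuous Real.tanh :=
  continuous_iff_continuousAt.2 fun x => (hasDerivAt_tanh x).continuousAt

theorem continuous_log_cosh : Continuous fun x => Real.log (Real.cosh x) :=
  continuous_iff_continuousAt.2 fun x => (hasDerivAt_log_cosh x).continuousAt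

theorem abs_log_cosh_sub_le (x y : ℝ) :
    |Real.log (Real.cosh x) - Real.log (Real.cosh y)| ≤ |x - y| := by
  have := Convex.norm_image_sub_le_of_norm_hasDerivWithin_le (s := Set.univ) (C := 1)
    (f := fun x => Real.log (Real.cosh x)) (f' := Real.tanh)
    (fun x _ => (hasDerivAt_log_cosh x).hasDerivWithinAt)
    (fun x _ => abs_tanh_le_one x) convex_univ (Set.mem_univ y) (Set.mem_univ x)
  simpa using this

theorem abs_log_cosh_le (x : ℝ) : |Real.log (Real.cosh x)| ≤ |x| := by
  simpa using abs_log_cosh_sub_le x 0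

/-- The polynomial `p` such that `p (tanh x)` is the derivative of order `j + 1` of
`log (cosh x)`. -/
noncomputable def tanhPoly : ℕ → Polynomial ℝ
  | 0 => Polynomial.X
  | j + 1 => (tanhPoly j).derivative * (1 - Polynomial.X ^ 2)

theorem hasDerivAt_tanhPoly (j : ℕ) (x : ℝ) :
    HasDerivAt (fun x => (tanhPoly j).eval (Real.tanh x))
      ((tanhPoly (j + 1)).eval (Real.tanh x)) x := by
  have h := ((tanhPoly j).hasDerivAt (Real.tanh x)).comp x (hasDerivAt_tanh x)
  refine h.congr_deriv ?_
  simp [tanhPoly]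

theorem exists_abs_tanhPoly_le (j : ℕ) :
    ∃ C, ∀ x, |(tanhPoly j).eval (Real.tanh x)| ≤ C := by
  obtain ⟨C, hC⟩ := (isCompact_Icc (a := (-1 : ℝ)) (b := 1)).exists_bound_of_continuousOn
    (tanhPoly j).continuous.continuousOn
  exact ⟨C, fun x => hC _ (abs_le.1 (abs_tanh_le_one x))⟩

theorem hasDerivAt_integral_translate {μ : Measure ℝ} [IsProbabilityMeasure μ] {f f' : ℝ → ℝ}
    (hf : ∀ x, HasDerivAt f (f' x) x) {C : ℝ} (hC : ∀ x, |f' x| ≤ C)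
    (a : ℝ) (hint : ∀ x, Integrable (fun h => f (a * x + h)) μ) (x : ℝ) :
    HasDerivAt (fun x => ∫ h, f (a * x + h) ∂μ) (a * ∫ h, f' (a * x + h) ∂μ) x := by
  have hfc : Continuous f := continuous_iff_continuousAt.2 fun x => (hf x).continuousAt
  have hm : Measurable f' := by
    have : f' = deriv f := by ext x; exact (hf x).deriv.symm
    rw [this]; exact measurable_deriv f
  have key := hasDerivAt_integral_of_dominated_loc_of_deriv_le (μ := μ)
    (F := fun x h => f (a * x + h)) (F' := fun x h => a * f' (a * x + h)) (x₀ := x)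
    (s := Set.univ) (bound := fun _ => |a| * C) Filter.univ_mem
    (Eventually.of_forall fun y => (hint y).aestronglyMeasurable) (hint x)
    (by
      refine Measurable.aestronglyMeasurable ?_
      exact (hm.comp (measurable_const.add measurable_id)).const_mul a)
    (Eventually.of_forall fun h y _ => by
      rw [norm_mul]
      exact mul_le_mul_of_nonneg_left (hC _) (abs_nonneg a))
    (integrable_const _)
    (Eventually.of_forall fun h y _ => by
      have h1 : HasDerivAt (fun y => a * y + h) a y := by
        simpa using ((hasDerivAt_id y).const_mul a).add_const h
      exact ((hf (a * y + h)).comp y h1).congr_deriv (mul_comm _ _))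
  simpa [integral_const_mul] using key.2

theorem integrable_log_cosh {μ : Measure ℝ} [IsProbabilityMeasure μ]
    (hint : Integrable (fun h : ℝ => h) μ) (c : ℝ) :
    Integrable (fun h => Real.log (Real.cosh (c + h))) μ := by
  refine Integrable.mono' ((integrable_const c).add hint).norm
    (continuous_log_cosh.comp (by fun_prop)).aestronglyMeasurable
    (Eventually.of_forall fun h => ?_)
  exact abs_log_cosh_le (c + h)

theorem integrable_tanhPoly (μ : Measure ℝ) [IsProbabilityMeasure μ] (j : ℕ) (c : ℝ) :
    Integrable (fun h => (tanhPoly j).eval (Real.tanh (c + h))) μ := by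
  obtain ⟨C, hC⟩ := exists_abs_tanhPoly_le j
  refine Integrable.mono' (integrable_const C) ?_ (Eventually.of_forall fun h => hC _)
  exact ((tanhPoly j).continuous.comp
    (continuous_tanh_real.comp (by fun_prop))).aestronglyMeasurable

/-- `x ↦ 𝔼[log cosh (a x + h)]` and its derivatives. -/
noncomputable def logCoshMean (μ : Measure ℝ) (a : ℝ) : ℕ → ℝ → ℝ
  | 0, x => ∫ h, Real.log (Real.cosh (a * x + h)) ∂μ
  | j + 1, x => a ^ (j + 1) * ∫ h, (tanhPoly j).eval (Real.tanh (a * x + h)) ∂μ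

theorem hasDerivAt_logCoshMean {μ : Measure ℝ} [IsProbabilityMeasure μ]
    (hint : Integrable (fun h : ℝ => h) μ) (a : ℝ) (j : ℕ) (x : ℝ) :
    HasDerivAt (logCoshMean μ a j) (logCoshMean μ a (j + 1) x) x := by
  cases j with
  | zero =>
    have := hasDerivAt_integral_translate (μ := μ) hasDerivAt_log_cosh abs_tanh_le_one a
      (fun x => integrable_log_cosh hint (a * x)) x
    exact this.congr_deriv (by simp [logCoshMean, tanhPoly])
  | succ j =>
    obtain ⟨C, hC⟩ := exists_abs_tanhPoly_le (j + 1)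
    have := (hasDerivAt_integral_translate (μ := μ) (hasDerivAt_tanhPoly j) hC a
      (fun x => integrable_tanhPoly μ j (a * x)) x).const_mul (a ^ (j + 1))
    refine this.congr_deriv ?_
    simp only [logCoshMean]
    ring

theorem iteratedDeriv_logCoshMean {μ : Measure ℝ} [IsProbabilityMeasure μ]
    (hint : Integrable (fun h : ℝ => h) μ) (a : ℝ) (j : ℕ) :
    iteratedDeriv j (logCoshMean μ a 0) = logCoshMean μ a j := by
  induction j with
  | zero => simp
  | succ j ih =>
    rw [iteratedDeriv_succ, ih]
    ext x
    exact (hasDerivAt_logCoshMean hint a j x).deriv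

theorem contDiff_logCoshMean {μ : Measure ℝ} [IsProbabilityMeasure μ]
    (hint : Integrable (fun h : ℝ => h) μ) (a : ℝ) (N : ℕ) :
    ContDiff ℝ N (logCoshMean μ a 0) := by
  refine contDiff_of_differentiable_iteratedDeriv fun m _ => ?_
  rw [iteratedDeriv_logCoshMean hint]
  exact fun x => (hasDerivAt_logCoshMean hint a m x).differentiableAt

theorem meanFieldFunctional_eq (μ : Measure ℝ) (θ x : ℝ) :
    meanFieldFunctional μ θ x = x ^ 2 / 2 - logCoshMean μ √θ 0 x := rfl

theorem contDiff_meanFieldFunctional {μ : Measure ℝ} [IsProbabilityMeasure μ]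
    (hint : Integrable (fun h : ℝ => h) μ) (θ : ℝ) (N : ℕ) :
    ContDiff ℝ N (meanFieldFunctional μ θ) := by
  have : meanFieldFunctional μ θ = fun x => x ^ 2 / 2 - logCoshMean μ √θ 0 x := rfl
  rw [this]
  exact ContDiff.sub (by fun_prop) (contDiff_logCoshMean hint _ N)

theorem critical_pos {μ : Measure ℝ} [IsProbabilityMeasure μ] {θ : ℝ}
    (hcrit : θ = 1 / ∫ h, 1 / Real.cosh h ^ 2 ∂μ) : 0 < θ := by
  rw [hcrit]
  apply one_div_pos.2
  have hi : Integrable (fun h : ℝ => 1 / Real.cosh h ^ 2) μ := by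
    have := (integrable_tanhPoly μ 1 0)
    simpa [tanhPoly, one_sub_tanh_sq] using this
  rw [integral_pos_iff_support_of_nonneg (fun h => by positivity) hi]
  have : Function.support (fun h : ℝ => 1 / Real.cosh h ^ 2) = Set.univ := by
    ext h; simp [(Real.cosh_pos h).ne']
  rw [this]; simp

/-- The second derivative at the origin is `1 - θ 𝔼[sech² h]`, which is what criticality cancels. -/
theorem iteratedDeriv_two_meanFieldFunctional {μ : Measure ℝ} [IsProbabilityMeasure μ]
    (hint : Integrable (fun h : ℝ => h) μ) {θ : ℝ}
    (hcrit : θ = 1 / ∫ h, 1 / Real.cosh h ^ 2 ∂μ) :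
    iteratedDeriv 2 (meanFieldFunctional μ θ) 0 = 0 := by
  have hθ := critical_pos hcrit
  have h1 : deriv (meanFieldFunctional μ θ) = fun x => x - logCoshMean μ √θ 1 x := by
    ext x
    have := ((hasDerivAt_pow 2 x).div_const 2).sub (hasDerivAt_logCoshMean hint √θ 0 x)
    refine HasDerivAt.deriv (this.congr_deriv ?_)
    simp
  rw [iteratedDeriv_succ, iteratedDeriv_one, h1]
  have := (hasDerivAt_id (0 : ℝ)).sub (hasDerivAt_logCoshMean hint √θ 1 0)
  refine (HasDerivAt.deriv this).trans ?_
  have e : ∫ h, 1 / Real.cosh h ^ 2 ∂μ = 1 / θ := by rw [hcrit]; simp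
  simp only [logCoshMean, tanhPoly]
  simp only [Polynomial.derivative_X, one_mul, Polynomial.eval_sub, Polynomial.eval_one,
    Polynomial.eval_pow, Polynomial.eval_X, mul_zero, zero_add, one_sub_tanh_sq, e]
  rw [Real.sq_sqrt hθ.le]
  field_simp
  simp

/-- This is the only use of criticality besides the sign of `θ`. It yields `1 / (2 τ - 1) ≤ 1 / 2`,
on which the small-overlap bound depends. -/
theorem two_le_flatness {μ : Measure ℝ} [IsProbabilityMeasure μ]
    (hint : Integrable (fun h : ℝ => h) μ) {θ : ℝ}
    (hcrit : θ = 1 / ∫ h, 1 / Real.cosh h ^ 2 ∂μ)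
    {τ : ℕ} (hflat : IsGlobalMinWithFlatness (meanFieldFunctional μ θ) τ) : 2 ≤ τ := by
  by_contra h
  have h1 : τ = 1 := by have := hflat.pos; omega
  have h2 := hflat.iteratedDeriv_pos
  rw [h1, mul_one, iteratedDeriv_two_meanFieldFunctional hint hcrit] at h2
  exact lt_irrefl _ h2

/-! ### Polynomial lower bound for the mean-field functional. -/

theorem IsGlobalMinWithFlatness.exists_local_lower_bound {G : ℝ → ℝ} {τ : ℕ}
    (h : IsGlobalMinWithFlatness G τ) (hG : ContDiff ℝ (2 * τ : ℕ) G) :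
    ∃ c > 0, ∀ᶠ x in 𝓝 (0 : ℝ), c * x ^ (2 * τ) ≤ G x - G 0 := by
  have ht := taylor_isLittleO_univ (x₀ := 0) hG
  have e : ∀ x, taylorWithinEval G (2 * τ) Set.univ 0 x =
      G 0 + iteratedDeriv (2 * τ) G 0 / (2 * τ).factorial * x ^ (2 * τ) := by
    intro x
    rw [taylor_within_apply, Finset.sum_range_succ, Finset.sum_eq_single_of_mem 0]
    · simp [iteratedDerivWithin_univ]
      ring
    · have := h.pos
      simp; omega
    · intro j hj hj0
      rw [iteratedDerivWithin_univ, h.iteratedDeriv_eq_zero j (by omega) (by simpa using hj)]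
      simp
  set c := iteratedDeriv (2 * τ) G 0 / (2 * τ).factorial with hc
  have hcpos : 0 < c := div_pos h.iteratedDeriv_pos (by positivity)
  refine ⟨c / 2, half_pos hcpos, ?_⟩
  filter_upwards [ht.def (half_pos hcpos)] with x hx
  rw [e] at hx
  have h2 : (0 : ℝ) ≤ x ^ (2 * τ) := by rw [pow_mul]; positivity
  simp only [sub_zero, Real.norm_eq_abs, abs_of_nonneg h2] at hx
  have := (abs_le.1 hx).1
  linarith

/-- Near `0` this is Taylor's formula; away from `0` compactness and uniqueness of the minimum give
a positive gap. A bounded interval suffices, because the quadratic term of the functional takes over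
for large `x`. -/
theorem IsGlobalMinWithFlatness.exists_lower_bound {G : ℝ → ℝ} {τ : ℕ}
    (h : IsGlobalMinWithFlatness G τ) (hG : ContDiff ℝ (2 * τ : ℕ) G) (X : ℝ) :
    ∃ c > 0, ∀ x, |x| ≤ X → c * x ^ (2 * τ) ≤ G x - G 0 := by
  obtain ⟨c, hc, hloc⟩ := h.exists_local_lower_bound hG
  obtain ⟨ε, hε, hb⟩ := Metric.eventually_nhds_iff.1 hloc
  have hcomp : IsCompact {x : ℝ | ε ≤ |x| ∧ |x| ≤ X} := by
    refine (isCompact_Icc (a := -X) (b := X)).of_isClosed_subset ?_ ?_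
    · exact (isClosed_le continuous_const continuous_abs).inter
        (isClosed_le continuous_abs continuous_const)
    · rintro x ⟨_, hx⟩; exact abs_le.1 hx
  rcases Set.eq_empty_or_nonempty {x : ℝ | ε ≤ |x| ∧ |x| ≤ X} with he | hne
  · refine ⟨c, hc, fun x hx => hb ?_⟩
    rw [Real.dist_eq, sub_zero]
    by_contra hcon
    have : x ∈ {x : ℝ | ε ≤ |x| ∧ |x| ≤ X} := ⟨not_lt.1 hcon, hx⟩
    rw [he] at this; exact this
  · have hGc : Continuous G := hG.continuous
    obtain ⟨x₀, hx₀, hmin⟩ := hcomp.exists_isMinOn hne hGc.continuousOn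
    have hx₀0 : x₀ ≠ 0 := by
      rintro rfl
      have := hx₀.1
      simp at this; linarith
    have hd : 0 < G x₀ - G 0 := sub_pos.2 (h.lt_of_ne _ hx₀0)
    have hX : 0 < X := hε.trans_le (hx₀.1.trans hx₀.2)
    refine ⟨min c ((G x₀ - G 0) / X ^ (2 * τ)), lt_min hc (by positivity), fun x hx => ?_⟩
    have h2 : (0 : ℝ) ≤ x ^ (2 * τ) := by rw [pow_mul]; positivity
    by_cases hxε : |x| < ε
    · refine (mul_le_mul_of_nonneg_right (min_le_left _ _) h2).trans (hb ?_)
      rwa [Real.dist_eq, sub_zero]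
    · have hm : G x₀ ≤ G x := hmin ⟨not_lt.1 hxε, hx⟩
      have hp : x ^ (2 * τ) ≤ X ^ (2 * τ) := by
        rw [← (even_two_mul τ).pow_abs]
        exact pow_le_pow_left₀ (abs_nonneg x) hx _
      calc _ ≤ (G x₀ - G 0) / X ^ (2 * τ) * X ^ (2 * τ) :=
            mul_le_mul (min_le_right _ _) hp h2 (by positivity)
        _ = G x₀ - G 0 := by field_simp
        _ ≤ _ := by linarith

/-! ### Symmetries of the planted law and comparison with the uniform law. -/

/-- The total spin of the sites of `S`. -/
noncomputable def blockSum {n : ℕ} (S : Finset (Fin n)) (σ : Fin n → Bool) : ℝ :=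
  ∑ i ∈ S, spin (σ i)

/-- The configuration obtained by flipping the spins of `D`. -/
def flipSpins {n : ℕ} (D : Finset (Fin n)) (σ : Fin n → Bool) : Fin n → Bool :=
  fun i => if i ∈ D then !σ i else σ i

theorem spin_not (b : Bool) : spin (!b) = -spin b := by cases b <;> simp [spin]

theorem spin_mul_self (b : Bool) : spin b * spin b = 1 := by cases b <;> simp [spin]

theorem flipSpins_flipSpins {n : ℕ} (D : Finset (Fin n)) (σ : Fin n → Bool) :
    flipSpins D (flipSpins D σ) = σ := by
  ext i; by_cases h : i ∈ D <;> simp [flipSpins, h]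

/-- Flipping the spins of `D`, as a bijection of the configuration space. -/
def flipEquiv {n : ℕ} (D : Finset (Fin n)) : (Fin n → Bool) ≃ (Fin n → Bool) :=
  ⟨flipSpins D, flipSpins D, flipSpins_flipSpins D, flipSpins_flipSpins D⟩

theorem gibbsWeight_eq {n : ℕ} (θ : ℝ) (S : Finset (Fin n)) (h : Fin n → ℝ) (σ : Fin n → Bool) :
    gibbsWeight θ S h σ = Real.exp (θ / (2 * (S.card : ℝ)) * blockSum S σ ^ 2) *
      ∏ i, Real.exp (h i * spin (σ i)) := by
  rw [gibbsWeight, Real.exp_add, Real.exp_sum, blockSum]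

theorem gibbsWeight_pos {n : ℕ} (θ : ℝ) (S : Finset (Fin n)) (h : Fin n → ℝ) (σ : Fin n → Bool) :
    0 < gibbsWeight θ S h σ := Real.exp_pos _

theorem partition_pos {n : ℕ} (θ : ℝ) (S : Finset (Fin n)) (h : Fin n → ℝ) :
    0 < ∑ σ : Fin n → Bool, gibbsWeight θ S h σ :=
  Finset.sum_pos (fun σ _ => gibbsWeight_pos θ S h σ) Finset.univ_nonempty

theorem quenchedLaw_nonneg {n : ℕ} (θ : ℝ) (S : Finset (Fin n)) (h : Fin n → ℝ)
    (σ : Fin n → Bool) : 0 ≤ quenchedLaw θ S h σ :=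
  div_nonneg (gibbsWeight_pos θ S h σ).le (partition_pos θ S h).le

theorem sum_quenchedLaw {n : ℕ} (θ : ℝ) (S : Finset (Fin n)) (h : Fin n → ℝ) :
    ∑ σ : Fin n → Bool, quenchedLaw θ S h σ = 1 := by
  simp only [quenchedLaw]
  rw [← Finset.sum_div, div_self (partition_pos θ S h).ne']

theorem quenchedLaw_le_one {n : ℕ} (θ : ℝ) (S : Finset (Fin n)) (h : Fin n → ℝ)
    (σ : Fin n → Bool) : quenchedLaw θ S h σ ≤ 1 := by
  rw [← sum_quenchedLaw θ S h]
  exact Finset.single_le_sum (f := fun σ => quenchedLaw θ S h σ)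
    (fun σ _ => quenchedLaw_nonneg θ S h σ) (Finset.mem_univ σ)

theorem continuous_quenchedLaw {n : ℕ} (θ : ℝ) (S : Finset (Fin n)) (σ : Fin n → Bool) :
    Continuous fun h => quenchedLaw θ S h σ := by
  unfold quenchedLaw
  refine Continuous.div ?_ ?_ fun h => (partition_pos θ S h).ne'
  · unfold gibbsWeight; fun_prop
  · unfold gibbsWeight; fun_prop

theorem integrable_quenchedLaw {n : ℕ} (μ : Measure ℝ) [IsProbabilityMeasure μ] (θ : ℝ)
    (S : Finset (Fin n)) (σ : Fin n → Bool) :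
    Integrable (fun h => quenchedLaw θ S h σ) (Measure.pi fun _ : Fin n => μ) := by
  refine Integrable.mono' (integrable_const 1)
    (continuous_quenchedLaw θ S σ).aestronglyMeasurable (Eventually.of_forall fun h => ?_)
  rw [Real.norm_eq_abs, abs_of_nonneg (quenchedLaw_nonneg θ S h σ)]
  exact quenchedLaw_le_one θ S h σ

theorem plantedLaw_nonneg {n : ℕ} (μ : Measure ℝ) (θ : ℝ) (S : Finset (Fin n))
    (σ : Fin n → Bool) : 0 ≤ plantedLaw μ θ S σ :=
  integral_nonneg fun h => quenchedLaw_nonneg θ S h σ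

theorem sum_plantedLaw {n : ℕ} (μ : Measure ℝ) [IsProbabilityMeasure μ] (θ : ℝ)
    (S : Finset (Fin n)) : ∑ σ : Fin n → Bool, plantedLaw μ θ S σ = 1 := by
  unfold plantedLaw
  rw [← integral_finsetSum _ fun σ _ => integrable_quenchedLaw μ θ S σ]
  simp [sum_quenchedLaw]

/-- Symmetries act jointly on spins and fields. The partition function is then preserved
automatically, by reindexing along the bijection. -/
theorem quenchedLaw_equiv {n : ℕ} {θ : ℝ} {S : Finset (Fin n)} {h h' : Fin n → ℝ}
    (e : (Fin n → Bool) ≃ (Fin n → Bool))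
    (he : ∀ σ, gibbsWeight θ S h' (e σ) = gibbsWeight θ S h σ) (σ : Fin n → Bool) :
    quenchedLaw θ S h' (e σ) = quenchedLaw θ S h σ := by
  unfold quenchedLaw
  rw [he, ← Equiv.sum_comp e]
  simp only [he]

theorem blockSum_comp {n : ℕ} (S : Finset (Fin n)) (π : Equiv.Perm (Fin n))
    (hπ : ∀ i, π i ∈ S ↔ i ∈ S) (σ : Fin n → Bool) : blockSum S (σ ∘ π) = blockSum S σ := by
  unfold blockSum
  refine Finset.sum_bij (fun i _ => π i) (fun i hi => (hπ i).2 hi)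
    (fun i _ j _ hij => π.injective hij) (fun j hj => ⟨π.symm j, ?_, by simp⟩) (fun i _ => rfl)
  rw [← hπ]; simpa using hj

theorem plantedLaw_comp {n : ℕ} (μ : Measure ℝ) [IsProbabilityMeasure μ] (θ : ℝ)
    (S : Finset (Fin n)) (π : Equiv.Perm (Fin n)) (hπ : ∀ i, π i ∈ S ↔ i ∈ S)
    (σ : Fin n → Bool) : plantedLaw μ θ S (σ ∘ π) = plantedLaw μ θ S σ := by
  unfold plantedLaw
  have hmp := measurePreserving_piCongrLeft (fun _ : Fin n => μ) π.symm
  rw [← hmp.integral_comp' (g := fun h => quenchedLaw θ S h (σ ∘ π))]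
  congr 1
  ext h
  have e : (MeasurableEquiv.piCongrLeft (fun _ : Fin n => ℝ) π.symm) h = h ∘ π := by
    ext i
    have := MeasurableEquiv.piCongrLeft_apply_apply π.symm (β := fun _ => ℝ) h (π i)
    simpa using this
  rw [e]
  refine quenchedLaw_equiv (Equiv.arrowCongr π.symm (Equiv.refl Bool)) (fun σ => ?_) σ
  have e2 : (Equiv.arrowCongr π.symm (Equiv.refl Bool)) σ = σ ∘ π := by
    ext i; simp [Equiv.arrowCongr]
  rw [e2, gibbsWeight_eq, gibbsWeight_eq, blockSum_comp S π hπ]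
  congr 1
  exact Equiv.prod_comp π fun i => Real.exp (h i * spin (σ i))

/-- Changing the signs of `h i` and `σ i` together preserves `h i * σ i`, and the law of the field
is invariant since `μ` is symmetric. -/
theorem plantedLaw_flip {n : ℕ} {μ : Measure ℝ} [IsProbabilityMeasure μ]
    (hsymm : μ.map (fun h : ℝ => -h) = μ) (θ : ℝ) (S D : Finset (Fin n))
    (hD : ∀ σ, blockSum S (flipSpins D σ) ^ 2 = blockSum S σ ^ 2) (σ : Fin n → Bool) :
    plantedLaw μ θ S (flipSpins D σ) = plantedLaw μ θ S σ := by
  unfold plantedLaw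
  have hmp : MeasurePreserving (fun (h : Fin n → ℝ) i => if i ∈ D then -h i else h i)
      (Measure.pi fun _ : Fin n => μ) (Measure.pi fun _ : Fin n => μ) := by
    refine measurePreserving_pi (fun _ => μ) (fun _ => μ)
      (f := fun i (x : ℝ) => if i ∈ D then -x else x) fun i => ?_
    by_cases hi : i ∈ D
    · simp only [hi, if_true]
      exact ⟨measurable_neg, hsymm⟩
    · simp only [hi, if_false]
      exact MeasurePreserving.id μ
  conv_lhs => rw [← hmp.map_eq]
  rw [integral_map hmp.measurable.aemeasurable
    (continuous_quenchedLaw θ S _).aestronglyMeasurable]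
  congr 1
  ext h
  refine quenchedLaw_equiv (flipEquiv D) (fun σ => ?_) σ
  rw [gibbsWeight_eq, gibbsWeight_eq]
  change Real.exp (_ * blockSum S (flipSpins D σ) ^ 2) * _ = _
  rw [hD]
  congr 1
  refine Finset.prod_congr rfl fun i _ => ?_
  by_cases hi : i ∈ D <;> simp [flipEquiv, flipSpins, hi, spin_not]

theorem plantedLaw_flip_of_disjoint {n : ℕ} {μ : Measure ℝ} [IsProbabilityMeasure μ]
    (hsymm : μ.map (fun h : ℝ => -h) = μ) (θ : ℝ) (S : Finset (Fin n)) {i : Fin n} (hi : i ∉ S)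
    (σ : Fin n → Bool) : plantedLaw μ θ S (flipSpins {i} σ) = plantedLaw μ θ S σ := by
  refine plantedLaw_flip hsymm θ S {i} (fun σ => ?_) σ
  congr 1
  refine Finset.sum_congr rfl fun j hj => ?_
  have : j ≠ i := by rintro rfl; exact hi hj
  simp [flipSpins, this]

theorem blockSum_flip_univ {n : ℕ} (S : Finset (Fin n)) (σ : Fin n → Bool) :
    blockSum S (flipSpins Finset.univ σ) = -blockSum S σ := by
  simp [blockSum, flipSpins, spin_not]

theorem plantedLaw_flip_univ {n : ℕ} {μ : Measure ℝ} [IsProbabilityMeasure μ]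
    (hsymm : μ.map (fun h : ℝ => -h) = μ) (θ : ℝ) (S : Finset (Fin n))
    (σ : Fin n → Bool) : plantedLaw μ θ S (flipSpins Finset.univ σ) = plantedLaw μ θ S σ := by
  refine plantedLaw_flip hsymm θ S _ (fun σ => ?_) σ
  rw [blockSum_flip_univ, neg_sq]

theorem sum_prod_exp_spin {n : ℕ} (h : Fin n → ℝ) :
    ∑ σ : Fin n → Bool, ∏ i, Real.exp (h i * spin (σ i)) = ∏ i, (2 * Real.cosh (h i)) := by
  have := (Finset.prod_univ_sum (fun _ : Fin n => (Finset.univ : Finset Bool))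
    (fun i b => Real.exp (h i * spin b))).symm
  rw [Fintype.piFinset_univ] at this
  rw [this]
  refine Finset.prod_congr rfl fun i _ => ?_
  simp [spin, Real.cosh_eq]
  ring

theorem prod_cosh_le_partition {n : ℕ} {θ : ℝ} (hθ : 0 ≤ θ) (S : Finset (Fin n))
    (h : Fin n → ℝ) :
    ∏ i, (2 * Real.cosh (h i)) ≤ ∑ σ : Fin n → Bool, gibbsWeight θ S h σ := by
  rw [← sum_prod_exp_spin]
  refine Finset.sum_le_sum fun σ _ => ?_
  rw [gibbsWeight_eq]
  refine le_mul_of_one_le_left (by positivity) (Real.one_le_exp (by positivity))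

theorem integrable_exp_div_cosh (μ : Measure ℝ) [IsProbabilityMeasure μ] (b : Bool) :
    Integrable (fun h => Real.exp (h * spin b) / (2 * Real.cosh h)) μ := by
  refine Integrable.mono' (integrable_const 1) ?_ (Eventually.of_forall fun h => ?_)
  · refine Continuous.aestronglyMeasurable ?_
    refine Continuous.div (by fun_prop) (by fun_prop) fun h => ?_
    have := Real.cosh_pos h
    positivity
  · have := Real.cosh_pos h
    rw [Real.norm_eq_abs, abs_of_nonneg (by positivity), div_le_one (by positivity), Real.cosh_eq]
    cases b <;> simp [spin] <;> linarith [Real.exp_pos h, Real.exp_pos (-h)]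

theorem integral_exp_div_cosh {μ : Measure ℝ} [IsProbabilityMeasure μ]
    (hsymm : μ.map (fun h : ℝ => -h) = μ) (b : Bool) :
    ∫ h, Real.exp (h * spin b) / (2 * Real.cosh h) ∂μ = 1 / 2 := by
  have h1 : ∫ h, Real.exp (h * spin true) / (2 * Real.cosh h) ∂μ =
      ∫ h, Real.exp (h * spin false) / (2 * Real.cosh h) ∂μ := by
    conv_lhs => rw [← hsymm]
    rw [integral_map measurable_neg.aemeasurable]
    · simp [spin]
    · rw [hsymm]; exact (integrable_exp_div_cosh μ true).aestronglyMeasurable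
  have h2 : ∫ h, Real.exp (h * spin true) / (2 * Real.cosh h) ∂μ +
      ∫ h, Real.exp (h * spin false) / (2 * Real.cosh h) ∂μ = 1 := by
    rw [← integral_add (integrable_exp_div_cosh μ true) (integrable_exp_div_cosh μ false)]
    have : ∀ h : ℝ, Real.exp (h * spin true) / (2 * Real.cosh h) +
        Real.exp (h * spin false) / (2 * Real.cosh h) = 1 := by
      intro h
      have h0 := Real.cosh_pos h
      rw [← add_div, div_eq_one_iff_eq (by positivity), Real.cosh_eq]
      simp [spin]
      ring
    simp [this]
  cases b <;> linarith

theorem integral_prod_exp_div_cosh {n : ℕ} {μ : Measure ℝ} [IsProbabilityMeasure μ]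
    (hsymm : μ.map (fun h : ℝ => -h) = μ) (σ : Fin n → Bool) :
    ∫ h, ∏ i, (Real.exp (h i * spin (σ i)) / (2 * Real.cosh (h i)))
      ∂(Measure.pi fun _ : Fin n => μ) = (1 / 2) ^ n := by
  rw [integral_fintype_prod_eq_prod (𝕜 := ℝ)
    (fun i (x : ℝ) => Real.exp (x * spin (σ i)) / (2 * Real.cosh x))]
  simp [integral_exp_div_cosh hsymm]

theorem nullLaw_eq {n : ℕ} {μ : Measure ℝ} [IsProbabilityMeasure μ]
    (hsymm : μ.map (fun h : ℝ => -h) = μ) (σ : Fin n → Bool) : nullLaw μ σ = (1 / 2) ^ n := by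
  rw [← integral_prod_exp_div_cosh hsymm σ]
  unfold nullLaw plantedLaw
  congr 1
  ext h
  rw [quenchedLaw]
  have : ∀ σ, gibbsWeight 0 ∅ h σ = ∏ i, Real.exp (h i * spin (σ i)) := by
    intro σ; rw [gibbsWeight_eq]; simp
  simp only [this]
  rw [sum_prod_exp_spin, Finset.prod_div_distrib]

/-- The interaction only increases the partition function, so it may be dropped from the
denominator; averaging the remaining product over the field gives the uniform law. -/
theorem plantedLaw_le {n : ℕ} {μ : Measure ℝ} [IsProbabilityMeasure μ]
    (hsymm : μ.map (fun h : ℝ => -h) = μ) {θ : ℝ} (hθ : 0 ≤ θ) (S : Finset (Fin n))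
    (σ : Fin n → Bool) :
    plantedLaw μ θ S σ ≤
      (1 / 2) ^ n * Real.exp (θ / (2 * (S.card : ℝ)) * blockSum S σ ^ 2) := by
  rw [← integral_prod_exp_div_cosh hsymm σ, ← integral_mul_const]
  refine integral_mono (integrable_quenchedLaw μ θ S σ) (Integrable.mul_const ?_ _) fun h => ?_
  · exact Integrable.fintype_prod (f := fun i (x : ℝ) =>
      Real.exp (x * spin (σ i)) / (2 * Real.cosh x)) fun i => integrable_exp_div_cosh μ (σ i)
  · have h0 : 0 < ∏ i, (2 * Real.cosh (h i)) :=
      Finset.prod_pos fun i _ => mul_pos two_pos (Real.cosh_pos _)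
    refine (div_le_div_of_nonneg_left (gibbsWeight_pos θ S h σ).le h0
      (prod_cosh_le_partition hθ S h)).trans_eq ?_
    rw [gibbsWeight_eq, Finset.prod_div_distrib]
    ring

/-! ### Walsh expansion and bounds on the Walsh coefficients of exchangeable weights. -/

/-- The Walsh character indexed by `J`. -/
noncomputable def walsh {n : ℕ} (J : Finset (Fin n)) (σ : Fin n → Bool) : ℝ :=
  ∏ i ∈ J, spin (σ i)

theorem sum_walsh_mul_walsh {n : ℕ} (σ σ' : Fin n → Bool) :
    ∑ J : Finset (Fin n), walsh J σ * walsh J σ' = if σ = σ' then 2 ^ n else 0 := by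
  simp only [walsh, ← Finset.prod_mul_distrib]
  rw [← Finset.powerset_univ, ← Finset.prod_one_add]
  split_ifs with h
  · subst h
    simp [spin_mul_self, one_add_one_eq_two]
  · obtain ⟨i, hi⟩ := Function.ne_iff.1 h
    refine Finset.prod_eq_zero (Finset.mem_univ i) ?_
    cases h1 : σ i <;> cases h2 : σ' i <;> simp_all [spin]

/-- Parseval's identity on the hypercube. -/
theorem two_pow_mul_sum_mul {n : ℕ} (F H : (Fin n → Bool) → ℝ) :
    2 ^ n * ∑ σ, F σ * H σ = ∑ J : Finset (Fin n), (∑ σ, F σ * walsh J σ) * ∑ σ, H σ * walsh J σ := by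
  simp only [Finset.sum_mul_sum]
  rw [Finset.sum_comm, Finset.mul_sum]
  refine Finset.sum_congr rfl fun σ _ => ?_
  rw [Finset.sum_comm]
  have : ∀ σ', ∑ J : Finset (Fin n), F σ * walsh J σ * (H σ' * walsh J σ') =
      F σ * H σ' * if σ = σ' then 2 ^ n else 0 := by
    intro σ'
    rw [← sum_walsh_mul_walsh, Finset.mul_sum]
    exact Finset.sum_congr rfl fun J _ => by ring
  simp [this]
  ring

theorem sum_mul_walsh_eq_zero_of_flip {n : ℕ} {w : (Fin n → Bool) → ℝ} {D J : Finset (Fin n)}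
    (hw : ∀ σ, w (flipSpins D σ) = w σ) (hJ : Odd (J ∩ D).card) : ∑ σ, w σ * walsh J σ = 0 := by
  have h1 : ∀ σ, walsh J (flipSpins D σ) = -walsh J σ := by
    intro σ
    have : ∀ i ∈ J, spin (flipSpins D σ i) = spin (σ i) * if i ∈ D then -1 else 1 := by
      intro i _
      by_cases h : i ∈ D <;> simp [flipSpins, h, spin_not]
    rw [walsh, Finset.prod_congr rfl this, Finset.prod_mul_distrib, Finset.prod_ite]
    simp [Finset.filter_mem_eq_inter, hJ.neg_one_pow, walsh]
  have h2 := Equiv.sum_comp (flipEquiv D) fun σ => w σ * walsh J σ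
  have h3 : ∀ σ, w (flipEquiv D σ) * walsh J (flipEquiv D σ) = -(w σ * walsh J σ) := by
    intro σ
    change w (flipSpins D σ) * walsh J (flipSpins D σ) = _
    rw [hw, h1]; ring
  simp only [h3, Finset.sum_neg_distrib] at h2
  linarith

/-- Multiplication by a spin adds its site to the character or, as spins square to one, removes it.
Solved for the terms of higher degree, this is a recursion on the degree. -/
theorem blockSum_mul_walsh {n : ℕ} {S J : Finset (Fin n)} (hJ : J ⊆ S) (σ : Fin n → Bool) :
    blockSum S σ * walsh J σ =
      ∑ i ∈ S \ J, walsh (insert i J) σ + ∑ i ∈ J, walsh (J.erase i) σ := by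
  rw [blockSum, ← Finset.sum_sdiff hJ, add_mul, Finset.sum_mul, Finset.sum_mul]
  congr 1
  · refine Finset.sum_congr rfl fun i hi => ?_
    rw [walsh, walsh, Finset.prod_insert (Finset.mem_sdiff.1 hi).2]
  · refine Finset.sum_congr rfl fun i hi => ?_
    rw [walsh, walsh, ← Finset.mul_prod_erase J _ hi, ← mul_assoc, spin_mul_self, one_mul]

/-- Invariance of a weight on configurations under exchange of two sites of `S`. -/
def SwapInvariant {n : ℕ} (S : Finset (Fin n)) (w : (Fin n → Bool) → ℝ) : Prop :=
  ∀ i ∈ S, ∀ j ∈ S, ∀ σ, w (σ ∘ Equiv.swap i j) = w σ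

theorem swap_mem_iff {n : ℕ} {S : Finset (Fin n)} {i j : Fin n} (hi : i ∈ S) (hj : j ∈ S)
    (l : Fin n) : Equiv.swap i j l ∈ S ↔ l ∈ S := by
  rcases eq_or_ne l i with rfl | h1
  · simp [hi, hj]
  · rcases eq_or_ne l j with rfl | h2
    · simp [hi, hj]
    · rw [Equiv.swap_apply_of_ne_of_ne h1 h2]

theorem SwapInvariant.mul_blockSum {n : ℕ} {S : Finset (Fin n)} {w : (Fin n → Bool) → ℝ}
    (hw : SwapInvariant S w) (f : ℝ → ℝ) : SwapInvariant S fun σ => w σ * f (blockSum S σ) := by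
  intro i hi j hj σ
  simp only [hw i hi j hj, blockSum_comp S (Equiv.swap i j) (swap_mem_iff hi hj)]

theorem SwapInvariant.sum_mul_walsh_insert {n : ℕ} {S J : Finset (Fin n)}
    {w : (Fin n → Bool) → ℝ} (hw : SwapInvariant S w) {i j : Fin n} (hi : i ∈ S \ J)
    (hj : j ∈ S \ J) :
    ∑ σ, w σ * walsh (insert i J) σ = ∑ σ, w σ * walsh (insert j J) σ := by
  rw [Finset.mem_sdiff] at hi hj
  have e := Equiv.sum_comp (Equiv.arrowCongr (Equiv.swap i j) (Equiv.refl Bool))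
    fun σ => w σ * walsh (insert i J) σ
  rw [← e]
  refine Finset.sum_congr rfl fun σ _ => ?_
  have e2 : (Equiv.arrowCongr (Equiv.swap i j) (Equiv.refl Bool)) σ = σ ∘ Equiv.swap i j := by
    ext l; simp [Equiv.arrowCongr]
  rw [e2, hw i hi.1 j hj.1, walsh, walsh, Finset.prod_insert hi.2, Finset.prod_insert hj.2]
  congr 2
  · simp
  · refine Finset.prod_congr rfl fun l hl => ?_
    have h1 : l ≠ i := by rintro rfl; exact hi.2 hl
    have h2 : l ≠ j := by rintro rfl; exact hj.2 hl
    simp [Equiv.swap_apply_of_ne_of_ne h1 h2]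

/-- The size of a Walsh character of degree at most `R` on the configurations with the
magnetization of `σ` on `S`. -/
noncomputable def walshScale {n : ℕ} (S : Finset (Fin n)) (R : ℝ) (σ : Fin n → Bool) : ℝ :=
  4 * √((blockSum S σ / S.card) ^ 2 + R / S.card)

theorem walshScale_nonneg {n : ℕ} (S : Finset (Fin n)) (R : ℝ) (σ : Fin n → Bool) :
    0 ≤ walshScale S R σ := by unfold walshScale; positivity

theorem walshScale_sq {n : ℕ} (S : Finset (Fin n)) {R : ℝ} (hR : 0 ≤ R) (σ : Fin n → Bool) :
    walshScale S R σ ^ 2 = 16 * ((blockSum S σ / S.card) ^ 2 + R / S.card) := by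
  rw [walshScale, mul_pow, Real.sq_sqrt (by positivity)]
  norm_num

/-- The inequality that closes the induction on the degree. With `B` the scale and `k` the size of
`S`, the factor 4 in `walshScale` gives `|blockSum| ≤ k B / 4` and `q ≤ k B ^ 2 / 16`; the left side
is at most `(1/4 + 1/16) k B ^ (q + 1)`, whereas `k - q ≥ k / 2`. -/
theorem walshScale_step {n : ℕ} {S : Finset (Fin n)} (hS : 0 < (S.card : ℝ)) {R : ℝ}
    (hR2 : 2 * R ≤ S.card) {q : ℕ} (hq : (q : ℝ) ≤ R) (σ : Fin n → Bool) :
    |blockSum S σ| * walshScale S R σ ^ q + q * walshScale S R σ ^ (q - 1) ≤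
      (S.card - q) * walshScale S R σ ^ (q + 1) := by
  have hR : 0 ≤ R := (Nat.cast_nonneg q).trans hq
  have hsq := walshScale_sq S hR σ
  set B := walshScale S R σ with hB
  have hB0 : 0 ≤ B := walshScale_nonneg S R σ
  set k : ℝ := (S.card : ℝ) with hk
  have h1 : |blockSum S σ| ≤ k * B / 4 := by
    have h3 : |blockSum S σ| / k ≤ B / 4 := by
      apply abs_le_of_sq_le_sq' _ (by positivity) |>.2
      have : (blockSum S σ / k) ^ 2 = (|blockSum S σ| / k) ^ 2 := by rw [div_pow, div_pow, sq_abs]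
      rw [← this, div_pow B, hsq]
      have : 0 ≤ R / k := by positivity
      linarith
    rw [div_le_iff₀ hS] at h3
    linarith
  have h2 : (q : ℝ) ≤ k * B ^ 2 / 16 := by
    rw [hsq]
    have h4 : k * (16 * ((blockSum S σ / k) ^ 2 + R / k)) / 16 =
      k * (blockSum S σ / k) ^ 2 + R := by field_simp
    rw [h4]
    have : 0 ≤ k * (blockSum S σ / k) ^ 2 := by positivity
    linarith
  have h5 : (q : ℝ) * B ^ (q - 1) ≤ k * B ^ (q + 1) / 16 := by
    rcases Nat.eq_zero_or_pos q with rfl | hq0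
    · simp; positivity
    · have : B ^ (q + 1) = B ^ 2 * B ^ (q - 1) := by
        rw [← pow_add]; congr 1; omega
      rw [this]
      have := mul_le_mul_of_nonneg_right h2 (pow_nonneg hB0 (q - 1))
      linarith
  have h6 : |blockSum S σ| * B ^ q ≤ k * B ^ (q + 1) / 4 := by
    have := mul_le_mul_of_nonneg_right h1 (pow_nonneg hB0 q)
    rw [pow_succ]; linarith
  have h7 : k / 2 * B ^ (q + 1) ≤ (k - q) * B ^ (q + 1) :=
    mul_le_mul_of_nonneg_right (by linarith) (pow_nonneg hB0 _)
  have h8 : 0 ≤ k * B ^ (q + 1) := by positivity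
  linarith

/-- By exchangeability all extensions of `J` by one site of `S` have the same coefficient, so
`blockSum_mul_walsh` expresses it through lower degrees. The quantification over all weights `w`
lets the induction absorb the factor `blockSum` into the weight. -/
theorem abs_sum_mul_walsh_le {n : ℕ} {S : Finset (Fin n)} {R : ℝ} (hR2 : 2 * R ≤ S.card) (p : ℕ) :
    ∀ J ⊆ S, J.card = p → (p : ℝ) ≤ R → ∀ w : (Fin n → Bool) → ℝ, SwapInvariant S w →
      |∑ σ, w σ * walsh J σ| ≤ ∑ σ, |w σ| * walshScale S R σ ^ p := by
  induction p using Nat.strong_induction_on with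
  | _ p ih =>
  intro J hJ hp hpR w hw
  rcases Nat.eq_zero_or_pos p with rfl | hp0
  · rw [Finset.card_eq_zero] at hp
    subst hp
    simpa [walsh] using Finset.abs_sum_le_sum_abs w Finset.univ
  obtain ⟨q, rfl⟩ : ∃ q, p = q + 1 := ⟨p - 1, by omega⟩
  obtain ⟨i, J, hi, rfl, hq⟩ := Finset.card_eq_succ.1 hp
  have hiS : i ∈ S \ J := Finset.mem_sdiff.2 ⟨hJ (Finset.mem_insert_self i J), hi⟩
  have hJS : J ⊆ S := (Finset.subset_insert i J).trans hJ
  have hS : 0 < (S.card : ℝ) := by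
    exact_mod_cast Finset.card_pos.2 ⟨i, (Finset.mem_sdiff.1 hiS).1⟩
  have hqR : (q : ℝ) ≤ R := by push_cast at hpR; linarith
  have hkq : (0 : ℝ) < S.card - q := by
    push_cast at hpR
    linarith
  have hcard : ((S \ J).card : ℝ) = S.card - q := by
    rw [Finset.card_sdiff_of_subset hJS, hq, Nat.cast_sub]
    rw [← hq]; exact Finset.card_le_card hJS
  have e1 : (S.card - q : ℝ) * ∑ σ, w σ * walsh (insert i J) σ =
      ∑ σ, w σ * blockSum S σ * walsh J σ - ∑ j ∈ J, ∑ σ, w σ * walsh (J.erase j) σ := by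
    have h1 : ∑ l ∈ S \ J, ∑ σ, w σ * walsh (insert l J) σ =
        (S.card - q : ℝ) * ∑ σ, w σ * walsh (insert i J) σ := by
      rw [Finset.sum_congr rfl fun l hl => hw.sum_mul_walsh_insert hl hiS, Finset.sum_const,
        nsmul_eq_mul, hcard]
    rw [← h1, Finset.sum_comm, Finset.sum_comm (s := J), ← Finset.sum_sub_distrib]
    refine Finset.sum_congr rfl fun σ _ => ?_
    rw [mul_assoc, blockSum_mul_walsh hJS, mul_add, Finset.mul_sum, Finset.mul_sum]
    ring
  -- Degree `q`, with the weight multiplied by the magnetization, which is still exchangeable.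
  have b1 := ih q (by omega) J hJS hq hqR (fun σ => w σ * blockSum S σ) (hw.mul_blockSum id)
  have b2 : |∑ j ∈ J, ∑ σ, w σ * walsh (J.erase j) σ| ≤
      ∑ σ, |w σ| * (q * walshScale S R σ ^ (q - 1)) := by
    refine (Finset.abs_sum_le_sum_abs _ _).trans ?_
    have : ∀ j ∈ J, |∑ σ, w σ * walsh (J.erase j) σ| ≤
        ∑ σ, |w σ| * walshScale S R σ ^ (q - 1) := by
      intro j hj
      have h1 : (J.erase j).card = q - 1 := by rw [Finset.card_erase_of_mem hj, hq]
      refine ih (q - 1) (by omega) _ ((Finset.erase_subset j J).trans hJS) h1 ?_ w hw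
      exact le_trans (by exact_mod_cast Nat.sub_le q 1) hqR
    refine (Finset.sum_le_sum this).trans ?_
    rw [Finset.sum_const, hq, nsmul_eq_mul, Finset.mul_sum]
    exact Finset.sum_le_sum fun σ _ => le_of_eq (by ring)
  have b3 : (S.card - q : ℝ) * |∑ σ, w σ * walsh (insert i J) σ| ≤
      (S.card - q : ℝ) * ∑ σ, |w σ| * walshScale S R σ ^ (q + 1) := by
    rw [← abs_of_pos hkq, ← abs_mul, abs_of_pos hkq, e1]
    refine (abs_sub _ _).trans ((add_le_add b1 b2).trans ?_)
    rw [← Finset.sum_add_distrib, Finset.mul_sum]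
    refine Finset.sum_le_sum fun σ _ => ?_
    have := mul_le_mul_of_nonneg_left (walshScale_step hS hR2 hqR σ) (abs_nonneg (w σ))
    rw [abs_mul]
    linarith
  exact le_of_mul_le_mul_left b3 hkq

/-! ### Inner products of tilted likelihood ratios. -/

/-- The planted law with a Gaussian penalty on the magnetization of the clique. -/
noncomputable def tiltedLaw {n : ℕ} (μ : Measure ℝ) (θ lam : ℝ) (S : Finset (Fin n))
    (σ : Fin n → Bool) : ℝ :=
  plantedLaw μ θ S σ * Real.exp (-lam * (blockSum S σ / S.card) ^ 2)

/-- The inner product of the likelihood ratios of two tilted laws under the uniform law. -/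
noncomputable def overlapProduct {n : ℕ} (μ : Measure ℝ) (θ lam : ℝ) (S S' : Finset (Fin n)) : ℝ :=
  2 ^ n * ∑ σ, tiltedLaw μ θ lam S σ * tiltedLaw μ θ lam S' σ

theorem tiltedLaw_nonneg {n : ℕ} (μ : Measure ℝ) (θ lam : ℝ) (S : Finset (Fin n))
    (σ : Fin n → Bool) : 0 ≤ tiltedLaw μ θ lam S σ :=
  mul_nonneg (plantedLaw_nonneg μ θ S σ) (Real.exp_pos _).le

theorem overlapProduct_nonneg {n : ℕ} (μ : Measure ℝ) (θ lam : ℝ) (S S' : Finset (Fin n)) :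
    0 ≤ overlapProduct μ θ lam S S' :=
  mul_nonneg (by positivity) (Finset.sum_nonneg fun σ _ =>
    mul_nonneg (tiltedLaw_nonneg μ θ lam S σ) (tiltedLaw_nonneg μ θ lam S' σ))

theorem swapInvariant_tiltedLaw {n : ℕ} (μ : Measure ℝ) [IsProbabilityMeasure μ] (θ lam : ℝ)
    (S : Finset (Fin n)) : SwapInvariant S (tiltedLaw μ θ lam S) := by
  have h : SwapInvariant S (plantedLaw μ θ S) := fun i hi j hj σ =>
    plantedLaw_comp μ θ S (Equiv.swap i j) (swap_mem_iff hi hj) σ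
  exact h.mul_blockSum fun s => Real.exp (-lam * (s / S.card) ^ 2)

theorem sum_tiltedLaw_mul_walsh_eq_zero {n : ℕ} {μ : Measure ℝ} [IsProbabilityMeasure μ]
    (hsymm : μ.map (fun h : ℝ => -h) = μ) (θ lam : ℝ) {S J : Finset (Fin n)} (hJ : ¬ J ⊆ S) :
    ∑ σ, tiltedLaw μ θ lam S σ * walsh J σ = 0 := by
  obtain ⟨i, hiJ, hiS⟩ := Finset.not_subset.1 hJ
  refine sum_mul_walsh_eq_zero_of_flip (D := {i}) (fun σ => ?_) ?_
  · rw [tiltedLaw, tiltedLaw, plantedLaw_flip_of_disjoint hsymm θ S hiS]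
    have : blockSum S (flipSpins {i} σ) = blockSum S σ := by
      refine Finset.sum_congr rfl fun j hj => ?_
      have : j ≠ i := by rintro rfl; exact hiS hj
      simp [flipSpins, this]
    rw [this]
  · simp [Finset.inter_singleton_of_mem hiJ]

theorem sum_tiltedLaw_mul_walsh_eq_zero_of_odd {n : ℕ} {μ : Measure ℝ} [IsProbabilityMeasure μ]
    (hsymm : μ.map (fun h : ℝ => -h) = μ) (θ lam : ℝ) {S J : Finset (Fin n)} (hJ : Odd J.card) :
    ∑ σ, tiltedLaw μ θ lam S σ * walsh J σ = 0 := by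
  refine sum_mul_walsh_eq_zero_of_flip (D := Finset.univ) (fun σ => ?_) (by simpa using hJ)
  rw [tiltedLaw, tiltedLaw, plantedLaw_flip_univ hsymm θ S, blockSum_flip_univ, neg_div, neg_sq]

theorem overlapProduct_eq {n : ℕ} {μ : Measure ℝ} [IsProbabilityMeasure μ]
    (hsymm : μ.map (fun h : ℝ => -h) = μ) (θ lam : ℝ) (S S' : Finset (Fin n)) :
    overlapProduct μ θ lam S S' = ∑ J ∈ (S ∩ S').powerset,
      (∑ σ, tiltedLaw μ θ lam S σ * walsh J σ) * ∑ σ, tiltedLaw μ θ lam S' σ * walsh J σ := by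
  rw [overlapProduct, two_pow_mul_sum_mul]
  symm
  refine Finset.sum_subset (Finset.subset_univ _) fun J _ hJ => ?_
  rw [Finset.mem_powerset, Finset.subset_inter_iff, not_and_or] at hJ
  rcases hJ with hJ | hJ
  · rw [sum_tiltedLaw_mul_walsh_eq_zero hsymm θ lam hJ, zero_mul]
  · rw [sum_tiltedLaw_mul_walsh_eq_zero hsymm θ lam hJ, mul_zero]

/-- The product of the two Walsh scales is at most half the sum of their squares, whence the
constants 8 and 16. The parameter `R` remains free: it is taken as the degree of `J` for tilted laws
and as the overlap without tilt. -/
theorem walsh_coeff_mul_le {n : ℕ} (μ : Measure ℝ) [IsProbabilityMeasure μ] (θ lam : ℝ)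
    {S S' J : Finset (Fin n)} {k : ℕ} (hS : S.card = k) (hS' : S'.card = k) (hJ : J ⊆ S ∩ S')
    {R : ℝ} (hJR : (J.card : ℝ) ≤ R) (hR : 2 * R ≤ k) :
    (∑ σ, tiltedLaw μ θ lam S σ * walsh J σ) * ∑ σ, tiltedLaw μ θ lam S' σ * walsh J σ ≤
      ∑ σ, ∑ σ', tiltedLaw μ θ lam S σ * tiltedLaw μ θ lam S' σ' *
        (8 * ((blockSum S σ / k) ^ 2 + (blockSum S' σ' / k) ^ 2) + 16 * (R / k)) ^ J.card := by
  have hR0 : 0 ≤ R := (Nat.cast_nonneg _).trans hJR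
  rw [Finset.subset_inter_iff] at hJ
  have b1 := abs_sum_mul_walsh_le (S := S) (by rwa [hS]) J.card J hJ.1 rfl hJR _
    (swapInvariant_tiltedLaw μ θ lam S)
  have b2 := abs_sum_mul_walsh_le (S := S') (by rwa [hS']) J.card J hJ.2 rfl hJR _
    (swapInvariant_tiltedLaw μ θ lam S')
  refine (le_abs_self _).trans ?_
  rw [abs_mul]
  refine (mul_le_mul b1 b2 (abs_nonneg _) (Finset.sum_nonneg fun σ _ =>
    mul_nonneg (abs_nonneg _) (pow_nonneg (walshScale_nonneg S R σ) _))).trans ?_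
  rw [Finset.sum_mul_sum]
  refine Finset.sum_le_sum fun σ _ => Finset.sum_le_sum fun σ' _ => ?_
  rw [abs_of_nonneg (tiltedLaw_nonneg μ θ lam S σ), abs_of_nonneg (tiltedLaw_nonneg μ θ lam S' σ'),
    mul_mul_mul_comm, ← mul_pow]
  refine mul_le_mul_of_nonneg_left ?_
    (mul_nonneg (tiltedLaw_nonneg μ θ lam S σ) (tiltedLaw_nonneg μ θ lam S' σ'))
  refine pow_le_pow_left₀ (mul_nonneg (walshScale_nonneg S R σ) (walshScale_nonneg S' R σ')) ?_ _
  have e1 := walshScale_sq S hR0 σ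
  have e2 := walshScale_sq S' hR0 σ'
  rw [hS] at e1
  rw [hS'] at e2
  nlinarith [sq_nonneg (walshScale S R σ - walshScale S' R σ')]

/-- From `choose r j ≤ r ^ j / j!` and `j ^ j / j! ≤ e ^ j ≤ 3 ^ j` the left side is at most `(96 r
/ k) ^ j`; hence `192 = 2 * 3 * 32`. -/
theorem choose_mul_pow_le {r j k : ℕ} (hk : 0 < k) (hr : 192 * r ≤ k) :
    (r.choose j : ℝ) * (32 * (j / k : ℝ)) ^ j ≤ (1 / 2) ^ j := by
  have hk' : (0 : ℝ) < k := by exact_mod_cast hk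
  have hr' : 192 * (r : ℝ) ≤ k := by exact_mod_cast hr
  have h1 : (r.choose j : ℝ) ≤ r ^ j / j.factorial := Nat.choose_le_pow_div j r
  have h2 : (j : ℝ) ^ j / j.factorial ≤ 3 ^ j := by
    refine (Real.pow_div_factorial_le_exp (j : ℝ) (Nat.cast_nonneg j) j).trans ?_
    rw [← Real.exp_one_pow]
    exact pow_le_pow_left₀ (Real.exp_pos 1).le (by linarith [Real.exp_one_lt_d9]) j
  calc (r.choose j : ℝ) * (32 * (j / k : ℝ)) ^ j
      ≤ r ^ j / j.factorial * (32 * (j / k : ℝ)) ^ j :=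
        mul_le_mul_of_nonneg_right h1 (by positivity)
    _ = (32 * r / k) ^ j * (j ^ j / j.factorial) := by
        rw [mul_pow, div_pow, div_pow, mul_pow]; ring
    _ ≤ (32 * r / k) ^ j * 3 ^ j := mul_le_mul_of_nonneg_left h2 (by positivity)
    _ = (96 * r / k) ^ j := by rw [← mul_pow]; ring
    _ ≤ (1 / 2) ^ j := by
        refine pow_le_pow_left₀ (by positivity) ?_ j
        rw [div_le_iff₀ hk']; linarith

theorem add_pow_le_two_mul {a b : ℝ} (ha : 0 ≤ a) (hb : 0 ≤ b) (j : ℕ) :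
    (a + b) ^ j ≤ (2 * a) ^ j + (2 * b) ^ j := by
  rcases le_total a b with h | h
  · have : (a + b) ^ j ≤ (2 * b) ^ j := pow_le_pow_left₀ (by positivity) (by linarith) j
    have : 0 ≤ (2 * a) ^ j := by positivity
    linarith
  · have : (a + b) ^ j ≤ (2 * a) ^ j := pow_le_pow_left₀ (by positivity) (by linarith) j
    have : 0 ≤ (2 * b) ^ j := by positivity
    linarith

theorem sum_powerset_pow_le {α : Type*} (T : Finset α) {k : ℕ} (hk : 0 < k)
    (hT : 192 * T.card ≤ k) {Y : ℝ} (hY : 0 ≤ Y) :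
    ∑ J ∈ T.powerset, (8 * Y + 16 * ((J.card : ℝ) / k)) ^ J.card ≤
      Real.exp (16 * T.card * Y) + 2 := by
  have h1 : ∀ J ∈ T.powerset, (8 * Y + 16 * ((J.card : ℝ) / k)) ^ J.card ≤
      (16 * Y) ^ J.card + (32 * ((J.card : ℝ) / k)) ^ J.card := by
    intro J _
    refine (add_pow_le_two_mul (by positivity) (by positivity) _).trans (le_of_eq ?_)
    ring_nf
  refine (Finset.sum_le_sum h1).trans ?_
  rw [Finset.sum_add_distrib]
  refine add_le_add ?_ ?_
  · have := Finset.sum_pow_mul_eq_add_pow (16 * Y) 1 T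
    simp only [one_pow, mul_one] at this
    rw [this]
    calc (16 * Y + 1) ^ T.card ≤ (Real.exp (16 * Y)) ^ T.card :=
          pow_le_pow_left₀ (by positivity) (Real.add_one_le_exp _) _
      _ = _ := by rw [← Real.exp_nat_mul]; ring_nf
  · rw [Finset.sum_powerset_apply_card (fun j : ℕ => (32 * ((j : ℝ) / k)) ^ j)]
    simp only [nsmul_eq_mul]
    refine (Finset.sum_le_sum fun j _ => choose_mul_pow_le hk hT).trans ?_
    have := Summable.sum_le_tsum (f := fun j : ℕ => (1 / 2 : ℝ) ^ j) (Finset.range (T.card + 1))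
      (fun j _ => by positivity) summable_geometric_two
    rwa [tsum_geometric_two] at this

theorem sum_sum_plantedLaw {n : ℕ} (μ : Measure ℝ) [IsProbabilityMeasure μ] (θ : ℝ)
    (S S' : Finset (Fin n)) :
    ∑ σ, ∑ σ', plantedLaw μ θ S σ * plantedLaw μ θ S' σ' = 1 := by
  rw [← Finset.sum_mul_sum, sum_plantedLaw, sum_plantedLaw, one_mul]

/-- The tilt `16 r` is the one that exactly cancels the factor `exp (16 r Y)` of
`sum_powerset_pow_le`; what remains is `1 + 2`. -/
theorem overlapProduct_le_three {n : ℕ} {μ : Measure ℝ} [IsProbabilityMeasure μ]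
    (hsymm : μ.map (fun h : ℝ => -h) = μ) (θ : ℝ) {S S' : Finset (Fin n)} {k : ℕ} (hk : 0 < k)
    (hS : S.card = k) (hS' : S'.card = k) (hr : 192 * (S ∩ S').card ≤ k) :
    overlapProduct μ θ (16 * (S ∩ S').card) S S' ≤ 3 := by
  set r := (S ∩ S').card with hrdef
  rw [overlapProduct_eq hsymm]
  have h1 : ∀ J ∈ (S ∩ S').powerset,
      (∑ σ, tiltedLaw μ θ (16 * r) S σ * walsh J σ) *
        ∑ σ, tiltedLaw μ θ (16 * r) S' σ * walsh J σ ≤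
      ∑ σ, ∑ σ', tiltedLaw μ θ (16 * r) S σ * tiltedLaw μ θ (16 * r) S' σ' *
        (8 * ((blockSum S σ / k) ^ 2 + (blockSum S' σ' / k) ^ 2) +
          16 * ((J.card : ℝ) / k)) ^ J.card := by
    intro J hJ
    refine walsh_coeff_mul_le μ θ _ hS hS' (Finset.mem_powerset.1 hJ) le_rfl ?_
    have := Finset.card_le_card (Finset.mem_powerset.1 hJ)
    have : 2 * J.card ≤ k := by omega
    exact_mod_cast this
  refine (Finset.sum_le_sum h1).trans ?_
  rw [Finset.sum_comm]
  have h2 : ∀ σ, ∑ J ∈ (S ∩ S').powerset, ∑ σ',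
      tiltedLaw μ θ (16 * r) S σ * tiltedLaw μ θ (16 * r) S' σ' *
        (8 * ((blockSum S σ / k) ^ 2 + (blockSum S' σ' / k) ^ 2) +
          16 * ((J.card : ℝ) / k)) ^ J.card ≤
      ∑ σ', 3 * (plantedLaw μ θ S σ * plantedLaw μ θ S' σ') := by
    intro σ
    rw [Finset.sum_comm]
    refine Finset.sum_le_sum fun σ' _ => ?_
    rw [← Finset.mul_sum]
    refine (mul_le_mul_of_nonneg_left (sum_powerset_pow_le (S ∩ S') hk hr (by positivity))
      (mul_nonneg (tiltedLaw_nonneg _ _ _ _ _) (tiltedLaw_nonneg _ _ _ _ _))).trans ?_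
    rw [← hrdef]
    set a := (blockSum S σ / k) ^ 2 with ha
    set b := (blockSum S' σ' / k) ^ 2 with hb
    have e : tiltedLaw μ θ (16 * r) S σ * tiltedLaw μ θ (16 * r) S' σ' =
        plantedLaw μ θ S σ * plantedLaw μ θ S' σ' * Real.exp (-(16 * r * (a + b))) := by
      rw [tiltedLaw, tiltedLaw, hS, hS', mul_mul_mul_comm, ← Real.exp_add]
      congr 2
      ring
    rw [e, mul_assoc]
    have h3 : Real.exp (-(16 * r * (a + b))) * (Real.exp (16 * r * (a + b)) + 2) ≤ 3 := by
      rw [mul_add, ← Real.exp_add, neg_add_cancel, Real.exp_zero]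
      have : Real.exp (-(16 * r * (a + b))) ≤ 1 := Real.exp_le_one_iff.2 (by
        have : 0 ≤ 16 * (r : ℝ) * (a + b) := by positivity
        linarith)
      linarith
    have := mul_le_mul_of_nonneg_left h3
      (mul_nonneg (plantedLaw_nonneg μ θ S σ) (plantedLaw_nonneg μ θ S' σ'))
    linarith
  refine (Finset.sum_le_sum fun σ _ => h2 σ).trans ?_
  simp only [← Finset.mul_sum]
  rw [Finset.mul_sum]
  have := sum_sum_plantedLaw μ θ S S'
  simp only [← Finset.mul_sum] at this ⊢
  rw [this, mul_one]

/-- The tilt `θ k / 2` cancels the exponential in `plantedLaw_le`, so the tilted law of `S` lies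
below the uniform law. It serves for overlaps comparable to `k`. -/
theorem overlapProduct_le_one {n : ℕ} {μ : Measure ℝ} [IsProbabilityMeasure μ]
    (hsymm : μ.map (fun h : ℝ => -h) = μ) {θ : ℝ} (hθ : 0 ≤ θ) {S S' : Finset (Fin n)} {k : ℕ}
    (hk : 0 < k) (hS : S.card = k) :
    overlapProduct μ θ (θ * k / 2) S S' ≤ 1 := by
  have hk' : (0 : ℝ) < k := by exact_mod_cast hk
  rw [overlapProduct, Finset.mul_sum, ← sum_plantedLaw μ θ S']
  refine Finset.sum_le_sum fun σ _ => ?_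
  have h1 : tiltedLaw μ θ (θ * k / 2) S σ ≤ (1 / 2) ^ n := by
    rw [tiltedLaw]
    refine (mul_le_mul_of_nonneg_right (plantedLaw_le hsymm hθ S σ) (Real.exp_pos _).le).trans ?_
    rw [mul_assoc, ← Real.exp_add, hS]
    have : θ / (2 * (k : ℝ)) * blockSum S σ ^ 2 + -(θ * k / 2) * (blockSum S σ / k) ^ 2 = 0 := by
      field_simp; ring
    rw [this]; simp
  have h2 : tiltedLaw μ θ (θ * k / 2) S' σ ≤ plantedLaw μ θ S' σ := by
    rw [tiltedLaw]
    refine mul_le_of_le_one_right (plantedLaw_nonneg μ θ S' σ) (Real.exp_le_one_iff.2 ?_)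
    have : 0 ≤ θ * k / 2 * (blockSum S' σ / S'.card) ^ 2 := by positivity
    linarith
  calc 2 ^ n * (tiltedLaw μ θ (θ * k / 2) S σ * tiltedLaw μ θ (θ * k / 2) S' σ)
      ≤ 2 ^ n * ((1 / 2) ^ n * plantedLaw μ θ S' σ) := by
        gcongr
        exact tiltedLaw_nonneg _ _ _ _ _
    _ = plantedLaw μ θ S' σ := by
        rw [← mul_assoc, ← mul_pow]; norm_num

theorem exp_sub_one_sub_le {z : ℝ} (hz : 0 ≤ z) : Real.exp z - 1 - z ≤ z ^ 2 * Real.exp z := by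
  rcases le_total 1 z with h | h
  · have : 1 ≤ z ^ 2 := one_le_pow₀ h
    nlinarith [Real.exp_pos z]
  · have h1 : Real.exp z * (1 - z) ≤ 1 := by
      have := mul_le_mul_of_nonneg_left (Real.one_sub_le_exp_neg z) (Real.exp_pos z).le
      rwa [← Real.exp_add, add_neg_cancel, Real.exp_zero] at this
    nlinarith [mul_le_mul_of_nonneg_right h1 (by linarith : 0 ≤ 1 + z)]

theorem sum_powerset_two_le {α : Type*} (T : Finset α) {b : ℝ} (hb : 0 ≤ b) :
    ∑ J ∈ T.powerset, (if J.card < 2 then 0 else b ^ J.card) ≤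
      (T.card * b) ^ 2 * Real.exp (T.card * b) := by
  refine le_trans ?_ (exp_sub_one_sub_le (by positivity))
  have h1 : ∑ J ∈ T.powerset, b ^ J.card ≤ Real.exp (T.card * b) := by
    have := Finset.sum_pow_mul_eq_add_pow b 1 T
    simp only [one_pow, mul_one] at this
    rw [this, Real.exp_nat_mul]
    exact pow_le_pow_left₀ (by positivity) (Real.add_one_le_exp b) _
  have h2 : ∑ J ∈ T.powerset, (if J.card = 0 then (1 : ℝ) else 0) = 1 := by
    rw [Finset.sum_powerset_apply_card (fun j : ℕ => if j = 0 then (1 : ℝ) else 0)]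
    simp
  have h3 : ∑ J ∈ T.powerset, (if J.card = 1 then b else 0) = T.card * b := by
    rw [Finset.sum_powerset_apply_card (fun j : ℕ => if j = 1 then b else 0)]
    rcases Nat.eq_zero_or_pos T.card with h | h
    · simp [h]
    · simp [h]
  have h4 : ∀ J ∈ T.powerset, (if J.card < 2 then 0 else b ^ J.card) =
      b ^ J.card - (if J.card = 0 then (1 : ℝ) else 0) - (if J.card = 1 then b else 0) := by
    intro J _
    rcases Nat.lt_or_ge J.card 2 with h | h
    · interval_cases h5 : J.card <;> simp
    · have h6 : J.card ≠ 0 := by omega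
      have h7 : J.card ≠ 1 := by omega
      simp [h.not_gt, h6, h7]
  rw [Finset.sum_congr rfl h4, Finset.sum_sub_distrib, Finset.sum_sub_distrib, h2, h3]
  linarith

/-- The empty character gives the 1 and degree one vanishes under the global spin flip. The sum thus
starts at degree two, which is why the error is quadratic in the overlap. -/
theorem overlapProduct_zero_le {n : ℕ} {μ : Measure ℝ} [IsProbabilityMeasure μ]
    (hsymm : μ.map (fun h : ℝ => -h) = μ) (θ : ℝ) {S S' : Finset (Fin n)} {k : ℕ}
    (hS : S.card = k) (hS' : S'.card = k) (hr : 2 * (S ∩ S').card ≤ k) :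
    overlapProduct μ θ 0 S S' ≤ 1 + ∑ σ, ∑ σ', plantedLaw μ θ S σ * plantedLaw μ θ S' σ' *
      (((S ∩ S').card * (8 * ((blockSum S σ / k) ^ 2 + (blockSum S' σ' / k) ^ 2) +
        16 * ((S ∩ S').card / k))) ^ 2 *
      Real.exp ((S ∩ S').card * (8 * ((blockSum S σ / k) ^ 2 + (blockSum S' σ' / k) ^ 2) +
        16 * ((S ∩ S').card / k)))) := by
  have ht : ∀ S : Finset (Fin n), tiltedLaw μ θ 0 S = plantedLaw μ θ S := by
    intro S; ext σ; simp [tiltedLaw]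
  rw [overlapProduct_eq hsymm]
  set r := (S ∩ S').card with hrdef
  set b : (Fin n → Bool) → (Fin n → Bool) → ℝ := fun σ σ' =>
    8 * ((blockSum S σ / k) ^ 2 + (blockSum S' σ' / k) ^ 2) + 16 * ((r : ℝ) / k) with hb
  have hb0 : ∀ σ σ', 0 ≤ b σ σ' := fun σ σ' => by positivity
  have h1 : ∀ J ∈ (S ∩ S').powerset,
      (∑ σ, tiltedLaw μ θ 0 S σ * walsh J σ) * ∑ σ, tiltedLaw μ θ 0 S' σ * walsh J σ ≤
      (if J = ∅ then 1 else 0) + ∑ σ, ∑ σ', plantedLaw μ θ S σ * plantedLaw μ θ S' σ' *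
        (if J.card < 2 then 0 else b σ σ' ^ J.card) := by
    intro J hJ
    rcases eq_or_ne J ∅ with rfl | hne
    · simp [walsh, ht, sum_plantedLaw]
    · rw [if_neg hne, zero_add]
      rcases Nat.lt_or_ge J.card 2 with h | h
      · have hc : J.card = 1 := by
          have := Finset.card_pos.2 (Finset.nonempty_iff_ne_empty.2 hne)
          omega
        rw [sum_tiltedLaw_mul_walsh_eq_zero_of_odd hsymm θ 0 (by rw [hc]; exact odd_one)]
        simp [h]
      · have hle := Finset.card_le_card (Finset.mem_powerset.1 hJ)
        have := walsh_coeff_mul_le μ θ 0 hS hS' (Finset.mem_powerset.1 hJ) (R := r)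
          (by exact_mod_cast hle) (by exact_mod_cast hr)
        simp only [if_neg h.not_gt]
        simpa only [ht] using this
  refine (Finset.sum_le_sum h1).trans ?_
  rw [Finset.sum_add_distrib]
  refine add_le_add (by rw [Finset.sum_ite_eq', if_pos (Finset.empty_mem_powerset _)]) ?_
  rw [Finset.sum_comm]
  refine Finset.sum_le_sum fun σ _ => ?_
  rw [Finset.sum_comm]
  refine Finset.sum_le_sum fun σ' _ => ?_
  rw [← Finset.mul_sum]
  exact mul_le_mul_of_nonneg_left (sum_powerset_two_le (S ∩ S') (hb0 σ σ'))
    (mul_nonneg (plantedLaw_nonneg μ θ S σ) (plantedLaw_nonneg μ θ S' σ'))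

/-! ### Small overlaps under a moment bound at the critical scale. -/

/-- Uniform exponential moment bound for the squared magnetization of the clique under the planted
law, on the critical scale `k ^ (-γ)`. -/
def MagnetizationMomentBound (μ : Measure ℝ) (θ γ c C : ℝ) : Prop :=
  ∀ (n : ℕ) (S : Finset (Fin n)), S.Nonempty →
    ∑ σ, plantedLaw μ θ S σ *
      Real.exp (c * ((S.card : ℝ) ^ γ * (blockSum S σ / S.card) ^ 2)) ≤ C

/-- The exponent `c u / 2` is split in two: one quarter of `c u` dominates `exp (8 ρ u)`, the other
absorbs `u ^ 2`; `2048 = 64 * 32`. -/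
theorem sq_mul_exp_le {c ρ u : ℝ} (hc : 0 < c) (hρc : 32 * ρ ≤ c) (hu : 0 ≤ u) :
    (8 * ρ * u) ^ 2 * Real.exp (8 * ρ * u) ≤ 2048 / c ^ 2 * ρ ^ 2 * Real.exp (c * u / 2) := by
  have h1 : (c * u / 4) ^ 2 / 2 ≤ Real.exp (c * u / 4) := by
    have := Real.pow_div_factorial_le_exp (c * u / 4) (by positivity) 2
    simpa using this
  have h2 : Real.exp (8 * ρ * u) ≤ Real.exp (c * u / 4) := by
    apply Real.exp_le_exp.2
    nlinarith
  have h3 : Real.exp (c * u / 2) = Real.exp (c * u / 4) * Real.exp (c * u / 4) := by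
    rw [← Real.exp_add]; ring_nf
  have h4 : u ^ 2 ≤ 32 / c ^ 2 * Real.exp (c * u / 4) := by
    rw [div_mul_eq_mul_div, le_div_iff₀ (by positivity)]
    nlinarith
  calc (8 * ρ * u) ^ 2 * Real.exp (8 * ρ * u)
      = 64 * ρ ^ 2 * (u ^ 2 * Real.exp (8 * ρ * u)) := by ring
    _ ≤ 64 * ρ ^ 2 * (32 / c ^ 2 * Real.exp (c * u / 4) * Real.exp (c * u / 4)) := by
        gcongr
    _ = _ := by rw [h3]; ring

theorem overlapProduct_zero_le_of_momentBound {μ : Measure ℝ} [IsProbabilityMeasure μ]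
    (hsymm : μ.map (fun h : ℝ => -h) = μ) {θ γ c C : ℝ} (hγ : γ ≤ 1 / 2) (hc : 0 < c)
    (hM : MagnetizationMomentBound μ θ γ c C) {n k : ℕ} (hk : 0 < k) {S S' : Finset (Fin n)}
    (hS : S.card = k) (hS' : S'.card = k)
    (hr : (S ∩ S').card * (k : ℝ) ^ (-γ) ≤ min (1 / 2) (c / 32)) :
    overlapProduct μ θ 0 S S' ≤
      1 + 2048 / c ^ 2 * Real.exp c * C ^ 2 * ((S ∩ S').card * (k : ℝ) ^ (-γ)) ^ 2 := by
  have hk' : (1 : ℝ) ≤ k := by exact_mod_cast hk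
  have hk0 : (0 : ℝ) < k := by linarith
  set r := (S ∩ S').card with hrdef
  set ρ := (r : ℝ) * (k : ℝ) ^ (-γ) with hρ
  have hρ0 : 0 ≤ ρ := by positivity
  have hγk : (k : ℝ) ^ (-γ) * (k : ℝ) ^ γ = 1 := by
    rw [← Real.rpow_add hk0]; simp
  have hrρ : ρ * (k : ℝ) ^ γ = (r : ℝ) := by rw [hρ, mul_assoc, hγk, mul_one]
  clear_value ρ r
  have hkγ : (k : ℝ) ^ γ ≤ k := by
    calc (k : ℝ) ^ γ ≤ (k : ℝ) ^ (1 : ℝ) := Real.rpow_le_rpow_of_exponent_le hk' (by linarith)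
      _ = k := Real.rpow_one _
  have hkγ2 : (k : ℝ) ^ γ * (k : ℝ) ^ γ ≤ k := by
    calc (k : ℝ) ^ γ * (k : ℝ) ^ γ = (k : ℝ) ^ (γ + γ) := (Real.rpow_add hk0 _ _).symm
      _ ≤ (k : ℝ) ^ (1 : ℝ) := Real.rpow_le_rpow_of_exponent_le hk' (by linarith)
      _ = k := Real.rpow_one _
  have hkγ0 : 0 < (k : ℝ) ^ γ := by positivity
  have h2r : 2 * r ≤ k := by
    have h1 := hr.trans (min_le_left _ _)
    have : 2 * (r : ℝ) ≤ k := by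
      rw [← hrρ]
      nlinarith
    exact_mod_cast this
  have key := overlapProduct_zero_le hsymm θ hS hS' (by rwa [← hrdef])
  rw [← hrdef] at key
  refine key.trans (add_le_add le_rfl ?_)
  have hpt : ∀ σ σ', plantedLaw μ θ S σ * plantedLaw μ θ S' σ' *
      ((r * (8 * ((blockSum S σ / k) ^ 2 + (blockSum S' σ' / k) ^ 2) +
        16 * ((r : ℝ) / k))) ^ 2 *
      Real.exp (r * (8 * ((blockSum S σ / k) ^ 2 + (blockSum S' σ' / k) ^ 2) +
        16 * ((r : ℝ) / k)))) ≤
      2048 / c ^ 2 * Real.exp c * ρ ^ 2 *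
        ((plantedLaw μ θ S σ * Real.exp (c * ((k : ℝ) ^ γ * (blockSum S σ / k) ^ 2))) *
        (plantedLaw μ θ S' σ' * Real.exp (c * ((k : ℝ) ^ γ * (blockSum S' σ' / k) ^ 2)))) := by
    intro σ σ'
    set a := (blockSum S σ / k) ^ 2 with ha
    set b := (blockSum S' σ' / k) ^ 2 with hb
    have ha0 : 0 ≤ a := sq_nonneg _
    have hb0 : 0 ≤ b := sq_nonneg _
    -- The summand 2 accounts for the term `16 r / k` of the Walsh scale. Since `γ ≤ 1 / 2` and `ρ ≤
    -- 1`, `r k ^ γ / k = ρ k ^ (2 γ) / k ≤ 1`.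
    set u := (k : ℝ) ^ γ * a + (k : ℝ) ^ γ * b + 2 with hu
    have hu0 : 0 ≤ u := by positivity
    have hz : r * (8 * (a + b) + 16 * ((r : ℝ) / k)) ≤ 8 * ρ * u := by
      have h1 : (r : ℝ) * ((k : ℝ) ^ γ / k) ≤ 1 := by
        have h2 : ρ ≤ 1 := by linarith [hr.trans (min_le_left _ _)]
        rw [← hrρ, ← mul_div_assoc, div_le_one hk0]
        nlinarith
      have h3 : r * (8 * (a + b) + 16 * ((r : ℝ) / k)) =
          8 * ρ * ((k : ℝ) ^ γ * a + (k : ℝ) ^ γ * b + 2 * (r * ((k : ℝ) ^ γ / k))) := by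
        conv_lhs => rw [← hrρ]
        conv_rhs => rw [← hrρ]
        ring
      rw [h3]
      refine mul_le_mul_of_nonneg_left ?_ (by positivity)
      linarith
    have hz0 : 0 ≤ r * (8 * (a + b) + 16 * ((r : ℝ) / k)) := by positivity
    have h5 : (r * (8 * (a + b) + 16 * ((r : ℝ) / k))) ^ 2 *
        Real.exp (r * (8 * (a + b) + 16 * ((r : ℝ) / k))) ≤
        2048 / c ^ 2 * ρ ^ 2 * Real.exp (c * u / 2) := by
      refine le_trans ?_ (sq_mul_exp_le hc
        (by have := hr.trans (min_le_right _ _); linarith) hu0)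
      gcongr
    have h6 : Real.exp (c * u / 2) ≤ Real.exp c *
        (Real.exp (c * ((k : ℝ) ^ γ * a)) * Real.exp (c * ((k : ℝ) ^ γ * b))) := by
      rw [← Real.exp_add, ← Real.exp_add]
      apply Real.exp_le_exp.2
      have : 0 ≤ c * ((k : ℝ) ^ γ * a) := by positivity
      have : 0 ≤ c * ((k : ℝ) ^ γ * b) := by positivity
      rw [hu]
      linarith
    calc _ ≤ plantedLaw μ θ S σ * plantedLaw μ θ S' σ' *
          (2048 / c ^ 2 * ρ ^ 2 * (Real.exp c *
        (Real.exp (c * ((k : ℝ) ^ γ * a)) * Real.exp (c * ((k : ℝ) ^ γ * b))))) := by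
          refine mul_le_mul_of_nonneg_left (h5.trans ?_)
            (mul_nonneg (plantedLaw_nonneg μ θ S σ) (plantedLaw_nonneg μ θ S' σ'))
          exact mul_le_mul_of_nonneg_left h6 (by positivity)
      _ = _ := by ring
  refine (Finset.sum_le_sum fun σ _ => Finset.sum_le_sum fun σ' _ => hpt σ σ').trans ?_
  simp only [← Finset.mul_sum]
  rw [← Finset.sum_mul]
  have m1 := hM n S (Finset.card_pos.1 (by omega))
  have m2 := hM n S' (Finset.card_pos.1 (by omega))
  rw [hS] at m1
  rw [hS'] at m2
  have p2 : 0 ≤ ∑ σ, plantedLaw μ θ S' σ *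
      Real.exp (c * ((k : ℝ) ^ γ * (blockSum S' σ / k) ^ 2)) :=
    Finset.sum_nonneg fun σ _ => mul_nonneg (plantedLaw_nonneg μ θ S' σ) (Real.exp_pos _).le
  have p1 : 0 ≤ ∑ σ, plantedLaw μ θ S σ *
      Real.exp (c * ((k : ℝ) ^ γ * (blockSum S σ / k) ^ 2)) :=
    Finset.sum_nonneg fun σ _ => mul_nonneg (plantedLaw_nonneg μ θ S σ) (Real.exp_pos _).le
  calc _ ≤ 2048 / c ^ 2 * Real.exp c * ρ ^ 2 * (C * C) := by
        refine mul_le_mul_of_nonneg_left (mul_le_mul m1 m2 p2 (p1.trans m1)) (by positivity)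
    _ = _ := by ring

/-! ### Truncated likelihood ratios of `m` samples. -/

/-- The joint law of `m` observations, restricted to the event that the empirical second moment of
the magnetization of the clique is at most `W`. -/
noncomputable def truncatedLaw {n m : ℕ} (μ : Measure ℝ) (θ W : ℝ) (S : Finset (Fin n))
    (x : Fin m → Fin n → Bool) : ℝ :=
  if ∑ j, (blockSum S (x j) / S.card) ^ 2 ≤ W then ∏ j, plantedLaw μ θ S (x j) else 0

theorem sum_prod_eq_pow {α : Type*} [Fintype α] [DecidableEq α] (m : ℕ) (f : α → ℝ) :
    ∑ x : Fin m → α, ∏ j, f (x j) = (∑ a, f a) ^ m := by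
  have := (Finset.prod_univ_sum (fun _ : Fin m => (Finset.univ : Finset α))
    (fun _ a => f a)).symm
  rw [Fintype.piFinset_univ] at this
  simp [this]

theorem truncatedLaw_nonneg {n m : ℕ} (μ : Measure ℝ) (θ W : ℝ) (S : Finset (Fin n))
    (x : Fin m → Fin n → Bool) : 0 ≤ truncatedLaw μ θ W S x := by
  unfold truncatedLaw
  split_ifs
  · exact Finset.prod_nonneg fun j _ => plantedLaw_nonneg μ θ S _
  · exact le_rfl

theorem truncatedLaw_le {n m : ℕ} (μ : Measure ℝ) (θ W : ℝ) (S : Finset (Fin n))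
    (x : Fin m → Fin n → Bool) : truncatedLaw μ θ W S x ≤ ∏ j, plantedLaw μ θ S (x j) := by
  unfold truncatedLaw
  split_ifs
  · exact le_rfl
  · exact Finset.prod_nonneg fun j _ => plantedLaw_nonneg μ θ S _

theorem truncatedLaw_le_tilted {n m : ℕ} (μ : Measure ℝ) (θ W : ℝ) {lam : ℝ} (hlam : 0 ≤ lam)
    (S : Finset (Fin n)) (x : Fin m → Fin n → Bool) :
    truncatedLaw μ θ W S x ≤ Real.exp (lam * W) * ∏ j, tiltedLaw μ θ lam S (x j) := by
  unfold truncatedLaw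
  split_ifs with h
  · simp only [tiltedLaw]
    rw [Finset.prod_mul_distrib, ← Real.exp_sum, mul_left_comm, ← Real.exp_add, ← Finset.mul_sum]
    refine le_mul_of_one_le_right (Finset.prod_nonneg fun j _ => plantedLaw_nonneg μ θ S _)
      (Real.one_le_exp ?_)
    nlinarith
  · exact mul_nonneg (Real.exp_pos _).le (Finset.prod_nonneg fun j _ => tiltedLaw_nonneg _ _ _ _ _)

/-- On the truncation event the indicator is at most `exp (lam * (W - ∑ ...))`. This replaces a
constraint coupling the samples by a product of tilted laws, and the sum factorizes; `W` is paid
once for each clique. -/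
theorem sum_truncatedLaw_mul_le {n m : ℕ} (μ : Measure ℝ) (θ W : ℝ) {lam : ℝ} (hlam : 0 ≤ lam)
    (S S' : Finset (Fin n)) :
    (2 ^ n) ^ m * ∑ x : Fin m → Fin n → Bool, truncatedLaw μ θ W S x * truncatedLaw μ θ W S' x ≤
      Real.exp (2 * lam * W) * overlapProduct μ θ lam S S' ^ m := by
  have h1 : ∑ x : Fin m → Fin n → Bool, truncatedLaw μ θ W S x * truncatedLaw μ θ W S' x ≤
      ∑ x : Fin m → Fin n → Bool, Real.exp (2 * lam * W) *
        ∏ j, (tiltedLaw μ θ lam S (x j) * tiltedLaw μ θ lam S' (x j)) := by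
    refine Finset.sum_le_sum fun x _ => ?_
    refine (mul_le_mul (truncatedLaw_le_tilted μ θ W hlam S x)
      (truncatedLaw_le_tilted μ θ W hlam S' x) (truncatedLaw_nonneg μ θ W S' x) ?_).trans_eq ?_
    · exact mul_nonneg (Real.exp_pos _).le
        (Finset.prod_nonneg fun j _ => tiltedLaw_nonneg _ _ _ _ _)
    · rw [mul_mul_mul_comm, ← Real.exp_add, Finset.prod_mul_distrib]
      ring_nf
  refine (mul_le_mul_of_nonneg_left h1 (by positivity)).trans_eq ?_
  rw [← Finset.mul_sum, sum_prod_eq_pow m fun σ => tiltedLaw μ θ lam S σ * tiltedLaw μ θ lam S' σ,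
    overlapProduct, mul_pow]
  ring

/-- Chernoff's bound for the discarded event, with the exponential moment at the critical scale. -/
theorem one_sub_le_sum_truncatedLaw {μ : Measure ℝ} [IsProbabilityMeasure μ] {θ γ c C D : ℝ}
    (hc : 0 < c) (hM : MagnetizationMomentBound μ θ γ c C) {n m k : ℕ} (hk : 0 < k)
    {S : Finset (Fin n)} (hS : S.card = k) :
    1 - (C * Real.exp (-c * D)) ^ m ≤
      ∑ x : Fin m → Fin n → Bool, truncatedLaw μ θ (D * m * (k : ℝ) ^ (-γ)) S x := by
  have hk0 : (0 : ℝ) < k := by exact_mod_cast hk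
  have hγk : (k : ℝ) ^ γ * (k : ℝ) ^ (-γ) = 1 := by
    rw [← Real.rpow_add hk0]; simp
  set W := D * m * (k : ℝ) ^ (-γ) with hW
  have h1 : ∀ x : Fin m → Fin n → Bool, ∏ j, plantedLaw μ θ S (x j) - truncatedLaw μ θ W S x ≤
      Real.exp (-c * D * m) * ∏ j, (plantedLaw μ θ S (x j) *
        Real.exp (c * ((k : ℝ) ^ γ * (blockSum S (x j) / k) ^ 2))) := by
    intro x
    have hp : 0 ≤ ∏ j, plantedLaw μ θ S (x j) :=
      Finset.prod_nonneg fun j _ => plantedLaw_nonneg μ θ S _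
    unfold truncatedLaw
    rw [Finset.prod_mul_distrib, ← Real.exp_sum, mul_left_comm, ← Real.exp_add, ← Finset.mul_sum,
      ← Finset.mul_sum]
    split_ifs with h
    · rw [sub_self]; positivity
    · rw [sub_zero]
      refine le_mul_of_one_le_right hp (Real.one_le_exp ?_)
      rw [hS, not_le] at h
      have h2 := mul_le_mul_of_nonneg_left h.le (by positivity : 0 ≤ (k : ℝ) ^ γ)
      have h3 : (k : ℝ) ^ γ * W = D * m := by
        rw [hW, mul_left_comm, hγk, mul_one]
      rw [h3] at h2
      nlinarith
  have h2 := Finset.sum_le_sum fun (x : Fin m → Fin n → Bool) (_ : x ∈ Finset.univ) => h1 x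
  rw [Finset.sum_sub_distrib, sum_prod_eq_pow, sum_plantedLaw, one_pow, ← Finset.mul_sum,
    sum_prod_eq_pow m fun σ => plantedLaw μ θ S σ *
      Real.exp (c * ((k : ℝ) ^ γ * (blockSum S σ / k) ^ 2))] at h2
  have m1 := hM n S (Finset.card_pos.1 (by omega))
  rw [hS] at m1
  have p1 : 0 ≤ ∑ σ, plantedLaw μ θ S σ *
      Real.exp (c * ((k : ℝ) ^ γ * (blockSum S σ / k) ^ 2)) :=
    Finset.sum_nonneg fun σ _ => mul_nonneg (plantedLaw_nonneg μ θ S σ) (Real.exp_pos _).le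
  have h3 : Real.exp (-c * D * m) * (∑ σ, plantedLaw μ θ S σ *
      Real.exp (c * ((k : ℝ) ^ γ * (blockSum S σ / k) ^ 2))) ^ m ≤
      (C * Real.exp (-c * D)) ^ m := by
    rw [mul_pow, ← Real.exp_nat_mul, mul_comm]
    have : (m : ℝ) * (-c * D) = -c * D * m := by ring
    rw [this]
    exact mul_le_mul_of_nonneg_right (pow_le_pow_left₀ p1 m1 m) (Real.exp_pos _).le
  linarith

/-- Second moment of the truncated likelihood ratio for small overlaps. -/
theorem sum_truncatedLaw_mul_le_of_small {μ : Measure ℝ} [IsProbabilityMeasure μ]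
    (hsymm : μ.map (fun h : ℝ => -h) = μ) {θ γ c C W : ℝ} (hγ : γ ≤ 1 / 2)
    (hc : 0 < c) (hM : MagnetizationMomentBound μ θ γ c C) {n m k : ℕ} (hk : 0 < k)
    {S S' : Finset (Fin n)} (hS : S.card = k) (hS' : S'.card = k)
    (hr : (S ∩ S').card * (k : ℝ) ^ (-γ) ≤ min (1 / 2) (c / 32)) :
    (2 ^ n) ^ m * ∑ x : Fin m → Fin n → Bool, truncatedLaw μ θ W S x * truncatedLaw μ θ W S' x ≤
      Real.exp (2048 / c ^ 2 * Real.exp c * C ^ 2 * m *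
        ((S ∩ S').card * (k : ℝ) ^ (-γ)) ^ 2) := by
  refine (sum_truncatedLaw_mul_le μ θ W le_rfl S S').trans ?_
  have h := overlapProduct_zero_le_of_momentBound hsymm hγ hc hM hk hS hS' hr
  rw [mul_zero, zero_mul, Real.exp_zero, one_mul]
  refine (pow_le_pow_left₀ (overlapProduct_nonneg _ _ _ _ _) (h.trans (?_ : _ ≤ Real.exp
    (2048 / c ^ 2 * Real.exp c * C ^ 2 * ((S ∩ S').card * (k : ℝ) ^ (-γ)) ^ 2))) m).trans_eq ?_
  · linarith [Real.add_one_le_exp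
      (2048 / c ^ 2 * Real.exp c * C ^ 2 * ((S ∩ S').card * (k : ℝ) ^ (-γ)) ^ 2)]
  · rw [← Real.exp_nat_mul]
    ring_nf

/-- Second moment of the truncated likelihood ratio for large overlaps. -/
theorem sum_truncatedLaw_mul_le_of_large {μ : Measure ℝ} [IsProbabilityMeasure μ]
    (hsymm : μ.map (fun h : ℝ => -h) = μ) {θ γ c₁ D : ℝ} (hθ : 0 ≤ θ) (hc₁ : 0 < c₁) (hD : 0 ≤ D)
    {n m k : ℕ} (hk : 0 < k) {S S' : Finset (Fin n)} (hS : S.card = k) (hS' : S'.card = k)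
    (hr : c₁ ≤ (S ∩ S').card * (k : ℝ) ^ (-γ)) :
    (2 ^ n) ^ m * ∑ x : Fin m → Fin n → Bool, truncatedLaw μ θ (D * m * (k : ℝ) ^ (-γ)) S x *
        truncatedLaw μ θ (D * m * (k : ℝ) ^ (-γ)) S' x ≤
      Real.exp ((32 * D + 2 / c₁ + 192 * θ * D) * (m * ((S ∩ S').card * (k : ℝ) ^ (-γ)))) := by
  have hk0 : (0 : ℝ) < k := by exact_mod_cast hk
  set r := (S ∩ S').card with hrdef
  set g := (k : ℝ) ^ (-γ) with hg
  have hg0 : 0 < g := by positivity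
  have hm0 : (0 : ℝ) ≤ m := Nat.cast_nonneg m
  have hr0 : (0 : ℝ) ≤ r := Nat.cast_nonneg r
  -- For `r ≤ k / 192` the tilt is `16 r` and the factor `3 ^ m` is absorbed through `ρ ≥ c₁`.
  -- Otherwise the tilt is `θ k / 2`, and `k < 192 r` turns its cost back into a multiple of `r`.
  rcases le_or_gt (192 * r) k with h | h
  · refine (sum_truncatedLaw_mul_le μ θ _ (by positivity : (0 : ℝ) ≤ 16 * r) S S').trans ?_
    have h3 : overlapProduct μ θ (16 * r) S S' ^ m ≤ Real.exp (2 * m) := by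
      refine (pow_le_pow_left₀ (overlapProduct_nonneg _ _ _ _ _)
        ((overlapProduct_le_three hsymm θ hk hS hS' h).trans
          (by linarith [Real.add_one_le_exp (2 : ℝ)] : (3 : ℝ) ≤ Real.exp 2)) m).trans_eq ?_
      rw [← Real.exp_nat_mul]; ring_nf
    refine (mul_le_mul_of_nonneg_left h3 (Real.exp_pos _).le).trans ?_
    rw [← Real.exp_add]
    apply Real.exp_le_exp.2
    have h4 : 2 * (m : ℝ) ≤ 2 / c₁ * (m * (r * g)) := by
      rw [div_mul_eq_mul_div, le_div_iff₀ hc₁]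
      nlinarith
    have h5 : 0 ≤ 192 * θ * D * (m * (r * g)) := by positivity
    nlinarith
  · have h' : (k : ℝ) ≤ 192 * r := by exact_mod_cast h.le
    refine (sum_truncatedLaw_mul_le μ θ _ (by positivity : (0 : ℝ) ≤ θ * k / 2) S S').trans ?_
    have h3 : overlapProduct μ θ (θ * k / 2) S S' ^ m ≤ 1 :=
      pow_le_one₀ (overlapProduct_nonneg _ _ _ _ _) (overlapProduct_le_one hsymm hθ hk hS)
    refine (mul_le_mul_of_nonneg_left h3 (Real.exp_pos _).le).trans ?_
    rw [mul_one]
    apply Real.exp_le_exp.2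
    have h5 : 0 ≤ (32 * D + 2 / c₁) * (m * (r * g)) := by positivity
    have h6 := mul_le_mul_of_nonneg_left h' (by positivity : 0 ≤ θ * D * m * g)
    nlinarith

/-! ### From second moments to the minimax risk. -/

theorem sum_prod_plantedLaw {n m : ℕ} (μ : Measure ℝ) [IsProbabilityMeasure μ] (θ : ℝ)
    (S : Finset (Fin n)) : ∑ x : Fin m → Fin n → Bool, ∏ j, plantedLaw μ θ S (x j) = 1 := by
  rw [sum_prod_eq_pow, sum_plantedLaw, one_pow]

theorem typeIError_nonneg {n m : ℕ} (μ : Measure ℝ) (ψ : DetectionTest n m) :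
    0 ≤ typeIError μ ψ :=
  Finset.sum_nonneg fun x _ =>
    mul_nonneg (Finset.prod_nonneg fun _ _ => plantedLaw_nonneg μ 0 ∅ _) (ψ.2 x).1

theorem typeIIError_nonneg {n m : ℕ} (μ : Measure ℝ) (θ : ℝ) (S : Finset (Fin n))
    (ψ : DetectionTest n m) : 0 ≤ typeIIError μ θ S ψ :=
  Finset.sum_nonneg fun x _ =>
    mul_nonneg (Finset.prod_nonneg fun _ _ => plantedLaw_nonneg μ θ S _)
      (sub_nonneg.2 (ψ.2 x).2)

/-- The test that never rejects has risk at most one. -/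
theorem minimaxRisk_le_one (μ : Measure ℝ) [IsProbabilityMeasure μ] (θ : ℝ) (n k m : ℕ) :
    minimaxRisk μ θ n k m ≤ 1 := by
  have hb : BddBelow (Set.range fun ψ : DetectionTest n m => testRisk μ θ k ψ) := by
    refine ⟨0, ?_⟩
    rintro _ ⟨ψ, rfl⟩
    exact add_nonneg (typeIError_nonneg μ ψ)
      (Real.iSup_nonneg fun S => typeIIError_nonneg μ θ S.1 ψ)
  refine (ciInf_le hb ⟨fun _ => 0, fun _ => by simp⟩).trans ?_
  unfold testRisk
  have h1 : typeIError μ (⟨fun _ => 0, fun _ => by simp⟩ : DetectionTest n m) = 0 := by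
    simp [typeIError]
  rw [h1, zero_add]
  refine Real.iSup_le (fun S => ?_) zero_le_one
  simp [typeIIError, sum_prod_plantedLaw]

/-- The worst type II error dominates its average over cliques, even with truncated laws. The risk
is therefore at least one minus the `L¹` distance between the null law and the truncated mixture,
and Cauchy-Schwarz against the uniform law bounds that distance by an `L²` quantity. The loss of
mass enters as `2 a` through the cross term. -/
theorem one_sub_sqrt_le_minimaxRisk {μ : Measure ℝ} [IsProbabilityMeasure μ]
    (hsymm : μ.map (fun h : ℝ => -h) = μ) (θ : ℝ) {n k m : ℕ} (hkn : k ≤ n) {W a χ : ℝ}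
    (hmass : ∀ S : Finset (Fin n), S.card = k →
      1 - a ≤ ∑ x : Fin m → Fin n → Bool, truncatedLaw μ θ W S x)
    (hsecond : ∀ S : Finset (Fin n), S.card = k →
      ∑ S' ∈ Finset.powersetCard k (Finset.univ : Finset (Fin n)),
        (2 ^ n) ^ m * ∑ x : Fin m → Fin n → Bool,
          truncatedLaw μ θ W S x * truncatedLaw μ θ W S' x ≤ (1 + χ) * n.choose k) :
    1 - √(χ + 2 * a) ≤ minimaxRisk μ θ n k m := by
  have : Nonempty (DetectionTest n m) := ⟨⟨fun _ => 0, fun _ => by simp⟩⟩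
  refine le_ciInf fun ψ => ?_
  set 𝒮 := Finset.powersetCard k (Finset.univ : Finset (Fin n)) with h𝒮
  have hcard : 𝒮.card = n.choose k := by simp [h𝒮]
  have hN : (0 : ℝ) < n.choose k := by exact_mod_cast Nat.choose_pos hkn
  set N : ℝ := (n.choose k : ℝ) with hNdef
  have hmem : ∀ S ∈ 𝒮, S.card = k := fun S hS => (Finset.mem_powersetCard.1 hS).2
  set q : ℝ := ((1 / 2) ^ n) ^ m with hq
  set pbar : (Fin m → Fin n → Bool) → ℝ := fun x => (∑ S ∈ 𝒮, truncatedLaw μ θ W S x) / N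
    with hpbar
  have hXq : ((2 : ℝ) ^ n) ^ m * q = 1 := by
    rw [hq, ← mul_pow, ← mul_pow]; norm_num
  have hX : (Fintype.card (Fin m → Fin n → Bool) : ℝ) = (2 ^ n) ^ m := by
    simp
  have hsumq : ∑ _x : Fin m → Fin n → Bool, q = 1 := by
    rw [Finset.sum_const, Finset.card_univ, nsmul_eq_mul, hX, hXq]
  -- average of the type II errors
  have hII : ∑ x : Fin m → Fin n → Bool, pbar x * (1 - ψ.1 x) ≤
      ⨆ S : {S : Finset (Fin n) // S.card = k}, typeIIError μ θ S.1 ψ := by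
    have h1 : ∀ S ∈ 𝒮, ∑ x : Fin m → Fin n → Bool, truncatedLaw μ θ W S x * (1 - ψ.1 x) ≤
        ⨆ S : {S : Finset (Fin n) // S.card = k}, typeIIError μ θ S.1 ψ := by
      intro S hS
      refine le_trans ?_ (le_ciSup (f := fun S : {S : Finset (Fin n) // S.card = k} =>
        typeIIError μ θ S.1 ψ) (Set.finite_range _).bddAbove ⟨S, hmem S hS⟩)
      exact Finset.sum_le_sum fun x _ =>
        mul_le_mul_of_nonneg_right (truncatedLaw_le μ θ W S x) (sub_nonneg.2 (ψ.2 x).2)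
    have h2 := Finset.sum_le_sum h1
    rw [Finset.sum_const, hcard, nsmul_eq_mul, Finset.sum_comm] at h2
    have h3 : ∑ x : Fin m → Fin n → Bool, pbar x * (1 - ψ.1 x) =
        (∑ x : Fin m → Fin n → Bool, ∑ S ∈ 𝒮, truncatedLaw μ θ W S x * (1 - ψ.1 x)) / N := by
      rw [Finset.sum_div]
      refine Finset.sum_congr rfl fun x _ => ?_
      rw [hpbar, ← Finset.sum_mul]
      ring
    rw [h3, div_le_iff₀ hN]
    linarith
  have hI : typeIError μ ψ = ∑ x, q * ψ.1 x := by
    simp [typeIError, nullLaw_eq hsymm, hq]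
  have hrisk : 1 - ∑ x, |q - pbar x| ≤ testRisk μ θ k ψ := by
    unfold testRisk
    refine le_trans ?_ (add_le_add le_rfl hII)
    suffices h0 : ∑ x, (q - |q - pbar x|) ≤ ∑ x, (q * ψ.1 x + pbar x * (1 - ψ.1 x)) by
      rw [Finset.sum_sub_distrib, hsumq, Finset.sum_add_distrib] at h0
      rwa [hI]
    refine Finset.sum_le_sum fun x _ => ?_
    have h1 := (ψ.2 x).1
    have h2 := (ψ.2 x).2
    have h3 := le_abs_self (q - pbar x)
    have h4 := abs_nonneg (q - pbar x)
    nlinarith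
  refine le_trans (sub_le_sub_left ?_ 1) hrisk
  apply Real.le_sqrt_of_sq_le
  have hcs := sq_sum_le_card_mul_sum_sq (s := (Finset.univ : Finset (Fin m → Fin n → Bool)))
    (f := fun x => |q - pbar x|)
  refine hcs.trans ?_
  rw [Finset.card_univ, hX]
  have hmassbar : 1 - a ≤ ∑ x, pbar x := by
    have h1 := Finset.sum_le_sum fun S (hS : S ∈ 𝒮) => hmass S (hmem S hS)
    rw [Finset.sum_const, hcard, nsmul_eq_mul, Finset.sum_comm] at h1
    rw [hpbar, ← Finset.sum_div, le_div_iff₀ hN]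
    linarith
  have hsq : ((2 : ℝ) ^ n) ^ m * ∑ x, pbar x ^ 2 ≤ 1 + χ := by
    have h1 := Finset.sum_le_sum fun S (hS : S ∈ 𝒮) => hsecond S (hmem S hS)
    rw [Finset.sum_const, hcard, nsmul_eq_mul] at h1
    have h2 : ((2 : ℝ) ^ n) ^ m * ∑ x, pbar x ^ 2 =
        (∑ S ∈ 𝒮, ∑ S' ∈ 𝒮, (2 ^ n) ^ m * ∑ x : Fin m → Fin n → Bool,
          truncatedLaw μ θ W S x * truncatedLaw μ θ W S' x) / (N * N) := by
      simp only [← Finset.mul_sum]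
      rw [mul_div_assoc]
      congr 1
      rw [Finset.sum_congr rfl fun S _ => Finset.sum_comm, Finset.sum_comm, Finset.sum_div]
      refine Finset.sum_congr rfl fun x _ => ?_
      rw [hpbar, ← Finset.sum_mul_sum, div_pow]
      ring
    rw [h2, div_le_iff₀ (by positivity)]
    linarith
  have hexp : ((2 : ℝ) ^ n) ^ m * ∑ x, |q - pbar x| ^ 2 =
      1 - 2 * ∑ x, pbar x + ((2 : ℝ) ^ n) ^ m * ∑ x, pbar x ^ 2 := by
    have h1 : ∀ x, |q - pbar x| ^ 2 = q * q - 2 * q * pbar x + pbar x ^ 2 := by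
      intro x; rw [sq_abs]; ring
    simp only [h1]
    rw [Finset.sum_add_distrib, Finset.sum_sub_distrib, ← Finset.mul_sum, ← Finset.mul_sum, hsumq]
    linear_combination (1 - 2 * ∑ x, pbar x) * hXq
  rw [hexp]
  linarith

/-- Treated apart because the quantitative estimates assume `1 ≤ m`. -/
theorem minimaxRisk_zero_samples {μ : Measure ℝ} [IsProbabilityMeasure μ]
    (hsymm : μ.map (fun h : ℝ => -h) = μ) (θ : ℝ) {n k : ℕ} (hkn : k ≤ n) :
    minimaxRisk μ θ n k 0 = 1 := by
  refine le_antisymm (minimaxRisk_le_one μ θ n k 0) ?_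
  have := one_sub_sqrt_le_minimaxRisk hsymm θ (m := 0) hkn (W := 0) (a := 0) (χ := 0)
    (fun S _ => by simp [truncatedLaw]) (fun S _ => by simp [truncatedLaw])
  simpa using this

/-! ### The law of the overlap of two cliques. -/

/-- The intersection is chosen first, then the other sites outside it. These are allowed to meet `S`
again, so the count is only an upper bound, but one whose ratio to `n.choose k` is simple. -/
theorem card_filter_inter_card_le {n k : ℕ} (S : Finset (Fin n)) (hS : S.card = k) (r : ℕ) :
    ((Finset.powersetCard k (Finset.univ : Finset (Fin n))).filter
      fun S' => (S ∩ S').card = r).card ≤ k.choose r * (n - r).choose (k - r) := by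
  have hsub : (Finset.powersetCard k (Finset.univ : Finset (Fin n))).filter
      (fun S' => (S ∩ S').card = r) ⊆
      (S.powersetCard r).biUnion fun T =>
        ((Finset.univ \ T).powersetCard (k - r)).image fun U => T ∪ U := by
    intro S' hS'
    rw [Finset.mem_filter, Finset.mem_powersetCard] at hS'
    refine Finset.mem_biUnion.2 ⟨S ∩ S',
      Finset.mem_powersetCard.2 ⟨Finset.inter_subset_left, hS'.2⟩, ?_⟩
    refine Finset.mem_image.2 ⟨S' \ (S ∩ S'), Finset.mem_powersetCard.2 ⟨?_, ?_⟩, ?_⟩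
    · exact Finset.sdiff_subset_sdiff (Finset.subset_univ _) le_rfl
    · rw [Finset.card_sdiff_of_subset Finset.inter_subset_right, hS'.1.2, hS'.2]
    · exact Finset.union_sdiff_of_subset Finset.inter_subset_right
  refine (Finset.card_le_card hsub).trans (Finset.card_biUnion_le.trans ?_)
  have h1 : ∀ T ∈ S.powersetCard r,
      (((Finset.univ \ T).powersetCard (k - r)).image fun U => T ∪ U).card ≤
        (n - r).choose (k - r) := by
    intro T hT
    refine Finset.card_image_le.trans ?_
    rw [Finset.card_powersetCard, Finset.card_sdiff_of_subset (Finset.subset_univ T),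
      Finset.card_univ, Fintype.card_fin, (Finset.mem_powersetCard.1 hT).2]
  refine (Finset.sum_le_sum h1).trans ?_
  rw [Finset.sum_const, Finset.card_powersetCard, hS, smul_eq_mul]

theorem choose_sub_sub_mul_pow_le {n k : ℕ} (hkn : k ≤ n) (r : ℕ) (hr : r ≤ k) :
    (n - r).choose (k - r) * n ^ r ≤ k ^ r * n.choose k := by
  induction r with
  | zero => simp
  | succ r ih =>
    have ih := ih (by omega)
    obtain ⟨a, ha⟩ : ∃ a, n - r = a + 1 := ⟨n - r - 1, by omega⟩
    obtain ⟨b, hb⟩ : ∃ b, k - r = b + 1 := ⟨k - r - 1, by omega⟩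
    have ha' : n - (r + 1) = a := by omega
    have hb' : k - (r + 1) = b := by omega
    rw [ha, hb] at ih
    rw [ha', hb']
    have h1 := Nat.add_one_mul_choose_eq a b
    have h2 : n * (b + 1) ≤ k * (a + 1) := by
      have e1 : n = a + 1 + r := by omega
      have e2 : k = b + 1 + r := by omega
      have e3 : b ≤ a := by omega
      rw [e1, e2]
      nlinarith
    refine le_of_mul_le_mul_left ?_ (Nat.succ_pos a)
    calc (a + 1) * (a.choose b * n ^ (r + 1))
        = (a + 1) * a.choose b * n * n ^ r := by ring
      _ = n * (b + 1) * ((a + 1).choose (b + 1) * n ^ r) := by rw [h1]; ring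
      _ ≤ k * (a + 1) * (k ^ r * n.choose k) := Nat.mul_le_mul h2 ih
      _ = (a + 1) * (k ^ (r + 1) * n.choose k) := by ring

/-- The law of the overlap of a set of size `k` with a uniform random set of size `k`. -/
noncomputable def overlapLaw {n : ℕ} (k : ℕ) (S : Finset (Fin n)) (r : ℕ) : ℝ :=
  ((Finset.powersetCard k (Finset.univ : Finset (Fin n))).filter
      fun S' => (S ∩ S').card = r).card / (n.choose k : ℝ)

theorem overlapLaw_nonneg {n : ℕ} (k : ℕ) (S : Finset (Fin n)) (r : ℕ) : 0 ≤ overlapLaw k S r := by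
  unfold overlapLaw; positivity

theorem sum_overlapLaw_mul {n k : ℕ} (hkn : k ≤ n) (S : Finset (Fin n)) (hS : S.card = k)
    (F : ℕ → ℝ) :
    ∑ S' ∈ Finset.powersetCard k (Finset.univ : Finset (Fin n)), F (S ∩ S').card =
      (∑ r ∈ Finset.range (k + 1), overlapLaw k S r * F r) * n.choose k := by
  have hN : (0 : ℝ) < n.choose k := by exact_mod_cast Nat.choose_pos hkn
  rw [← Finset.sum_fiberwise_of_maps_to (t := Finset.range (k + 1))
    (g := fun S' => (S ∩ S').card), Finset.sum_mul]
  · refine Finset.sum_congr rfl fun r _ => ?_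
    rw [Finset.sum_congr rfl fun S' hS' => by rw [(Finset.mem_filter.1 hS').2], Finset.sum_const,
      nsmul_eq_mul, overlapLaw]
    field_simp
  · intro S' _
    rw [Finset.mem_range, Nat.lt_succ_iff, ← hS]
    exact Finset.card_le_card Finset.inter_subset_left

theorem sum_overlapLaw {n k : ℕ} (hkn : k ≤ n) (S : Finset (Fin n)) (hS : S.card = k) :
    ∑ r ∈ Finset.range (k + 1), overlapLaw k S r = 1 := by
  have hN : (0 : ℝ) < n.choose k := by exact_mod_cast Nat.choose_pos hkn
  have := sum_overlapLaw_mul hkn S hS fun _ => 1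
  simp only [Finset.sum_const, Finset.card_powersetCard, Finset.card_univ, Fintype.card_fin,
    nsmul_eq_mul, mul_one] at this
  exact (mul_right_cancel₀ hN.ne' (by linarith))

theorem overlapLaw_le {n k : ℕ} (hkn : k ≤ n) (hk : 0 < k) (S : Finset (Fin n)) (hS : S.card = k)
    {r : ℕ} (hr : 1 ≤ r) :
    overlapLaw k S r ≤ (Real.exp 1 * ((k : ℝ) ^ 2 / n) / r) ^ r := by
  have hN : (0 : ℝ) < n.choose k := by exact_mod_cast Nat.choose_pos hkn
  have hn : (0 : ℝ) < n := by exact_mod_cast hk.trans_le hkn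
  have hr0 : (0 : ℝ) < r := by exact_mod_cast hr
  unfold overlapLaw
  rw [div_le_iff₀ hN]
  have h0 : (((Finset.powersetCard k (Finset.univ : Finset (Fin n))).filter
      fun S' => (S ∩ S').card = r).card : ℝ) ≤ k.choose r * (n - r).choose (k - r) := by
    exact_mod_cast card_filter_inter_card_le S hS r
  refine h0.trans ?_
  rcases le_or_gt r k with hrk | hrk
  · have h1 : (k.choose r : ℝ) ≤ k ^ r / r.factorial := Nat.choose_le_pow_div r k
    have h2 : (r : ℝ) ^ r / r.factorial ≤ Real.exp 1 ^ r := by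
      rw [Real.exp_one_pow]
      exact Real.pow_div_factorial_le_exp (r : ℝ) (Nat.cast_nonneg r) r
    have h3 : ((n - r).choose (k - r) : ℝ) ≤ (k / n) ^ r * n.choose k := by
      rw [div_pow, div_mul_eq_mul_div, le_div_iff₀ (by positivity)]
      exact_mod_cast choose_sub_sub_mul_pow_le hkn r hrk
    have h4 : (k.choose r : ℝ) ≤ (Real.exp 1 * k / r) ^ r := by
      refine h1.trans ?_
      rw [div_pow, mul_pow, le_div_iff₀ (by positivity)]
      calc (k : ℝ) ^ r / r.factorial * (r : ℝ) ^ r = (r : ℝ) ^ r / r.factorial * k ^ r := by ring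
        _ ≤ _ := by gcongr
    calc (k.choose r : ℝ) * (n - r).choose (k - r)
        ≤ (Real.exp 1 * k / r) ^ r * ((k / n) ^ r * n.choose k) := by gcongr
      _ = (Real.exp 1 * ((k : ℝ) ^ 2 / n) / r) ^ r * n.choose k := by
        rw [← mul_assoc, ← mul_pow]
        congr 2
        field_simp
  · rw [Nat.choose_eq_zero_of_lt hrk]
    simp only [Nat.cast_zero, zero_mul]
    positivity

/-! ### Summation of the second moment against the Poisson tail. -/

/-- Here `M = k ^ 2 / n` and `g = k ^ γ`; the claim is that half of the tail exponent dominates the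
second-moment exponent. With `P = n ^ δ`: if `r ≥ M P` the logarithm is of order `log n` and the
local condition suffices; if `r < M P` and `M ≥ P`, then `r ≤ M ^ 2` and the global condition
suffices; otherwise `r ≤ P ^ 2` and `M ≥ 1 / P`, so `g ≥ P ^ 3` by the choice `δ = γ / 8`, and a
power of `n` is to spare. -/
theorem log_ratio_small {γ δ c₁ K₁ ε n M g m r : ℝ} (hδ : δ = γ / 8) (hγ0 : 0 < γ) (hγ1 : γ ≤ 1)
    (hK₁ : 0 ≤ K₁) (hε1 : ε * (K₁ * c₁) ≤ δ / 4) (hε2 : ε * K₁ ≤ min 1 δ)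
    (hn : 1 ≤ n) (hlog : 2 ≤ δ * Real.log n) (hM : 0 < M) (hg : g = (n * M) ^ (γ / 2))
    (hm0 : 0 ≤ m) (hm1 : m * M ^ 2 ≤ ε * g ^ 2) (hm2 : m ≤ ε * g * Real.log n) (hr1 : 1 ≤ r)
    (hrg : r ≤ c₁ * g) (hℓ : 2 ≤ Real.log (r / (Real.exp 1 * M))) :
    K₁ * m * r ≤ g ^ 2 * (Real.log (r / (Real.exp 1 * M)) / 2) := by
  have hn0 : 0 < n := by linarith
  have hδ0 : 0 < δ := by rw [hδ]; positivity
  have hg0 : 0 < g := by rw [hg]; positivity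
  have hlog0 : 0 < Real.log n := by
    by_contra h
    nlinarith
  set P := n ^ δ with hP
  have hP0 : 0 < P := by positivity
  rcases le_or_gt (M * P) r with h1 | h1
  · have h2 : δ * Real.log n - 1 ≤ Real.log (r / (Real.exp 1 * M)) := by
      have : P / Real.exp 1 ≤ r / (Real.exp 1 * M) := by
        rw [div_le_div_iff₀ (Real.exp_pos 1) (by positivity)]
        nlinarith [Real.exp_pos 1]
      have h3 := Real.log_le_log (by positivity) this
      rwa [Real.log_div hP0.ne' (Real.exp_pos 1).ne', Real.log_exp, hP, Real.log_rpow hn0] at h3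
    calc K₁ * m * r ≤ K₁ * (ε * g * Real.log n) * (c₁ * g) :=
        mul_le_mul (mul_le_mul_of_nonneg_left hm2 hK₁) hrg (by linarith)
          (mul_nonneg hK₁ (hm0.trans hm2))
      _ = g ^ 2 * (ε * (K₁ * c₁) * Real.log n) := by ring
      _ ≤ g ^ 2 * (δ / 4 * Real.log n) := by gcongr
      _ ≤ _ := by
        refine mul_le_mul_of_nonneg_left ?_ (sq_nonneg g)
        linarith
  rcases le_or_gt P M with h4 | h4
  · have h5 : r ≤ M ^ 2 := by nlinarith
    have h6 : K₁ * m * r ≤ g ^ 2 * 1 := by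
      calc K₁ * m * r ≤ K₁ * m * M ^ 2 := by gcongr
        _ = K₁ * (m * M ^ 2) := by ring
        _ ≤ K₁ * (ε * g ^ 2) := by gcongr
        _ = g ^ 2 * (ε * K₁) := by ring
        _ ≤ g ^ 2 * 1 := by
          gcongr
          exact hε2.trans (min_le_left _ _)
    refine h6.trans (mul_le_mul_of_nonneg_left (by linarith) (sq_nonneg g))
  · have h5 : r ≤ P * P := by nlinarith
    have hMP : 1 / P ≤ M := by
      rw [div_le_iff₀ hP0]; linarith
    have h6 : P * P * P ≤ g := by
      have e1 : (n * (1 / P)) ^ (γ / 2) ≤ g := by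
        rw [hg]
        gcongr
      refine le_trans ?_ e1
      rw [hP, one_div, ← Real.rpow_neg hn0.le, ← Real.rpow_add hn0, ← Real.rpow_add hn0]
      have e2 : n * n ^ (-δ) = n ^ (1 - δ) := by
        rw [sub_eq_add_neg, Real.rpow_add hn0, Real.rpow_one]
      rw [e2, ← Real.rpow_mul hn0.le]
      apply Real.rpow_le_rpow_of_exponent_le hn
      rw [hδ]
      nlinarith
    have h7 : Real.log n ≤ P / δ := Real.log_le_rpow_div hn0.le hδ0
    have h8 : Real.log n * r ≤ g / δ := by
      calc Real.log n * r ≤ P / δ * (P * P) := by gcongr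
        _ = P * P * P / δ := by ring
        _ ≤ g / δ := by gcongr
    have h9 : K₁ * m * r ≤ g ^ 2 * 1 := by
      have hε0 : 0 ≤ ε * g * Real.log n := hm0.trans hm2
      have hε0' : 0 ≤ ε := by
        by_contra hneg
        have : 0 < g * Real.log n := by positivity
        nlinarith
      calc K₁ * m * r ≤ K₁ * (ε * g * Real.log n) * r := by gcongr
        _ = ε * K₁ * g * (Real.log n * r) := by ring
        _ ≤ ε * K₁ * g * (g / δ) := by gcongr
        _ = g ^ 2 * (ε * K₁ / δ) := by ring
        _ ≤ g ^ 2 * 1 := by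
          gcongr
          rw [div_le_one hδ0]
          exact hε2.trans (min_le_right _ _)
    refine h9.trans (mul_le_mul_of_nonneg_left (by linarith) (sq_nonneg g))

/-- If `g ≥ M P` the logarithm is of order `log n` and the local condition applies. If not, `M ≥ g /
P ≥ 1 / P` forces `g ≥ P ^ 2`, whence `g ≤ M ^ 2`, and the global condition applies. -/
theorem log_ratio_large {γ δ c₁ K₂ ε n M g m r : ℝ} (hδ : δ = γ / 8) (hγ0 : 0 < γ) (hγ1 : γ ≤ 1)
    (hc₁ : 0 < c₁) (hK₂ : 0 ≤ K₂) (hε1 : ε * K₂ ≤ min 1 (δ / 4))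
    (hn : 1 ≤ n) (hlog : 1 - Real.log c₁ ≤ δ / 2 * Real.log n) (hM : 0 < M)
    (hg : g = (n * M) ^ (γ / 2)) (hg1 : 1 ≤ g)
    (hm1 : m * M ^ 2 ≤ ε * g ^ 2) (hm2 : m ≤ ε * g * Real.log n)
    (hrg : c₁ * g ≤ r) (hℓ : 2 ≤ Real.log (r / (Real.exp 1 * M))) :
    K₂ * m ≤ g * (Real.log (r / (Real.exp 1 * M)) / 2) := by
  have hn0 : 0 < n := by linarith
  have hδ0 : 0 < δ := by rw [hδ]; positivity
  have hg0 : 0 < g := by linarith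
  have hlog0 : 0 ≤ Real.log n := Real.log_nonneg hn
  set P := n ^ δ with hP
  have hP0 : 0 < P := by positivity
  rcases le_or_gt (M * P) g with h1 | h1
  · have h2 : Real.log c₁ - 1 + δ * Real.log n ≤ Real.log (r / (Real.exp 1 * M)) := by
      have : c₁ * P / Real.exp 1 ≤ r / (Real.exp 1 * M) := by
        rw [div_le_div_iff₀ (Real.exp_pos 1) (by positivity)]
        have h3 : c₁ * P * M ≤ r := by nlinarith
        nlinarith [Real.exp_pos 1]
      have h3 := Real.log_le_log (by positivity) this
      rw [Real.log_div (by positivity) (Real.exp_pos 1).ne', Real.log_exp, hP,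
        Real.log_mul hc₁.ne' (by positivity), Real.log_rpow hn0] at h3
      linarith
    calc K₂ * m ≤ K₂ * (ε * g * Real.log n) := by gcongr
      _ = g * (ε * K₂ * Real.log n) := by ring
      _ ≤ g * (δ / 4 * Real.log n) := by
        gcongr
        exact hε1.trans (min_le_right _ _)
      _ ≤ _ := by
        refine mul_le_mul_of_nonneg_left ?_ hg0.le
        linarith
  · have hMP : g / P ≤ M := by
      rw [div_le_iff₀ hP0]; linarith
    have hMP' : 1 / P ≤ M := le_trans (by gcongr) hMP
    have h6 : P * P ≤ g := by
      have e1 : (n * (1 / P)) ^ (γ / 2) ≤ g := by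
        rw [hg]
        gcongr
      refine le_trans ?_ e1
      rw [hP, one_div, ← Real.rpow_neg hn0.le, ← Real.rpow_add hn0]
      have e2 : n * n ^ (-δ) = n ^ (1 - δ) := by
        rw [sub_eq_add_neg, Real.rpow_add hn0, Real.rpow_one]
      rw [e2, ← Real.rpow_mul hn0.le]
      apply Real.rpow_le_rpow_of_exponent_le hn
      rw [hδ]
      nlinarith
    have h7 : g ≤ M ^ 2 := by
      have h8 : g * g ≤ (M * P) * (M * P) := by gcongr
      have h9 : g * g ≤ M ^ 2 * g := by nlinarith [sq_nonneg M]
      exact le_of_mul_le_mul_right h9 hg0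
    have h10 : K₂ * m * M ^ 2 ≤ g * M ^ 2 := by
      calc K₂ * m * M ^ 2 = K₂ * (m * M ^ 2) := by ring
        _ ≤ K₂ * (ε * g ^ 2) := by gcongr
        _ = ε * K₂ * g ^ 2 := by ring
        _ ≤ 1 * g ^ 2 := by
          gcongr
          exact hε1.trans (min_le_left _ _)
        _ = g * g := by ring
        _ ≤ g * M ^ 2 := by gcongr
    have h11 : K₂ * m ≤ g := le_of_mul_le_mul_right h10 (by positivity)
    nlinarith

/-- With `ℓ = log (r / (e M))` the tail is `exp (-r ℓ)` and `F` consumes half of it; the rest is at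
most `x ^ r` since `exp (-ℓ / 2) ≤ x`. -/
theorem mul_le_pow_of_poisson_tail {p F M x : ℝ} {r : ℕ} (hp0 : 0 ≤ p) (hM : 0 < M) (hx : 0 < x)
    (hr : 0 < r) (hp : p ≤ (Real.exp 1 * M / r) ^ r)
    (hF : F ≤ Real.exp (r * (Real.log (r / (Real.exp 1 * M)) / 2)))
    (hxr : 1 / x ^ 2 ≤ r / (Real.exp 1 * M)) : p * F ≤ x ^ r := by
  have hrpos : (0 : ℝ) < r := by exact_mod_cast hr
  have hlog := Real.log_le_log (by positivity) hxr
  rw [Real.log_div one_ne_zero (by positivity), Real.log_one, Real.log_pow] at hlog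
  push_cast at hlog
  have e : Real.exp 1 * M / r = Real.exp (-Real.log (r / (Real.exp 1 * M))) := by
    rw [Real.exp_neg, Real.exp_log (by positivity), inv_div]
  rw [e, ← Real.exp_nat_mul] at hp
  have h1 : p * F ≤ p * Real.exp (r * (Real.log (r / (Real.exp 1 * M)) / 2)) :=
    mul_le_mul_of_nonneg_left hF hp0
  have h2 := mul_le_mul_of_nonneg_right hp
    (Real.exp_pos (r * (Real.log (r / (Real.exp 1 * M)) / 2))).le
  refine (h1.trans h2).trans ?_
  rw [← Real.exp_add, ← Real.exp_log (pow_pos hx r), Real.log_pow]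
  apply Real.exp_le_exp.2
  have := mul_le_mul_of_nonneg_left hlog hrpos.le
  linarith

set_option maxHeartbeats 800000 in
/-- If the overlap has the tail of a Poisson law of mean `k ^ 2 / n`, then the second moment of the
likelihood ratio is close to one. -/
theorem exists_sum_overlap_le {γ c₁ K₁ K₂ η : ℝ} (hγ0 : 0 < γ) (hγ1 : γ ≤ 1) (hc₁ : 0 < c₁)
    (hK₁ : 0 ≤ K₁) (hK₂ : 0 ≤ K₂) (hη : 0 < η) :
    ∃ ε > 0, ∃ N : ℕ, ∀ n ≥ N, ∀ k m : ℕ, 1 ≤ n → 1 ≤ k → 1 ≤ m →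
      (m : ℝ) ≤ ε * ((n : ℝ) ^ 2 * (k : ℝ) ^ (2 * γ - 4)) →
      (m : ℝ) ≤ ε * ((k : ℝ) ^ γ * Real.log n) →
      ∀ F p : ℕ → ℝ, (∀ r, 0 ≤ p r) → ∑ r ∈ Finset.range (k + 1), p r = 1 →
      (∀ r, 1 ≤ r → p r ≤ (Real.exp 1 * ((k : ℝ) ^ 2 / n) / r) ^ r) →
      (∀ r ≤ k, (r : ℝ) * (k : ℝ) ^ (-γ) ≤ c₁ →
        F r ≤ Real.exp (K₁ * m * (r * (k : ℝ) ^ (-γ)) ^ 2)) →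
      (∀ r ≤ k, c₁ ≤ (r : ℝ) * (k : ℝ) ^ (-γ) →
        F r ≤ Real.exp (K₂ * (m * (r * (k : ℝ) ^ (-γ))))) →
      ∑ r ∈ Finset.range (k + 1), p r * F r ≤ 1 + η := by
  set δ := γ / 8 with hδ
  have hδ0 : 0 < δ := by positivity
  -- Ratio of the geometric series bounding the overlaps `r ≥ K M`: its sum is at most `2 x ≤ η /
  -- 2`, and `x ≤ exp (-1)` makes the logarithms at least 2.
  set x := min (Real.exp (-1)) (min (1 / 2) (η / 4)) with hx
  have hx0 : 0 < x := lt_min (Real.exp_pos _) (lt_min (by norm_num) (by positivity))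
  set K := Real.exp 1 / x ^ 2 with hK
  have hK0 : 0 < K := by positivity
  set b := min 1 (min (δ / 4) (Real.log (1 + η / 2))) with hb
  have hb0 : 0 < b :=
    lt_min one_pos (lt_min (by positivity) (Real.log_pos (by linarith)))
  set Tt := 1 + K₁ * c₁ + K₁ + K₂ + K₁ * K ^ 2 with hT
  have hT0 : 0 < Tt := by positivity
  -- The first bound forces `K M ≤ c₁ g`, so that overlaps below `K M` all belong to the regime of
  -- small `ρ`; the second makes `ε` times each constant in `Tt` at most `b`.
  set ε := min ((c₁ / K) ^ 2) (b / Tt) with hε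
  have hε0 : 0 < ε := lt_min (by positivity) (by positivity)
  have hεT : ε * Tt ≤ b := by
    have : ε ≤ b / Tt := min_le_right _ _
    rwa [le_div_iff₀ hT0] at this
  have hεA : ∀ A, A ≤ Tt → ε * A ≤ b := fun A hA =>
    (mul_le_mul_of_nonneg_left hA hε0.le).trans hεT
  have hb1 : b ≤ 1 := min_le_left _ _
  have hb2 : b ≤ δ / 4 := (min_le_right _ _).trans (min_le_left _ _)
  have hb3 : b ≤ Real.log (1 + η / 2) := (min_le_right _ _).trans (min_le_right _ _)
  have p1 : 0 ≤ K₁ * c₁ := by positivity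
  have p2 : 0 ≤ K₁ * K ^ 2 := by positivity
  have hx1 : x ≤ Real.exp (-1) := min_le_left _ _
  have hx2 : x ≤ 1 / 2 := (min_le_right _ _).trans (min_le_left _ _)
  have hx3 : x ≤ η / 4 := (min_le_right _ _).trans (min_le_right _ _)
  have E1 : ε * (K₁ * c₁) ≤ b := hεA _ (by rw [hT]; linarith)
  have E2 : ε * K₁ ≤ b := hεA _ (by rw [hT]; linarith)
  have E3 : ε * K₂ ≤ b := hεA _ (by rw [hT]; linarith)
  have E4 : ε * (K₁ * K ^ 2) ≤ b := hεA _ (by rw [hT]; linarith)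
  have E5 : ε ≤ (c₁ / K) ^ 2 := min_le_left _ _
  have hKx : K * x ^ 2 = Real.exp 1 := by rw [hK]; field_simp
  clear_value ε Tt b K x δ
  refine ⟨ε, hε0, ⌈Real.exp (max (2 / δ) (2 / δ * (1 - Real.log c₁)))⌉₊, ?_⟩
  intro n hnN k m hn1 hk hm hmA hmB F p hp0 hp1 hptail hFs hFl
  have hn : (1 : ℝ) ≤ n := by exact_mod_cast hn1
  have hn0 : (0 : ℝ) < n := by linarith
  have hk1 : (1 : ℝ) ≤ k := by exact_mod_cast hk
  have hk0 : (0 : ℝ) < k := by linarith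
  have hm1 : (1 : ℝ) ≤ m := by exact_mod_cast hm
  have hlog : max (2 / δ) (2 / δ * (1 - Real.log c₁)) ≤ Real.log n := by
    rw [Real.le_log_iff_exp_le hn0]
    exact (Nat.le_ceil _).trans (by exact_mod_cast hnN)
  have hlog1 : 2 ≤ δ * Real.log n := by
    have := (le_max_left _ _).trans hlog
    rw [div_le_iff₀ hδ0] at this
    linarith
  have hlog2 : 1 - Real.log c₁ ≤ δ / 2 * Real.log n := by
    have := mul_le_mul_of_nonneg_left ((le_max_right _ _).trans hlog)
      (by positivity : 0 ≤ δ / 2)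
    have e : δ / 2 * (2 / δ * (1 - Real.log c₁)) = 1 - Real.log c₁ := by field_simp
    linarith
  set M := (k : ℝ) ^ 2 / n with hM
  have hM0 : 0 < M := by positivity
  set g := (k : ℝ) ^ γ with hg
  have hg1 : 1 ≤ g := Real.one_le_rpow hk1 hγ0.le
  have hg0 : 0 < g := by linarith
  have hgM : g = (n * M) ^ (γ / 2) := by
    have : (n : ℝ) * M = (k : ℝ) ^ (2 : ℝ) := by
      rw [hM, Real.rpow_two]; field_simp
    rw [this, ← Real.rpow_mul hk0.le]
    have : 2 * (γ / 2) = γ := by ring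
    rw [this]
  have hginv : (k : ℝ) ^ (-γ) = g⁻¹ := by rw [Real.rpow_neg hk0.le]
  have hmA' : (m : ℝ) * M ^ 2 ≤ ε * g ^ 2 := by
    have e : (n : ℝ) ^ 2 * (k : ℝ) ^ (2 * γ - 4) * M ^ 2 = g ^ 2 := by
      have e1 : (k : ℝ) ^ (2 * γ - 4) * (k : ℝ) ^ 4 = g ^ 2 := by
        rw [hg, ← Real.rpow_natCast, ← Real.rpow_natCast, ← Real.rpow_add hk0,
          ← Real.rpow_mul hk0.le]
        congr 1
        push_cast; ring
      rw [hM, ← e1]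
      field_simp
    rw [← e]
    have := mul_le_mul_of_nonneg_right hmA (sq_nonneg M)
    linarith
  have hmB' : (m : ℝ) ≤ ε * g * Real.log n := by linarith
  have hlarge : ∀ r : ℝ, K * M ≤ r → 1 / x ^ 2 ≤ r / (Real.exp 1 * M) := by
    intro r hr
    rw [div_le_div_iff₀ (by positivity) (by positivity)]
    have := mul_le_mul_of_nonneg_right hr (sq_nonneg x)
    rw [mul_right_comm, hKx] at this
    linarith
  have hℓ : ∀ r : ℝ, K * M ≤ r → 2 ≤ Real.log (r / (Real.exp 1 * M)) := by
    intro r hr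
    refine le_trans ?_ (Real.log_le_log (by positivity) (hlarge r hr))
    rw [Real.log_div one_ne_zero (by positivity), Real.log_one, Real.log_pow]
    have := Real.log_le_log hx0 hx1
    rw [Real.log_exp] at this
    push_cast
    linarith
  have hbig : ∀ r : ℕ, c₁ ≤ (r : ℝ) * (k : ℝ) ^ (-γ) → K * M ≤ r := by
    intro r hr
    rw [hginv, ← div_eq_mul_inv, le_div_iff₀ hg0] at hr
    refine le_trans ?_ hr
    have h1 : M ^ 2 ≤ ((c₁ / K) * g) ^ 2 := by
      calc M ^ 2 ≤ m * M ^ 2 := le_mul_of_one_le_left (sq_nonneg M) hm1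
        _ ≤ ε * g ^ 2 := hmA'
        _ ≤ (c₁ / K) ^ 2 * g ^ 2 := by
          gcongr
        _ = _ := by ring
    have h2 : M ≤ c₁ / K * g := le_of_sq_le_sq h1 (by positivity)
    calc K * M ≤ K * (c₁ / K * g) := by gcongr
      _ = c₁ * g := by field_simp
  have hterm : ∀ r ∈ Finset.range (k + 1), p r * F r ≤
      p r * (1 + η / 2) + (if r = 0 then 0 else x ^ r) := by
    intro r hr
    have hrk : r ≤ k := by simpa [Nat.lt_succ_iff] using hr
    -- Overlaps of the order of the mean: there `F r ≤ 1 + η / 2` by the global condition. Beyond,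
    -- the Poisson tail wins.
    rcases lt_or_ge (r : ℝ) (K * M) with h | h
    · have hs : (r : ℝ) * (k : ℝ) ^ (-γ) ≤ c₁ := by
        by_contra hcon
        exact absurd (hbig r (not_le.1 hcon).le) (not_le.2 h)
      have h1 : F r ≤ 1 + η / 2 := by
        refine (hFs r hrk hs).trans ?_
        rw [← Real.le_log_iff_exp_le (by linarith)]
        refine le_trans ?_ (E4.trans hb3)
        rw [hginv, ← div_eq_mul_inv, div_pow, ← mul_div_assoc, div_le_iff₀ (by positivity)]
        calc K₁ * m * (r : ℝ) ^ 2 ≤ K₁ * m * (K * M) ^ 2 := by gcongr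
          _ = K₁ * K ^ 2 * (m * M ^ 2) := by ring
          _ ≤ K₁ * K ^ 2 * (ε * g ^ 2) := by gcongr
          _ = _ := by ring
      have h2 : 0 ≤ (if r = 0 then 0 else x ^ r) := by
        split_ifs
        · exact le_rfl
        · positivity
      have := mul_le_mul_of_nonneg_left h1 (hp0 r)
      linarith
    · have hr0 : r ≠ 0 := by
        rintro rfl
        have : 0 < K * M := by positivity
        simp at h
        linarith
      have hr1 : (1 : ℝ) ≤ r := by exact_mod_cast Nat.one_le_iff_ne_zero.2 hr0
      have hrpos : (0 : ℝ) < r := by linarith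
      have hℓr := hℓ r h
      have hF : F r ≤ Real.exp (r * (Real.log (r / (Real.exp 1 * M)) / 2)) := by
        rcases le_total ((r : ℝ) * (k : ℝ) ^ (-γ)) c₁ with hs | hs
        · refine (hFs r hrk hs).trans (Real.exp_le_exp.2 ?_)
          rw [hginv, ← div_eq_mul_inv] at hs ⊢
          rw [div_le_iff₀ hg0] at hs
          have := log_ratio_small hδ hγ0 hγ1 hK₁
            (E1.trans hb2)
            (le_min (E2.trans hb1)
              (E2.trans (by linarith)))
            hn hlog1 hM0 hgM (by linarith) hmA' hmB' hr1 hs hℓr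
          rw [div_pow, ← mul_div_assoc, div_le_iff₀ (by positivity)]
          have := mul_le_mul_of_nonneg_left this hrpos.le
          linarith
        · refine (hFl r hrk hs).trans (Real.exp_le_exp.2 ?_)
          rw [hginv, ← div_eq_mul_inv] at hs ⊢
          rw [le_div_iff₀ hg0] at hs
          have := log_ratio_large hδ hγ0 hγ1 hc₁ hK₂
            (le_min (E3.trans hb1)
              (E3.trans hb2))
            hn hlog2 hM0 hgM hg1 hmA' hmB' hs hℓr
          rw [← mul_div_assoc, ← mul_div_assoc, div_le_iff₀ (by positivity)]
          have := mul_le_mul_of_nonneg_left this hrpos.le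
          linarith
      have h3 := mul_le_pow_of_poisson_tail (hp0 r) hM0 hx0 (Nat.pos_of_ne_zero hr0)
        (hptail r (by omega)) hF (hlarge r h)
      rw [if_neg hr0]
      have : 0 ≤ p r * (1 + η / 2) := mul_nonneg (hp0 r) (by linarith)
      linarith
  refine (Finset.sum_le_sum hterm).trans ?_
  rw [Finset.sum_add_distrib, ← Finset.sum_mul, hp1, one_mul, Finset.sum_range_succ']
  simp only [Nat.add_eq_zero_iff, one_ne_zero, and_false, if_false, if_true, add_zero]
  have hgeom : ∑ r ∈ Finset.range k, x ^ (r + 1) ≤ 2 * x := by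
    have h1 : ∀ r ∈ Finset.range k, x ^ (r + 1) ≤ x * (1 / 2) ^ r := by
      intro r _
      rw [pow_succ']
      gcongr
    refine (Finset.sum_le_sum h1).trans ?_
    rw [← Finset.mul_sum]
    have := Summable.sum_le_tsum (f := fun j : ℕ => (1 / 2 : ℝ) ^ j) (Finset.range k)
      (fun j _ => by positivity) summable_geometric_two
    rw [tsum_geometric_two] at this
    have := mul_le_mul_of_nonneg_left this hx0.le
    linarith
  linarith

/-! ### Gaussian linearization and the mean-field integral. -/

theorem neg_mul_sq_add_eq {B : ℝ} (hB : 0 < B) (ω x : ℝ) :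
    Real.exp (-B * x ^ 2 + ω * x) =
      Real.exp (ω ^ 2 / (4 * B)) * Real.exp (-B * (x - ω / (2 * B)) ^ 2) := by
  rw [← Real.exp_add]
  congr 1
  field_simp
  ring

theorem integrable_exp_neg_mul_sq_add {B : ℝ} (hB : 0 < B) (ω : ℝ) :
    Integrable fun x : ℝ => Real.exp (-B * x ^ 2 + ω * x) := by
  simp only [neg_mul_sq_add_eq hB ω]
  exact ((integrable_exp_neg_mul_sq hB).comp_sub_right (ω / (2 * B))).const_mul _

theorem integral_exp_neg_mul_sq_add {B : ℝ} (hB : 0 < B) (ω : ℝ) :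
    ∫ x : ℝ, Real.exp (-B * x ^ 2 + ω * x) = √(Real.pi / B) * Real.exp (ω ^ 2 / (4 * B)) := by
  simp only [neg_mul_sq_add_eq hB ω]
  rw [integral_const_mul, integral_sub_right_eq_self (fun x : ℝ => Real.exp (-B * x ^ 2)),
    integral_gaussian, mul_comm]

/-- The log-partition function of the spins of `S` in the mean field `a x`, relative to that in the
mean field `0`. -/
noncomputable def fieldLogPartition {n : ℕ} (a : ℝ) (S : Finset (Fin n)) (h : Fin n → ℝ) (x : ℝ) :
    ℝ :=
  ∑ i ∈ S, (Real.log (Real.cosh (a * x + h i)) - Real.log (Real.cosh (h i)))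

theorem sum_exp_blockSum {n : ℕ} (a : ℝ) (S : Finset (Fin n)) (h : Fin n → ℝ) (x : ℝ) :
    ∑ σ : Fin n → Bool, Real.exp (a * x * blockSum S σ) * ∏ i, Real.exp (h i * spin (σ i)) =
      (∏ i, (2 * Real.cosh (h i))) * Real.exp (fieldLogPartition a S h x) := by
  have h1 : ∀ σ : Fin n → Bool,
      Real.exp (a * x * blockSum S σ) * ∏ i, Real.exp (h i * spin (σ i)) =
      ∏ i, Real.exp ((h i + if i ∈ S then a * x else 0) * spin (σ i)) := by
    intro σ
    rw [← Real.exp_sum, ← Real.exp_sum, ← Real.exp_add]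
    congr 1
    simp only [add_mul, Finset.sum_add_distrib, ite_mul, zero_mul]
    rw [Finset.sum_ite_mem, Finset.univ_inter, blockSum, Finset.mul_sum, add_comm]
  simp only [h1]
  rw [sum_prod_exp_spin, fieldLogPartition, Real.exp_sum]
  have h2 : ∏ i ∈ S, Real.exp (Real.log (Real.cosh (a * x + h i)) - Real.log (Real.cosh (h i))) =
      ∏ i, if i ∈ S then Real.cosh (a * x + h i) / Real.cosh (h i) else 1 := by
    rw [Finset.prod_ite_mem, Finset.univ_inter]
    refine Finset.prod_congr rfl fun i _ => ?_
    rw [Real.exp_sub, Real.exp_log (Real.cosh_pos _), Real.exp_log (Real.cosh_pos _)]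
  rw [h2, ← Finset.prod_mul_distrib]
  refine Finset.prod_congr rfl fun i _ => ?_
  have := (Real.cosh_pos (h i)).ne'
  split_ifs
  · rw [add_comm (h i)]
    field_simp
  · simp

/-- Linearization of the quadratic interaction by a Gaussian mean field. -/
theorem sum_exp_sq_blockSum {n : ℕ} {θ α : ℝ} (hθ : 0 < θ) (hα : 0 < α) (S : Finset (Fin n))
    (h : Fin n → ℝ) :
    Integrable (fun x : ℝ => Real.exp (-(θ / (4 * α)) * x ^ 2 + fieldLogPartition √θ S h x)) ∧
    ∑ σ : Fin n → Bool, Real.exp (α * blockSum S σ ^ 2) * ∏ i, Real.exp (h i * spin (σ i)) =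
      (∏ i, (2 * Real.cosh (h i))) * (√(θ / (4 * α) / Real.pi) *
        ∫ x : ℝ, Real.exp (-(θ / (4 * α)) * x ^ 2 + fieldLogPartition √θ S h x)) := by
  -- Chosen so that the Gaussian integral with slope `√θ * blockSum` returns `exp (α * blockSum ^
  -- 2)`; for `α = θ / (2 k)` it equals `k / 2`, the quadratic part of `k G`.
  set B := θ / (4 * α) with hB
  have hB0 : 0 < B := by positivity
  set Q := ∏ i, (2 * Real.cosh (h i)) with hQ
  have hQ0 : 0 < Q := Finset.prod_pos fun i _ => mul_pos two_pos (Real.cosh_pos _)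
  have hpt : ∀ x : ℝ, ∑ σ : Fin n → Bool, Real.exp (-B * x ^ 2 + √θ * blockSum S σ * x) *
      ∏ i, Real.exp (h i * spin (σ i)) =
      Q * Real.exp (-B * x ^ 2 + fieldLogPartition √θ S h x) := by
    intro x
    have := sum_exp_blockSum √θ S h x
    rw [Real.exp_add (-B * x ^ 2) (fieldLogPartition _ _ _ _), mul_left_comm, ← this,
      Finset.mul_sum]
    refine Finset.sum_congr rfl fun σ _ => ?_
    rw [Real.exp_add]
    ring_nf
  have hint : ∀ σ : Fin n → Bool, Integrable fun x : ℝ =>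
      Real.exp (-B * x ^ 2 + √θ * blockSum S σ * x) * ∏ i, Real.exp (h i * spin (σ i)) :=
    fun σ => (integrable_exp_neg_mul_sq_add hB0 _).mul_const _
  have hI : Integrable fun x : ℝ => Q * Real.exp (-B * x ^ 2 + fieldLogPartition √θ S h x) := by
    simp only [← hpt]
    exact integrable_finsetSum _ fun σ _ => hint σ
  refine ⟨?_, ?_⟩
  · have := hI.const_mul Q⁻¹
    simpa [← mul_assoc, inv_mul_cancel₀ hQ0.ne'] using this
  · rw [mul_left_comm, ← integral_const_mul]
    simp only [← hpt]
    rw [integral_finsetSum _ fun σ _ => hint σ, Finset.mul_sum]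
    refine Finset.sum_congr rfl fun σ _ => ?_
    rw [integral_mul_const, integral_exp_neg_mul_sq_add hB0, ← mul_assoc, ← mul_assoc,
      ← Real.sqrt_mul (by positivity)]
    have e1 : B / Real.pi * (Real.pi / B) = 1 := by field_simp
    have e2 : (√θ * blockSum S σ) ^ 2 / (4 * B) = α * blockSum S σ ^ 2 := by
      rw [mul_pow, Real.sq_sqrt hθ.le, hB]
      field_simp
    rw [e1, e2, Real.sqrt_one, one_mul]

theorem fieldLogPartition_le {n : ℕ} {a : ℝ} (ha : 0 ≤ a) (S : Finset (Fin n))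
    (h : Fin n → ℝ) (x : ℝ) : fieldLogPartition a S h x ≤ S.card * (a * |x|) := by
  unfold fieldLogPartition
  refine (Finset.sum_le_card_nsmul S _ (a * |x|) fun i _ => ?_).trans_eq (nsmul_eq_mul _ _)
  refine (le_abs_self _).trans ((abs_log_cosh_sub_le _ _).trans_eq ?_)
  rw [add_sub_cancel_right, abs_mul, abs_of_nonneg ha]

theorem exp_neg_abs_le (y : ℝ) : Real.exp (-|y|) ≤ 2 * (1 + y ^ 2)⁻¹ := by
  have h := Real.quadratic_le_exp_of_nonneg (abs_nonneg y)
  rw [sq_abs] at h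
  rw [Real.exp_neg, ← div_eq_mul_inv, inv_eq_one_div, div_le_div_iff₀ (Real.exp_pos _)
    (by positivity)]
  linarith [abs_nonneg y]

theorem integrable_exp_neg_mul_abs {s : ℝ} (hs : 0 < s) :
    Integrable fun x : ℝ => Real.exp (-(s * |x|)) := by
  refine Integrable.mono' ((integrable_inv_one_add_sq.comp_mul_left' hs.ne').const_mul 2)
    (by fun_prop) (Eventually.of_forall fun x => ?_)
  rw [Real.norm_eq_abs, abs_of_pos (Real.exp_pos _)]
  have := exp_neg_abs_le (s * x)
  rwa [abs_mul, abs_of_pos hs] at this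

theorem integral_exp_neg_mul_abs_le {s : ℝ} (hs : 0 < s) :
    ∫ x : ℝ, Real.exp (-(s * |x|)) ≤ 2 * Real.pi / s := by
  have h1 : ∫ x : ℝ, Real.exp (-(s * |x|)) ≤ ∫ x : ℝ, 2 * (1 + (s * x) ^ 2)⁻¹ := by
    refine integral_mono (integrable_exp_neg_mul_abs hs)
      ((integrable_inv_one_add_sq.comp_mul_left' hs.ne').const_mul 2) fun x => ?_
    have := exp_neg_abs_le (s * x)
    rwa [abs_mul, abs_of_pos hs] at this
  refine h1.trans_eq ?_
  rw [integral_const_mul, Measure.integral_comp_mul_left (fun x : ℝ => (1 + x ^ 2)⁻¹),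
    integral_univ_inv_one_add_sq, abs_of_pos (inv_pos.2 hs), smul_eq_mul]
  ring

/-- The exponential weight only changes the coefficient of the quadratic interaction, hence only
lowers the Gaussian coefficient `B`, by at most `c k ^ γ`. The moment becomes a ratio of two
mean-field integrals, compared pointwise by `hpt`. -/
theorem sum_quenchedLaw_mul_exp_le {n : ℕ} {θ γ c q A : ℝ} (hθ : 0 < θ) (hc : 0 < c) (hq : 0 < q)
    {S : Finset (Fin n)} (hS : S.Nonempty) (h : Fin n → ℝ)
    (hpt : ∀ x : ℝ, Real.exp (c * ((S.card : ℝ) ^ γ * x ^ 2) +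
        (-((S.card : ℝ) / 2) * x ^ 2 + fieldLogPartition √θ S h x)) ≤
      Real.exp A * Real.exp (-((S.card : ℝ) / 2) * x ^ 2 + fieldLogPartition √θ S h x) +
        Real.exp (-(q * √(S.card : ℝ) * |x|))) :
    ∑ σ, quenchedLaw θ S h σ *
      Real.exp (θ * c * ((S.card : ℝ) ^ γ * (blockSum S σ / S.card) ^ 2)) ≤
      Real.exp A + √(2 * Real.pi) / q := by
  have hk : (0 : ℝ) < S.card := by exact_mod_cast Finset.card_pos.2 hS
  set k : ℝ := (S.card : ℝ) with hkdef
  set φ := fieldLogPartition √θ S h with hφ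
  set Q := ∏ i, (2 * Real.cosh (h i)) with hQ
  have hQ0 : 0 < Q := Finset.prod_pos fun i _ => mul_pos two_pos (Real.cosh_pos _)
  set Z := ∑ σ : Fin n → Bool, gibbsWeight θ S h σ with hZ
  have hQZ : Q ≤ Z := prod_cosh_le_partition hθ.le S h
  have hZ0 : 0 < Z := hQ0.trans_le hQZ
  have hkγ : 0 < k ^ γ := by positivity
  obtain ⟨I0, e0⟩ := sum_exp_sq_blockSum hθ (α := θ / (2 * k)) (by positivity) S h
  obtain ⟨I1, e1⟩ := sum_exp_sq_blockSum hθ (α := θ / (2 * k) + θ * c * (k ^ γ / k ^ 2))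
    (by positivity) S h
  have hB0 : θ / (4 * (θ / (2 * k))) = k / 2 := by field_simp; ring
  rw [hB0] at I0 e0
  set B := θ / (4 * (θ / (2 * k) + θ * c * (k ^ γ / k ^ 2))) with hB
  have hBeq : B = k / 2 / (1 + 2 * c * (k ^ γ / k)) := by
    rw [hB]; field_simp; ring
  have hy : 0 ≤ 2 * c * (k ^ γ / k) := by positivity
  have hB1 : B ≤ k / 2 := by
    rw [hBeq]; exact div_le_self (by positivity) (by linarith)
  have hB2 : k / 2 - c * k ^ γ ≤ B := by
    rw [hBeq, le_div_iff₀ (by linarith)]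
    have e : (k / 2 - c * k ^ γ) * (1 + 2 * c * (k ^ γ / k)) =
        k / 2 - 2 * (c * k ^ γ) ^ 2 / k := by field_simp; ring
    rw [e]
    have : 0 ≤ 2 * (c * k ^ γ) ^ 2 / k := by positivity
    linarith
  have hZe : Z = ∑ σ : Fin n → Bool, Real.exp (θ / (2 * k) * blockSum S σ ^ 2) *
      ∏ i, Real.exp (h i * spin (σ i)) :=
    Finset.sum_congr rfl fun σ _ => gibbsWeight_eq θ S h σ
  have hN : ∑ σ, quenchedLaw θ S h σ *
      Real.exp (θ * c * (k ^ γ * (blockSum S σ / k) ^ 2)) =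
      (∑ σ : Fin n → Bool, Real.exp ((θ / (2 * k) + θ * c * (k ^ γ / k ^ 2)) * blockSum S σ ^ 2) *
      ∏ i, Real.exp (h i * spin (σ i))) / Z := by
    rw [Finset.sum_div]
    refine Finset.sum_congr rfl fun σ _ => ?_
    rw [quenchedLaw, gibbsWeight_eq, add_mul, Real.exp_add]
    have : θ * c * (k ^ γ * (blockSum S σ / k) ^ 2) =
        θ * c * (k ^ γ / k ^ 2) * blockSum S σ ^ 2 := by
      field_simp
    rw [this]
    ring
  rw [hN, div_le_iff₀ hZ0, e1]
  rw [hZe, e0] at hQZ ⊢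
  set D := ∫ x : ℝ, Real.exp (-(k / 2) * x ^ 2 + φ x) with hD
  have hs : 0 < q * √k := by positivity
  have hint : ∫ x : ℝ, Real.exp (-B * x ^ 2 + φ x) ≤
      Real.exp A * D + 2 * Real.pi / (q * √k) := by
    have h1 : ∫ x : ℝ, Real.exp (-B * x ^ 2 + φ x) ≤
        ∫ x : ℝ, (Real.exp A * Real.exp (-(k / 2) * x ^ 2 + φ x) +
          Real.exp (-(q * √k * |x|))) := by
      refine integral_mono I1 ((I0.const_mul _).add (integrable_exp_neg_mul_abs hs)) fun x => ?_
      refine le_trans (Real.exp_le_exp.2 ?_) (hpt x)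
      have := mul_le_mul_of_nonneg_right hB2 (sq_nonneg x)
      linarith
    rw [integral_add (I0.const_mul _) (integrable_exp_neg_mul_abs hs), integral_const_mul] at h1
    linarith [integral_exp_neg_mul_abs_le hs]
  -- The partition function is at least its value without interaction. This normalizes the additive
  -- error, whose integral is of order `1 / √k`.
  have hD1 : 1 ≤ √(k / 2 / Real.pi) * D := by
    have : Q * 1 ≤ Q * (√(k / 2 / Real.pi) * D) := by linarith
    exact le_of_mul_le_mul_left this hQ0
  have hint0 : 0 ≤ ∫ x : ℝ, Real.exp (-B * x ^ 2 + φ x) :=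
    integral_nonneg fun x => (Real.exp_pos _).le
  have e3 : √(k / 2 / Real.pi) * (2 * Real.pi / (q * √k)) = √(2 * Real.pi) / q := by
    have h1 : √(k / 2 / Real.pi) = √k / √(2 * Real.pi) := by
      rw [← Real.sqrt_div hk.le]; congr 1; field_simp
    have h2 : √(2 * Real.pi) * √(2 * Real.pi) = 2 * Real.pi :=
      Real.mul_self_sqrt (by positivity)
    rw [h1]
    have h3 : 0 < √k := by positivity
    have h4 : 0 < √(2 * Real.pi) := by positivity
    field_simp
    linarith
  calc Q * (√(B / Real.pi) * ∫ x : ℝ, Real.exp (-B * x ^ 2 + φ x))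
      ≤ Q * (√(k / 2 / Real.pi) * (Real.exp A * D + 2 * Real.pi / (q * √k))) := by
        gcongr
    _ = Q * (Real.exp A * (√(k / 2 / Real.pi) * D) + √(2 * Real.pi) / q * 1) := by
        rw [← e3]; ring
    _ ≤ Q * (Real.exp A * (√(k / 2 / Real.pi) * D) +
          √(2 * Real.pi) / q * (√(k / 2 / Real.pi) * D)) := by
        gcongr
    _ = _ := by ring

/-- The mean-field weight at a point beyond the critical scale is negligible. -/
theorem exp_meanField_le {τ : ℕ} (hτ : 2 ≤ τ) {k a g c Ξ x φ : ℝ} (hk : 1 ≤ k) (ha : 0 < a)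
    (hg : 0 < g) (hc : 0 < c) (hcg : c ≤ g / 4) (hc8 : c ≤ 1 / 8) (hΞ : 0 ≤ Ξ)
    (hφ : φ ≤ k * (a * |x|))
    (hφ' : |x| ≤ 4 * a → -(k / 2) * x ^ 2 + φ ≤ -(k * (g * x ^ (2 * τ))) + Ξ * (√k * |x|)) :
    Real.exp (c * (k ^ (1 / (2 * (τ : ℝ) - 1)) * x ^ 2) + (-(k / 2) * x ^ 2 + φ)) ≤
      Real.exp (1 + Ξ) * Real.exp (-(k / 2) * x ^ 2 + φ) +
        Real.exp (-(min (g / 4) (a / 2) * √k * |x|)) := by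
  have hk0 : 0 < k := by linarith
  have hτ' : (2 : ℝ) ≤ τ := by exact_mod_cast hτ
  set γ := 1 / (2 * (τ : ℝ) - 1) with hγ
  have hγ0 : 0 < γ := by rw [hγ]; apply one_div_pos.2; linarith
  have hγ1 : γ ≤ 1 := by rw [hγ, div_le_one (by linarith)]; linarith
  -- Within the critical window, enlarged by the random slope `Ξ`, the extra exponent is at most `1
  -- + Ξ`.
  rcases le_or_gt (k ^ γ * x ^ 2) (1 + 2 * Ξ / g) with h1 | h1
  · refine le_trans ?_ (le_add_of_nonneg_right (Real.exp_pos _).le)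
    rw [← Real.exp_add]
    apply Real.exp_le_exp.2
    have h2 : c * (k ^ γ * x ^ 2) ≤ c * (1 + 2 * Ξ / g) := mul_le_mul_of_nonneg_left h1 hc.le
    have h3 : c * (2 * Ξ / g) ≤ Ξ := by
      rw [← mul_div_assoc, div_le_iff₀ hg]
      nlinarith
    linarith
  · refine le_trans (Real.exp_le_exp.2 ?_) (le_add_of_nonneg_left (by positivity))
    set z := k ^ (γ / 2) * |x| with hz
    have hz2 : z ^ 2 = k ^ γ * x ^ 2 := by
      rw [hz, mul_pow, sq_abs, ← Real.rpow_natCast, ← Real.rpow_mul hk0.le]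
      congr 2; push_cast; ring
    have hz0 : 0 ≤ z := by positivity
    have hΞg : 0 ≤ 2 * Ξ / g := by positivity
    have hz1 : 1 ≤ z := by
      by_contra hcon
      have : z ^ 2 ≤ 1 := pow_le_one₀ hz0 (not_le.1 hcon).le
      linarith
    -- This identity fixes `γ`: in the variable `z` the drift `k x ^ (2 τ)` is `z ^ (2 τ - 1)` times
    -- the fluctuation scale `√k |x|`.
    have hy : z ^ (2 * τ - 1) = √k * |x| ^ (2 * τ - 1) := by
      rw [hz, mul_pow, Real.sqrt_eq_rpow, ← Real.rpow_natCast (k ^ (γ / 2)),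
        ← Real.rpow_mul hk0.le]
      congr 2
      rw [Nat.cast_sub (by omega), hγ]
      push_cast
      have : 2 * (τ : ℝ) - 1 ≠ 0 := by linarith
      field_simp
    have hyz : z ^ 2 ≤ z ^ (2 * τ - 1) := pow_le_pow_right₀ hz1 (by omega)
    set y := z ^ (2 * τ - 1) with hydef
    have hzx : z ≤ √k * |x| := by
      rw [hz, Real.sqrt_eq_rpow]
      gcongr
    have hkx : k * x ^ (2 * τ) = y * (√k * |x|) := by
      rw [hy, ← (even_two_mul τ).pow_abs]
      have e1 : |x| ^ (2 * τ) = |x| ^ (2 * τ - 1) * |x| := by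
        rw [← pow_succ]; congr 1; omega
      have e2 : √k * √k = k := Real.mul_self_sqrt hk0.le
      rw [e1]
      linear_combination (-(|x| ^ (2 * τ - 1) * |x|)) * e2
    have hs1 : 1 ≤ √k * |x| := hz1.trans hzx
    have hy1 : 1 ≤ y := by linarith [one_le_pow₀ hz1 (n := 2)]
    rw [← hz2] at h1 ⊢
    -- For `|x| ≤ 4 a` the drift `g y √k |x|` is shared: half absorbs the slope, a quarter the extra
    -- exponent, a quarter gives the decay. For `|x| > 4 a` the Lipschitz bound on `φ` leaves `-k x
    -- ^ 2 / 4`, half of which absorbs the extra exponent.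
    rcases le_or_gt |x| (4 * a) with hx | hx
    · have h2 := hφ' hx
      have h3 : k * (g * x ^ (2 * τ)) = g * (y * (√k * |x|)) := by rw [← hkx]; ring
      rw [h3] at h2
      set s := √k * |x| with hs
      have h4 : Ξ * s ≤ g / 2 * (y * s) := by
        have h5 : 2 * Ξ / g ≤ y := by linarith
        rw [div_le_iff₀ hg] at h5
        have := mul_le_mul_of_nonneg_right h5 (by linarith : 0 ≤ s)
        linarith
      have h6 : z ^ 2 ≤ y * s := by nlinarith
      have h7 : c * z ^ 2 ≤ g / 4 * (y * s) := by
        refine mul_le_mul hcg h6 (by positivity) (by positivity)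
      have h8 : min (g / 4) (a / 2) * s ≤ g / 4 * (y * s) := by
        refine mul_le_mul (min_le_left _ _) (by nlinarith) (by linarith) (by positivity)
      rw [mul_assoc, ← hs]
      linarith
    · have h2 : z ^ 2 ≤ k * x ^ 2 := by
        calc z ^ 2 ≤ (√k * |x|) ^ 2 := pow_le_pow_left₀ hz0 hzx 2
          _ = k * x ^ 2 := by rw [mul_pow, Real.sq_sqrt hk0.le, sq_abs]
      have h3 : c * z ^ 2 ≤ 1 / 8 * (k * x ^ 2) :=
        mul_le_mul hc8 h2 (by positivity) (by norm_num)
      have hxx : 4 * a * |x| ≤ x ^ 2 := by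
        rw [← sq_abs, sq]
        exact mul_le_mul_of_nonneg_right hx.le (abs_nonneg x)
      have h4 : k * (a * |x|) ≤ 1 / 4 * (k * x ^ 2) := by nlinarith
      have h5 : min (g / 4) (a / 2) * √k * |x| ≤ 1 / 8 * (k * x ^ 2) := by
        have hsk : √k ≤ k := by
          rw [Real.sqrt_le_left hk0.le]; nlinarith
        calc min (g / 4) (a / 2) * √k * |x| ≤ a / 2 * k * |x| := by
              gcongr
              exact min_le_right _ _
          _ ≤ _ := by nlinarith
      linarith

/-! ### Fluctuations of the random field. -/

/-- Applied to a random function, this replaces the supremum of the derivative by its value at one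
point plus an integral, whose exponential moments follow from pointwise ones without a chaining
argument. -/
theorem abs_le_mul_of_second_deriv {f f' f'' : ℝ → ℝ} (hf : ∀ x, HasDerivAt f (f' x) x)
    (hf' : ∀ x, HasDerivAt f' (f'' x) x) (hc : Continuous f'') (h0 : f 0 = 0) {X x : ℝ}
    (hx : |x| ≤ X) : |f x| ≤ |x| * (|f' 0| + ∫ t in Set.Icc (-X) X, |f'' t|) := by
  have hX : 0 ≤ X := (abs_nonneg x).trans hx
  have hb : ∀ y ∈ Set.Icc (-X) X, |f' y| ≤ |f' 0| + ∫ t in Set.Icc (-X) X, |f'' t| := by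
    intro y hy
    have h1 : ∫ t in (0 : ℝ)..y, f'' t = f' y - f' 0 :=
      intervalIntegral.integral_eq_sub_of_hasDerivAt (fun t _ => hf' t)
        (hc.intervalIntegrable _ _)
    have h2 : |∫ t in (0 : ℝ)..y, f'' t| ≤ ∫ t in Set.Icc (-X) X, |f'' t| := by
      refine (intervalIntegral.norm_integral_le_integral_norm_uIoc (f := f'') (a := 0) (b := y)
        (μ := volume)).trans ?_
      refine setIntegral_mono_set (hc.abs.continuousOn.integrableOn_compact isCompact_Icc)
        (Eventually.of_forall fun t => abs_nonneg _) (LE.le.eventuallyLE ?_)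
      intro t ht
      have := Set.uIoc_subset_uIcc ht
      have h3 : Set.uIcc 0 y ⊆ Set.Icc (-X) X :=
        Set.uIcc_subset_Icc ⟨by linarith, hX⟩ hy
      exact h3 this
    rw [h1] at h2
    have := abs_sub_abs_le_abs_sub (f' y) (f' 0)
    linarith
  have := Convex.norm_image_sub_le_of_norm_hasDerivWithin_le (s := Set.Icc (-X) X)
    (fun y _ => (hf y).hasDerivWithinAt) hb (convex_Icc _ _) (x := 0) (y := x)
    ⟨by linarith, hX⟩ (abs_le.1 hx)
  rw [h0, sub_zero, sub_zero] at this
  rw [mul_comm]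
  exact this

/-- Moment generating function of a centered empirical sum over a set of sites. -/
theorem integral_exp_centered_sum_le {n : ℕ} {μ : Measure ℝ} [IsProbabilityMeasure μ] {f : ℝ → ℝ}
    (hf : Measurable f) {b : ℝ} (hb : ∀ x, |f x| ≤ b) (S : Finset (Fin n)) (t : ℝ) :
    ∫ h, Real.exp (t * ∑ i ∈ S, (f (h i) - ∫ y, f y ∂μ)) ∂(Measure.pi fun _ : Fin n => μ) ≤
      Real.exp (S.card * (b ^ 2 * t ^ 2 / 2)) := by
  have hb0 : 0 ≤ b := (abs_nonneg _).trans (hb 0)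
  have h1 : ∀ h : Fin n → ℝ, Real.exp (t * ∑ i ∈ S, (f (h i) - ∫ y, f y ∂μ)) =
      ∏ i, if i ∈ S then Real.exp (t * (f (h i) - ∫ y, f y ∂μ)) else 1 := by
    intro h
    rw [Finset.mul_sum, Real.exp_sum, Finset.prod_ite_mem, Finset.univ_inter]
  simp only [h1]
  rw [integral_fintype_prod_eq_prod (𝕜 := ℝ)
    (fun i (x : ℝ) => if i ∈ S then Real.exp (t * (f x - ∫ y, f y ∂μ)) else 1)]
  have hsub := (ProbabilityTheory.hasSubgaussianMGF_of_mem_Icc (μ := μ) (X := f) (a := -b) (b := b)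
    hf.aemeasurable (Eventually.of_forall fun x => abs_le.1 (hb x))).mgf_le t
  have hcb : (((‖b - -b‖₊ / 2) ^ 2 : NNReal) : ℝ) = b ^ 2 := by
    push_cast
    rw [Real.norm_eq_abs, sub_neg_eq_add, abs_of_nonneg (by linarith)]
    ring
  rw [hcb] at hsub
  have h2 : ∀ i : Fin n,
      (∫ x, (if i ∈ S then Real.exp (t * (f x - ∫ y, f y ∂μ)) else 1) ∂μ) ≤
      if i ∈ S then Real.exp (b ^ 2 * t ^ 2 / 2) else 1 := by
    intro i
    split_ifs
    · exact hsub
    · simp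
  refine (Finset.prod_le_prod (fun i _ => integral_nonneg fun x => ?_) fun i _ => h2 i).trans_eq ?_
  · dsimp only
    split_ifs
    · exact (Real.exp_pos _).le
    · exact zero_le_one
  · rw [Finset.prod_ite_mem, Finset.univ_inter, Finset.prod_const, ← Real.exp_nat_mul]

/-- The centered and normalized sum of the derivatives of order `j + 1` of the log-partition
functions of the sites of `S`. -/
noncomputable def fieldFluctuation {n : ℕ} (μ : Measure ℝ) (a : ℝ) (j : ℕ) (S : Finset (Fin n))
    (h : Fin n → ℝ) (x : ℝ) : ℝ :=
  ∑ i ∈ S, (a ^ (j + 1) * (tanhPoly j).eval (Real.tanh (a * x + h i)) - logCoshMean μ a (j + 1) x)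

theorem continuous_logCoshMean {μ : Measure ℝ} [IsProbabilityMeasure μ]
    (hint : Integrable (fun h : ℝ => h) μ) (a : ℝ) (j : ℕ) : Continuous (logCoshMean μ a j) :=
  continuous_iff_continuousAt.2 fun x => (hasDerivAt_logCoshMean hint a j x).continuousAt

theorem continuous_fieldFluctuation {n : ℕ} {μ : Measure ℝ} [IsProbabilityMeasure μ]
    (hint : Integrable (fun h : ℝ => h) μ) (a : ℝ) (j : ℕ) (S : Finset (Fin n)) :
    Continuous fun p : (Fin n → ℝ) × ℝ => fieldFluctuation μ a j S p.1 p.2 := by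
  unfold fieldFluctuation
  refine continuous_finsetSum _ fun i _ => ?_
  refine Continuous.sub (continuous_const.mul ((tanhPoly j).continuous.comp
    (continuous_tanh_real.comp (by fun_prop)))) ?_
  exact (continuous_logCoshMean hint a (j + 1)).comp continuous_snd

theorem exists_abs_fieldFluctuation_le (μ : Measure ℝ) [IsProbabilityMeasure μ] (a : ℝ) (j : ℕ) :
    ∃ b, ∀ (n : ℕ) (S : Finset (Fin n)) (h : Fin n → ℝ) (x : ℝ),
      |fieldFluctuation μ a j S h x| ≤ S.card * b := by
  obtain ⟨C, hC⟩ := exists_abs_tanhPoly_le j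
  refine ⟨|a ^ (j + 1)| * C + |a ^ (j + 1)| * C, fun n S h x => ?_⟩
  refine (Finset.abs_sum_le_sum_abs _ _).trans
    ((Finset.sum_le_card_nsmul S _ _ fun i _ => ?_).trans_eq (nsmul_eq_mul _ _))
  refine (abs_sub _ _).trans (add_le_add ?_ ?_)
  · rw [abs_mul]
    exact mul_le_mul_of_nonneg_left (hC _) (abs_nonneg _)
  · rw [logCoshMean, abs_mul]
    refine mul_le_mul_of_nonneg_left ?_ (abs_nonneg _)
    have := norm_integral_le_of_norm_le_const (μ := μ)
      (f := fun h => (tanhPoly j).eval (Real.tanh (a * x + h))) (C := C)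
      (Eventually.of_forall fun h => hC _)
    simpa using this

/-- Each site contributes a bounded centered variable, so the sub-Gaussian bound at `t = ± T / √|S|`
does not depend on the size of `S`. -/
theorem exists_integral_exp_abs_fieldFluctuation_le {μ : Measure ℝ} [IsProbabilityMeasure μ]
    (hint : Integrable (fun h : ℝ => h) μ) (a : ℝ) (j : ℕ) (T : ℝ) :
    ∃ C, ∀ (n : ℕ) (S : Finset (Fin n)) (x : ℝ), S.Nonempty →
      ∫ h, Real.exp (T * |fieldFluctuation μ a j S h x| / √(S.card : ℝ))
        ∂(Measure.pi fun _ : Fin n => μ) ≤ C := by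
  obtain ⟨C, hC⟩ := exists_abs_tanhPoly_le j
  set b := |a ^ (j + 1)| * C with hb
  refine ⟨2 * Real.exp (b ^ 2 * T ^ 2 / 2), fun n S x hS => ?_⟩
  have hk : (0 : ℝ) < S.card := by exact_mod_cast Finset.card_pos.2 hS
  set k : ℝ := (S.card : ℝ) with hkdef
  set f : ℝ → ℝ := fun y => a ^ (j + 1) * (tanhPoly j).eval (Real.tanh (a * x + y)) with hf
  have hfm : Measurable f := by
    refine Continuous.measurable (continuous_const.mul ((tanhPoly j).continuous.comp
      (continuous_tanh_real.comp (by fun_prop))))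
  have hfb : ∀ y, |f y| ≤ b := by
    intro y
    rw [hf, hb, abs_mul]
    exact mul_le_mul_of_nonneg_left (hC _) (abs_nonneg _)
  have hmean : ∫ y, f y ∂μ = logCoshMean μ a (j + 1) x := by
    rw [hf, logCoshMean, integral_const_mul]
  have key := fun t => integral_exp_centered_sum_le (μ := μ) hfm hfb S t
  rw [hmean] at key
  have e : ∀ h : Fin n → ℝ, ∑ i ∈ S, (f (h i) - logCoshMean μ a (j + 1) x) =
      fieldFluctuation μ a j S h x := fun h => rfl
  simp only [e] at key
  obtain ⟨b', hb'⟩ := exists_abs_fieldFluctuation_le μ a j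
  have hcont : Continuous fun h : Fin n → ℝ => fieldFluctuation μ a j S h x :=
    Continuous.uncurry_right (f := fun h x => fieldFluctuation μ a j S h x) x
      (continuous_fieldFluctuation hint a j S)
  have hI : ∀ t : ℝ, Integrable (fun h : Fin n → ℝ => Real.exp (t * fieldFluctuation μ a j S h x))
      (Measure.pi fun _ : Fin n => μ) := by
    intro t
    refine Integrable.mono' (integrable_const (Real.exp (|t| * (k * b'))))
      (Real.continuous_exp.comp (continuous_const.mul hcont)).aestronglyMeasurable (Eventually.of_forall fun h => ?_)
    rw [Real.norm_eq_abs, abs_of_pos (Real.exp_pos _)]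
    apply Real.exp_le_exp.2
    refine (le_abs_self _).trans ?_
    rw [abs_mul]
    exact mul_le_mul_of_nonneg_left (hb' n S h x) (abs_nonneg t)
  have hle : ∀ h : Fin n → ℝ, Real.exp (T * |fieldFluctuation μ a j S h x| / √k) ≤
      Real.exp (T / √k * fieldFluctuation μ a j S h x) +
      Real.exp (-(T / √k) * fieldFluctuation μ a j S h x) := by
    intro h
    rcases abs_cases (fieldFluctuation μ a j S h x) with ⟨h1, _⟩ | ⟨h1, _⟩
    · refine le_trans (le_of_eq ?_) (le_add_of_nonneg_right (Real.exp_pos _).le)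
      rw [h1]; ring_nf
    · refine le_trans (le_of_eq ?_) (le_add_of_nonneg_left (Real.exp_pos _).le)
      rw [h1]; ring_nf
  have hsq : (T / √k) ^ 2 = T ^ 2 / k := by rw [div_pow, Real.sq_sqrt hk.le]
  have e2 : k * (b ^ 2 * (T ^ 2 / k) / 2) = b ^ 2 * T ^ 2 / 2 := by field_simp
  have k1 := key (T / √k)
  have k2 := key (-(T / √k))
  rw [hsq, e2] at k1
  rw [neg_sq, hsq, e2] at k2
  have h3 : ∫ h, Real.exp (T * |fieldFluctuation μ a j S h x| / √k)
        ∂(Measure.pi fun _ : Fin n => μ) ≤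
      ∫ h, (Real.exp (T / √k * fieldFluctuation μ a j S h x) +
      Real.exp (-(T / √k) * fieldFluctuation μ a j S h x)) ∂(Measure.pi fun _ : Fin n => μ) :=
    integral_mono_of_nonneg (Eventually.of_forall fun h => (Real.exp_pos _).le)
      ((hI _).add (hI _)) (Eventually.of_forall hle)
  rw [integral_add (hI _) (hI _)] at h3
  linarith

/-- Jensen's inequality for the uniform law on `[-X, X]`. -/
theorem exp_setIntegral_le_of_continuous {X : ℝ} (hX : 0 < X) {f : ℝ → ℝ} (hf : Continuous f) :
    Real.exp (∫ t in Set.Icc (-X) X, f t) ≤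
      (2 * X)⁻¹ * ∫ t in Set.Icc (-X) X, Real.exp (2 * X * f t) := by
  have hv : volume.real (Set.Icc (-X) X) = 2 * X := by
    rw [Real.volume_real_Icc_of_le (by linarith)]; ring
  have hne : NeZero (volume.restrict (Set.Icc (-X) X)) := by
    refine ⟨fun h => ?_⟩
    have h1 := congrArg (fun ν : Measure ℝ => ν.real Set.univ) h
    simp only [measureReal_restrict_apply_univ, hv, measureReal_zero] at h1
    simp at h1
    linarith
  have hfin : IsFiniteMeasure (volume.restrict (Set.Icc (-X) X)) :=
    ⟨by simp⟩
  have := convexOn_exp.map_average_le (μ := volume.restrict (Set.Icc (-X) X))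
    (f := fun t => 2 * X * f t) Real.continuous_exp.continuousOn isClosed_univ
    (Eventually.of_forall fun _ => Set.mem_univ _)
    ((continuous_const.mul hf).continuousOn.integrableOn_compact isCompact_Icc)
    ((Real.continuous_exp.comp (continuous_const.mul hf)).continuousOn.integrableOn_compact
      isCompact_Icc)
  rw [average_eq, average_eq, measureReal_restrict_apply_univ, hv, integral_const_mul,
    smul_eq_mul, smul_eq_mul, inv_mul_cancel_left₀ (by positivity)] at this
  exact this

/-- The random slope controlling the fluctuations of the field on `[-X, X]`. -/
noncomputable def fieldSlope {n : ℕ} (μ : Measure ℝ) (a X : ℝ) (S : Finset (Fin n))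
    (h : Fin n → ℝ) : ℝ :=
  (|fieldFluctuation μ a 0 S h 0| + ∫ t in Set.Icc (-X) X, |fieldFluctuation μ a 1 S h t|) /
    √(S.card : ℝ)

theorem fieldSlope_nonneg {n : ℕ} (μ : Measure ℝ) (a X : ℝ) (S : Finset (Fin n))
    (h : Fin n → ℝ) : 0 ≤ fieldSlope μ a X S h :=
  div_nonneg (add_nonneg (abs_nonneg _) (integral_nonneg fun _ => abs_nonneg _))
    (Real.sqrt_nonneg _)

/-- An integrable majorant of the exponential of the slope. -/
theorem exists_exp_fieldSlope_le {μ : Measure ℝ} [IsProbabilityMeasure μ]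
    (hint : Integrable (fun h : ℝ => h) μ) (a : ℝ) {X : ℝ} (hX : 0 < X) :
    ∃ C, ∀ (n : ℕ) (S : Finset (Fin n)), S.Nonempty → ∃ Y : (Fin n → ℝ) → ℝ,
      Integrable Y (Measure.pi fun _ : Fin n => μ) ∧
      ∫ h, Y h ∂(Measure.pi fun _ : Fin n => μ) ≤ C ∧
      ∀ h, Real.exp (fieldSlope μ a X S h) ≤ Y h := by
  -- The slope is a sum of two terms and `exp (u + v) ≤ exp (2 u) + exp (2 v)`. Jensen's inequality
  -- multiplies the second exponent by the length `2 X`, hence 2 and `4 * X`.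
  obtain ⟨C0, hC0⟩ := exists_integral_exp_abs_fieldFluctuation_le hint a 0 2
  obtain ⟨C1, hC1⟩ := exists_integral_exp_abs_fieldFluctuation_le hint a 1 (4 * X)
  obtain ⟨b0, hb0⟩ := exists_abs_fieldFluctuation_le μ a 0
  obtain ⟨b1, hb1⟩ := exists_abs_fieldFluctuation_le μ a 1
  refine ⟨C0 + C1, fun n S hS => ?_⟩
  have hk : (0 : ℝ) < S.card := by exact_mod_cast Finset.card_pos.2 hS
  set k : ℝ := (S.card : ℝ) with hkdef
  set P := Measure.pi fun _ : Fin n => μ with hP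
  have hc0 : Continuous fun h : Fin n → ℝ => fieldFluctuation μ a 0 S h 0 :=
    Continuous.uncurry_right (f := fun h x => fieldFluctuation μ a 0 S h x) 0
      (continuous_fieldFluctuation hint a 0 S)
  have hc1 : Continuous fun p : (Fin n → ℝ) × ℝ => fieldFluctuation μ a 1 S p.1 p.2 :=
    continuous_fieldFluctuation hint a 1 S
  have hfin : IsFiniteMeasure (volume.restrict (Set.Icc (-X) X)) := ⟨by simp⟩
  have hI0 : Integrable (fun h => Real.exp (2 * |fieldFluctuation μ a 0 S h 0| / √k)) P := by
    refine Integrable.mono' (integrable_const (Real.exp (2 * (k * b0) / √k)))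
      (Real.continuous_exp.comp
        ((continuous_const.mul hc0.abs).div_const _)).aestronglyMeasurable (Eventually.of_forall fun h => ?_)
    rw [Real.norm_eq_abs, abs_of_pos (Real.exp_pos _)]
    apply Real.exp_le_exp.2
    have := hb0 n S h 0
    gcongr
  have hI1 : Integrable (fun p : (Fin n → ℝ) × ℝ =>
      Real.exp (4 * X * |fieldFluctuation μ a 1 S p.1 p.2| / √k))
      (P.prod (volume.restrict (Set.Icc (-X) X))) := by
    refine Integrable.mono' (integrable_const (Real.exp (4 * X * (k * b1) / √k)))
      (Real.continuous_exp.comp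
        ((continuous_const.mul hc1.abs).div_const _)).aestronglyMeasurable (Eventually.of_forall fun p => ?_)
    rw [Real.norm_eq_abs, abs_of_pos (Real.exp_pos _)]
    apply Real.exp_le_exp.2
    have := hb1 n S p.1 p.2
    gcongr
  refine ⟨fun h => Real.exp (2 * |fieldFluctuation μ a 0 S h 0| / √k) +
    (2 * X)⁻¹ * ∫ t in Set.Icc (-X) X, Real.exp (4 * X * |fieldFluctuation μ a 1 S h t| / √k),
    hI0.add (hI1.integral_prod_left.const_mul _), ?_, fun h => ?_⟩
  · rw [integral_add hI0 (hI1.integral_prod_left.const_mul _), integral_const_mul]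
    refine add_le_add (hC0 n S 0 hS) ?_
    rw [integral_integral_swap hI1]
    have h1 : ∫ t in Set.Icc (-X) X,
        (∫ h, Real.exp (4 * X * |fieldFluctuation μ a 1 S h t| / √k) ∂P) ≤
        ∫ _t in Set.Icc (-X) X, C1 :=
      integral_mono_of_nonneg
        (Eventually.of_forall fun t => integral_nonneg fun h => (Real.exp_pos _).le)
        (integrable_const C1) (Eventually.of_forall fun t => hC1 n S t hS)
    rw [setIntegral_const, Real.volume_real_Icc_of_le (by linarith), smul_eq_mul] at h1
    calc _ ≤ (2 * X)⁻¹ * ((X - -X) * C1) := by gcongr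
      _ = C1 := by field_simp; ring
  · have hct : Continuous fun t => fieldFluctuation μ a 1 S h t :=
      Continuous.uncurry_left (f := fun h x => fieldFluctuation μ a 1 S h x) h hc1
    have h1 : Real.exp (2 * (∫ t in Set.Icc (-X) X, |fieldFluctuation μ a 1 S h t|) / √k) ≤
        (2 * X)⁻¹ * ∫ t in Set.Icc (-X) X,
          Real.exp (4 * X * |fieldFluctuation μ a 1 S h t| / √k) := by
      have := exp_setIntegral_le_of_continuous hX
        (f := fun t => 2 / √k * |fieldFluctuation μ a 1 S h t|) (continuous_const.mul hct.abs)
      rw [integral_const_mul] at this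
      refine le_trans (le_of_eq ?_) (this.trans (le_of_eq ?_))
      · ring_nf
      · congr 2
        ext t
        ring_nf
    refine le_trans ?_ (add_le_add le_rfl h1)
    unfold fieldSlope
    set u := |fieldFluctuation μ a 0 S h 0|
    set v := ∫ t in Set.Icc (-X) X, |fieldFluctuation μ a 1 S h t|
    rcases le_total u v with h2 | h2
    · refine le_trans (Real.exp_le_exp.2 ?_) (le_add_of_nonneg_left (Real.exp_pos _).le)
      gcongr; linarith
    · refine le_trans (Real.exp_le_exp.2 ?_) (le_add_of_nonneg_right (Real.exp_pos _).le)
      gcongr; linarith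

/-- The centered log-partition function vanishes at `0`, so its size is at most `|x|` times a bound
on its derivative, uniform on `[-X, X]`. -/
theorem fieldLogPartition_sub_le {n : ℕ} {μ : Measure ℝ} [IsProbabilityMeasure μ]
    (hint : Integrable (fun h : ℝ => h) μ) (a : ℝ) {S : Finset (Fin n)} (hS : S.Nonempty)
    (h : Fin n → ℝ) {X x : ℝ} (hx : |x| ≤ X) :
    fieldLogPartition a S h x ≤
      S.card * (logCoshMean μ a 0 x - logCoshMean μ a 0 0) +
        fieldSlope μ a X S h * (√(S.card : ℝ) * |x|) := by
  have hk : (0 : ℝ) < S.card := by exact_mod_cast Finset.card_pos.2 hS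
  set F : ℝ → ℝ := fun y => ∑ i ∈ S, (Real.log (Real.cosh (a * y + h i)) -
    Real.log (Real.cosh (h i)) - (logCoshMean μ a 0 y - logCoshMean μ a 0 0)) with hF
  have hlin : ∀ (i : Fin n) (y : ℝ), HasDerivAt (fun y => a * y + h i) a y := fun i y => by
    simpa using ((hasDerivAt_id y).const_mul a).add_const (h i)
  have hF1 : ∀ y, HasDerivAt F (fieldFluctuation μ a 0 S h y) y := by
    intro y
    refine HasDerivAt.fun_sum fun i _ => ?_
    have h1 := ((hasDerivAt_log_cosh (a * y + h i)).comp y (hlin i y)).sub_const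
      (Real.log (Real.cosh (h i)))
    have h2 := (hasDerivAt_logCoshMean hint a 0 y).sub_const (logCoshMean μ a 0 0)
    refine (h1.sub h2).congr_deriv ?_
    simp [tanhPoly, mul_comm]
  have hF2 : ∀ y, HasDerivAt (fieldFluctuation μ a 0 S h) (fieldFluctuation μ a 1 S h y) y := by
    intro y
    refine HasDerivAt.fun_sum fun i _ => ?_
    have h1 := ((hasDerivAt_tanhPoly 0 (a * y + h i)).comp y (hlin i y)).const_mul (a ^ (0 + 1))
    refine (h1.sub (hasDerivAt_logCoshMean hint a 1 y)).congr_deriv ?_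
    ring
  have hcont : Continuous (fieldFluctuation μ a 1 S h) :=
    Continuous.uncurry_left (f := fun h x => fieldFluctuation μ a 1 S h x) h
      (continuous_fieldFluctuation hint a 1 S)
  have h0 : F 0 = 0 := by simp [hF]
  have key := (le_abs_self _).trans (abs_le_mul_of_second_deriv hF1 hF2 hcont h0 hx)
  have e1 : F x = fieldLogPartition a S h x -
      S.card * (logCoshMean μ a 0 x - logCoshMean μ a 0 0) := by
    rw [hF]
    simp only [Finset.sum_sub_distrib, fieldLogPartition, Finset.sum_const, nsmul_eq_mul]
    ring
  have e2 : fieldSlope μ a X S h * (√(S.card : ℝ) * |x|) = |x| * (|fieldFluctuation μ a 0 S h 0| +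
      ∫ t in Set.Icc (-X) X, |fieldFluctuation μ a 1 S h t|) := by
    have : 0 < √(S.card : ℝ) := Real.sqrt_pos.2 hk
    unfold fieldSlope
    field_simp
  rw [e1] at key
  rw [e2]
  linarith

/-! ### Moment bound at criticality and quantitative impossibility. -/

/-- At criticality the magnetization of the clique lives on the scale `k ^ (-1 / (2 (2 τ - 1)))`. -/
theorem exists_magnetizationMomentBound {μ : Measure ℝ} [IsProbabilityMeasure μ]
    (hint : Integrable (fun h : ℝ => h) μ) {θ : ℝ} (hθ : 0 < θ) {τ : ℕ} (hτ : 2 ≤ τ)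
    (hflat : IsGlobalMinWithFlatness (meanFieldFunctional μ θ) τ) :
    ∃ c > 0, ∃ C, MagnetizationMomentBound μ θ (1 / (2 * (τ : ℝ) - 1)) c C := by
  set a := √θ with ha
  have ha0 : 0 < a := Real.sqrt_pos.2 hθ
  -- The radius `4 * a` is the threshold of `exp_meanField_le`.
  obtain ⟨g, hg0, hg⟩ := hflat.exists_lower_bound
    (contDiff_meanFieldFunctional hint θ (2 * τ)) (4 * a)
  obtain ⟨C, hC⟩ := exists_exp_fieldSlope_le hint a (by positivity : 0 < 4 * a)
  set c := min (g / 4) (1 / 8) with hc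
  have hc0 : 0 < c := lt_min (by positivity) (by norm_num)
  set q := min (g / 4) (a / 2) with hq
  have hq0 : 0 < q := lt_min (by positivity) (by positivity)
  refine ⟨θ * c, mul_pos hθ hc0, Real.exp 1 * C + √(2 * Real.pi) / q, fun n S hS => ?_⟩
  obtain ⟨Y, hYi, hYC, hY⟩ := hC n S hS
  have hk1 : (1 : ℝ) ≤ S.card := by exact_mod_cast Finset.card_pos.2 hS
  set γ := 1 / (2 * (τ : ℝ) - 1) with hγ
  have hquenched : ∀ h : Fin n → ℝ, ∑ σ, quenchedLaw θ S h σ *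
      Real.exp (θ * c * ((S.card : ℝ) ^ γ * (blockSum S σ / S.card) ^ 2)) ≤
      Real.exp 1 * Y h + √(2 * Real.pi) / q := by
    intro h
    refine (sum_quenchedLaw_mul_exp_le hθ hc0 hq0 hS h
      (A := 1 + fieldSlope μ a (4 * a) S h) fun x => ?_).trans ?_
    · refine exp_meanField_le hτ hk1 ha0 hg0 hc0 (min_le_left _ _) (min_le_right _ _)
        (fieldSlope_nonneg μ a (4 * a) S h) (fieldLogPartition_le ha0.le S h x) fun hx => ?_
      have h1 := fieldLogPartition_sub_le hint a hS h hx
      have h2 := hg x hx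
      rw [meanFieldFunctional_eq, meanFieldFunctional_eq] at h2
      have h3 := mul_le_mul_of_nonneg_left h2 (by linarith : (0 : ℝ) ≤ S.card)
      linarith
    · rw [Real.exp_add]
      gcongr
      exact hY h
  have e : ∑ σ, plantedLaw μ θ S σ *
      Real.exp (θ * c * ((S.card : ℝ) ^ γ * (blockSum S σ / S.card) ^ 2)) =
      ∫ h, ∑ σ, quenchedLaw θ S h σ *
      Real.exp (θ * c * ((S.card : ℝ) ^ γ * (blockSum S σ / S.card) ^ 2))
        ∂(Measure.pi fun _ : Fin n => μ) := by
    rw [integral_finsetSum _ fun σ _ => (integrable_quenchedLaw μ θ S σ).mul_const _]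
    refine Finset.sum_congr rfl fun σ _ => ?_
    rw [integral_mul_const, plantedLaw]
  rw [e]
  have h1 := integral_mono (μ := Measure.pi fun _ : Fin n => μ)
    (integrable_finsetSum _ fun σ _ => (integrable_quenchedLaw μ θ S σ).mul_const
      (Real.exp (θ * c * ((S.card : ℝ) ^ γ * (blockSum S σ / S.card) ^ 2))))
    ((hYi.const_mul (Real.exp 1)).add (integrable_const (√(2 * Real.pi) / q))) hquenched
  refine h1.trans ?_
  simp only [Pi.add_apply]
  rw [integral_add (hYi.const_mul _) (integrable_const _), integral_const_mul, integral_const]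
  simp only [probReal_univ, one_smul]
  have := mul_le_mul_of_nonneg_left hYC (Real.exp_pos 1).le
  linarith

theorem globalRate_eq {τ : ℕ} (hτ : 2 ≤ τ) (n k : ℕ) :
    globalRate τ n k = (n : ℝ) ^ 2 * (k : ℝ) ^ (2 * (1 / (2 * (τ : ℝ) - 1)) - 4) := by
  have h : (2 : ℝ) ≤ τ := by exact_mod_cast hτ
  have h1 : 2 * (τ : ℝ) - 1 ≠ 0 := by linarith
  rw [globalRate]
  congr 2
  field_simp
  ring

/-- Quantitative form of impossibility: below a small multiple of both rates the minimax risk is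
close to one. -/
theorem exists_one_sub_le_minimaxRisk {μ : Measure ℝ} [IsProbabilityMeasure μ]
    (hint : Integrable (fun h : ℝ => h) μ) (hsymm : μ.map (fun h : ℝ => -h) = μ) {θ : ℝ}
    (hθ : 0 < θ) {τ : ℕ} (hτ : 2 ≤ τ)
    (hflat : IsGlobalMinWithFlatness (meanFieldFunctional μ θ) τ) {η : ℝ} (hη : 0 < η)
    (hη1 : η ≤ 1) :
    ∃ ε > 0, ∃ N : ℕ, ∀ n ≥ N, ∀ k m : ℕ, k ≤ n → 1 ≤ k → 1 ≤ m →
      (m : ℝ) ≤ ε * globalRate τ n k →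
      (m : ℝ) ≤ ε * ((k : ℝ) ^ (1 / (2 * (τ : ℝ) - 1)) * Real.log n) →
      1 - η ≤ minimaxRisk μ θ n k m := by
  obtain ⟨c, hc, C', hM'⟩ := exists_magnetizationMomentBound hint hθ hτ hflat
  set γ := 1 / (2 * (τ : ℝ) - 1) with hγ
  have hτ' : (2 : ℝ) ≤ τ := by exact_mod_cast hτ
  have hγ0 : 0 < γ := one_div_pos.2 (by linarith)
  have hγ2 : γ ≤ 1 / 2 := one_div_le_one_div_of_le (by norm_num) (by linarith)
  obtain ⟨C, hC, hM⟩ : ∃ C, 0 ≤ C ∧ MagnetizationMomentBound μ θ γ c C :=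
    ⟨|C'|, abs_nonneg _, fun n S hS => (hM' n S hS).trans (le_abs_self _)⟩
  -- With `χ = η ^ 2 / 2` this gives `χ + 2 a = η ^ 2`, so the risk bound is `1 - η`.
  set a := η ^ 2 / 4 with ha
  have ha0 : 0 < a := by positivity
  have ha1 : a ≤ 1 := by nlinarith
  set D := (C + 1) / (c * a) with hD
  have hD0 : 0 ≤ D := by positivity
  have htail : C * Real.exp (-c * D) ≤ a := by
    have e : -c * D = -((C + 1) / a) := by rw [hD]; field_simp
    have h1 : (C + 1) / a ≤ Real.exp ((C + 1) / a) := by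
      linarith [Real.add_one_le_exp ((C + 1) / a)]
    rw [e, Real.exp_neg]
    calc C * (Real.exp ((C + 1) / a))⁻¹ ≤ (C + 1) * ((C + 1) / a)⁻¹ := by
          gcongr
          linarith
      _ = a := by
          have : C + 1 ≠ 0 := by positivity
          field_simp
  set c₁ := min (1 / 2) (c / 32) with hc₁
  have hc₁0 : 0 < c₁ := lt_min (by norm_num) (by positivity)
  set K₁ := 2048 / c ^ 2 * Real.exp c * C ^ 2 with hK₁
  set K₂ := 32 * D + 2 / c₁ + 192 * θ * D with hK₂
  obtain ⟨ε, hε, N, hN⟩ := exists_sum_overlap_le (γ := γ) (c₁ := c₁) (K₁ := K₁) (K₂ := K₂)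
    (η := η ^ 2 / 2) hγ0 (by linarith) hc₁0 (by positivity) (by positivity) (by positivity)
  refine ⟨ε, hε, N, fun n hn k m hkn hk hm hmA hmB => ?_⟩
  rw [globalRate_eq hτ] at hmA
  have e : √(η ^ 2 / 2 + 2 * a) = η := by
    rw [show η ^ 2 / 2 + 2 * a = η ^ 2 by rw [ha]; ring, Real.sqrt_sq hη.le]
  rw [← e]
  refine one_sub_sqrt_le_minimaxRisk hsymm θ hkn (W := D * m * (k : ℝ) ^ (-γ))
    (fun S hS => ?_) fun S hS => ?_
  · refine le_trans ?_ (one_sub_le_sum_truncatedLaw hc hM hk hS)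
    have h1 : 0 ≤ C * Real.exp (-c * D) := by positivity
    have h2 := pow_le_of_le_one h1 (htail.trans ha1) (by omega : m ≠ 0)
    linarith
  · set E₁ : ℕ → ℝ := fun r => Real.exp (K₁ * m * ((r : ℝ) * (k : ℝ) ^ (-γ)) ^ 2) with hE₁
    set E₂ : ℕ → ℝ := fun r => Real.exp (K₂ * (m * ((r : ℝ) * (k : ℝ) ^ (-γ)))) with hE₂
    -- At `ρ = c₁` both regimes of `exists_sum_overlap_le` impose a bound on `F`, so the minimum is
    -- taken there.
    set F : ℕ → ℝ := fun r => if (r : ℝ) * (k : ℝ) ^ (-γ) < c₁ then E₁ r else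
      if c₁ < (r : ℝ) * (k : ℝ) ^ (-γ) then E₂ r else min (E₁ r) (E₂ r) with hF
    have h1 : ∀ S' ∈ Finset.powersetCard k (Finset.univ : Finset (Fin n)),
        ((2 : ℝ) ^ n) ^ m * ∑ x : Fin m → Fin n → Bool,
          truncatedLaw μ θ (D * m * (k : ℝ) ^ (-γ)) S x *
          truncatedLaw μ θ (D * m * (k : ℝ) ^ (-γ)) S' x ≤ F (S ∩ S').card := by
      intro S' hS'
      have hS'k := (Finset.mem_powersetCard.1 hS').2
      have hsmall := fun h => sum_truncatedLaw_mul_le_of_small hsymm hγ2 hc hM hk hS hS'k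
        (W := D * m * (k : ℝ) ^ (-γ)) (m := m) h
      have hlarge := fun h => sum_truncatedLaw_mul_le_of_large hsymm hθ.le hc₁0 hD0 hk hS hS'k
        (γ := γ) (m := m) h
      simp only [hF]
      split_ifs with h h'
      · exact hsmall h.le
      · exact hlarge h'.le
      · exact le_min (hsmall (not_lt.1 h')) (hlarge (not_lt.1 h))
    refine (Finset.sum_le_sum h1).trans ?_
    rw [sum_overlapLaw_mul hkn S hS F]
    refine mul_le_mul_of_nonneg_right ?_ (Nat.cast_nonneg _)
    refine hN n hn k m (hk.trans hkn) hk hm hmA hmB F (overlapLaw k S) (overlapLaw_nonneg k S)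
      (sum_overlapLaw hkn S hS) (fun r hr => overlapLaw_le hkn hk S hS hr)
      (fun r _ h => ?_) fun r _ h => ?_
    · simp only [hF]
      split_ifs with h1 h2
      · exact le_rfl
      · exact absurd h2 h.not_gt
      · exact min_le_left _ _
    · simp only [hF]
      split_ifs with h1 h2
      · exact absurd h1 h.not_gt
      · exact le_rfl
      · exact min_le_right _ _

/-- The local condition is `m = o(k ^ γ log n)`, without the factor `log k` in the denominator of
`localRate`. For `m ≥ 1` it also excludes `k = 0`. -/
theorem tendsto_minimaxRisk_of_isLittleO {μ : Measure ℝ} [IsProbabilityMeasure μ]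
    (hint : Integrable (fun h : ℝ => h) μ) (hsymm : μ.map (fun h : ℝ => -h) = μ) {θ : ℝ}
    (hθ : 0 < θ) {τ : ℕ} (hτ : 2 ≤ τ)
    (hflat : IsGlobalMinWithFlatness (meanFieldFunctional μ θ) τ) {k m : ℕ → ℕ}
    (hkn : (fun n => (k n : ℝ)) =o[atTop] fun n : ℕ => (n : ℝ))
    (hA : (fun n => (m n : ℝ)) =o[atTop] fun n => globalRate τ n (k n))
    (hB : (fun n => (m n : ℝ)) =o[atTop]
      fun n : ℕ => (k n : ℝ) ^ (1 / (2 * (τ : ℝ) - 1)) * Real.log n) :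
    Tendsto (fun n => minimaxRisk μ θ n (k n) (m n)) atTop (𝓝 1) := by
  have hτ' : (2 : ℝ) ≤ τ := by exact_mod_cast hτ
  rw [tendsto_order]
  refine ⟨fun b hb => ?_, fun b hb => Eventually.of_forall fun n =>
    (minimaxRisk_le_one μ θ n (k n) (m n)).trans_lt hb⟩
  set η := min 1 ((1 - b) / 2) with hη
  have hη0 : 0 < η := lt_min one_pos (by linarith)
  have hηb : b < 1 - η := by linarith [min_le_right 1 ((1 - b) / 2)]
  obtain ⟨ε, hε, N, hN⟩ := exists_one_sub_le_minimaxRisk hint hsymm hθ hτ hflat hη0 (min_le_left _ _)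
  filter_upwards [hkn.bound one_pos, hA.bound hε, hB.bound hε, eventually_ge_atTop N]
    with n h1 h2 h3 h4
  refine hηb.trans_le ?_
  have hkn' : k n ≤ n := by simpa using h1
  have hlog : 0 ≤ Real.log n := Real.log_natCast_nonneg n
  rw [Real.norm_natCast, Real.norm_of_nonneg (by positivity)] at h3
  rw [Real.norm_natCast, Real.norm_of_nonneg (by unfold globalRate; positivity)] at h2
  rcases Nat.eq_zero_or_pos (m n) with hm | hm
  · rw [hm, minimaxRisk_zero_samples hsymm θ hkn']
    linarith
  · refine hN n h4 (k n) (m n) hkn' (Nat.one_le_iff_ne_zero.2 fun hk => ?_) hm h2 h3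
    have : (1 : ℝ) ≤ m n := by exact_mod_cast hm
    rw [hk, Nat.cast_zero, Real.zero_rpow (one_div_pos.2 (by linarith)).ne'] at h3
    linarith

/-! ### Comparison of the rates and the theorem. -/

theorem localRate_nonneg {τ : ℕ} (n k : ℕ) : 0 ≤ localRate τ n k :=
  mul_nonneg (Real.rpow_nonneg (div_nonneg (Nat.cast_nonneg _) (Real.log_natCast_nonneg _)) _)
    (Real.log_natCast_nonneg _)

theorem localRate_isBigO {τ : ℕ} (hτ : 2 ≤ τ) (k : ℕ → ℕ) :
    (fun n => localRate τ n (k n)) =O[atTop]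
      fun n : ℕ => (k n : ℝ) ^ (1 / (2 * (τ : ℝ) - 1)) * Real.log n := by
  have hτ' : (2 : ℝ) ≤ τ := by exact_mod_cast hτ
  have hγ : 0 < 1 / (2 * (τ : ℝ) - 1) := one_div_pos.2 (by linarith)
  have hl2 : 0 < Real.log 2 := Real.log_pos (by norm_num)
  refine IsBigO.of_bound ((Real.log 2)⁻¹ ^ (1 / (2 * (τ : ℝ) - 1)))
    (Eventually.of_forall fun n => ?_)
  have hlog : 0 ≤ Real.log n := Real.log_natCast_nonneg n
  rw [Real.norm_of_nonneg (localRate_nonneg n _), Real.norm_of_nonneg (by positivity), ← mul_assoc,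
    ← Real.mul_rpow (by positivity) (by positivity), localRate]
  refine mul_le_mul_of_nonneg_right (Real.rpow_le_rpow
    (div_nonneg (Nat.cast_nonneg _) (Real.log_natCast_nonneg _)) ?_ hγ.le) hlog
  -- For `k ≤ 1` the logarithm is zero and so, by the convention on division, is the quotient;
  -- otherwise `log k ≥ log 2`.
  rcases lt_or_ge (k n) 2 with h | h
  · have : Real.log (k n : ℝ) = 0 := by
      interval_cases k n <;> simp
    rw [this, div_zero]
    positivity
  · rw [div_eq_mul_inv, mul_comm]
    gcongr
    exact_mod_cast h

theorem rpow_isLittleO_self {q : ℝ} (hq : q < 1) :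
    (fun n : ℕ => (n : ℝ) ^ q) =o[atTop] fun n : ℕ => (n : ℝ) := by
  refine (isLittleO_iff_tendsto' ?_).2 ?_
  · filter_upwards [eventually_gt_atTop 0] with n hn h
    simp only [Nat.cast_eq_zero] at h
    omega
  · refine ((tendsto_rpow_neg_atTop (sub_pos.2 hq)).comp tendsto_natCast_atTop_atTop).congr' ?_
    filter_upwards [eventually_gt_atTop 0] with n hn
    rw [Function.comp_apply, neg_sub, Real.rpow_sub_one (by positivity)]

theorem mainTheorem4 (μ : Measure ℝ) [IsProbabilityMeasure μ]
    (hint : Integrable (fun h : ℝ => h) μ)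
    (hsymm : μ.map (fun h : ℝ => -h) = μ)
    (θ : ℝ) (hcrit : θ = 1 / ∫ h, 1 / Real.cosh h ^ 2 ∂μ)
    (τ : ℕ) (hflat : IsGlobalMinWithFlatness (meanFieldFunctional μ θ) τ)
    (k m : ℕ → ℕ) :
    (((fun n : ℕ => (n : ℝ) ^ ((4 * (τ : ℝ) - 2) / (8 * (τ : ℝ) - 5))) =O[atTop]
          fun n => (k n : ℝ)) →
      ((fun n => (k n : ℝ)) =O[atTop]
          fun n : ℕ => (n : ℝ) ^ ((2 * (τ : ℝ) - 1) / (4 * (τ : ℝ) - 3))) →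
      ((fun n => (m n : ℝ)) =o[atTop] fun n => globalRate τ n (k n)) →
      Tendsto (fun n => minimaxRisk μ θ n (k n) (m n)) atTop (𝓝 1)) ∧
    (((fun n => (k n : ℝ)) =O[atTop]
          fun n : ℕ => (n : ℝ) ^ ((4 * (τ : ℝ) - 2) / (8 * (τ : ℝ) - 5)) / Real.log (n : ℝ)) →
      ((fun n => (m n : ℝ)) =o[atTop] fun n => localRate τ n (k n)) →
      Tendsto (fun n => minimaxRisk μ θ n (k n) (m n)) atTop (𝓝 1)) ∧
    (((fun n => (k n : ℝ)) =o[atTop]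
          fun n : ℕ => (n : ℝ) ^ ((4 * (τ : ℝ) - 2) / (8 * (τ : ℝ) - 5))) →
      ((fun n => (m n : ℝ)) =o[atTop]
          fun n => min (localRate τ n (k n)) (globalRate τ n (k n))) →
      Tendsto (fun n => minimaxRisk μ θ n (k n) (m n)) atTop (𝓝 1)) := by
  have hθ := critical_pos hcrit
  have hτ := two_le_flatness hint hcrit hflat
  have hτ' : (2 : ℝ) ≤ τ := by exact_mod_cast hτ
  have hp1 : (4 * (τ : ℝ) - 2) / (8 * (τ : ℝ) - 5) < 1 := by
    rw [div_lt_one] <;> linarith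
  have hp0 : 0 < (4 * (τ : ℝ) - 2) / (8 * (τ : ℝ) - 5) := div_pos (by linarith) (by linarith)
  have hq1 : (2 * (τ : ℝ) - 1) / (4 * (τ : ℝ) - 3) < 1 := by
    rw [div_lt_one] <;> linarith
  have hγ0 : 0 < 1 / (2 * (τ : ℝ) - 1) := one_div_pos.2 (by linarith)
  have hγ2 : 1 / (2 * (τ : ℝ) - 1) ≤ 1 / 2 :=
    one_div_le_one_div_of_le (by norm_num) (by linarith)
  -- The two rates cross here, up to logarithms: at `k = n ^ p` one has `k ^ (4 - γ) = n ^ 2`, that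
  -- is `n ^ 2 k ^ (2 γ - 4) = k ^ γ`.
  have hpγ : (4 * (τ : ℝ) - 2) / (8 * (τ : ℝ) - 5) * (4 - 1 / (2 * (τ : ℝ) - 1)) = 2 := by
    have h1 : (τ : ℝ) * 8 - 5 ≠ 0 := by linarith
    have h2 : (τ : ℝ) * 2 - 1 ≠ 0 := by linarith
    rw [mul_comm (8 : ℝ), mul_comm (2 : ℝ) (τ : ℝ)]
    field_simp
    ring
  simp only [globalRate_eq hτ] at *
  have hlogn : ∀ᶠ n : ℕ in atTop, 1 ≤ Real.log n :=
    (Real.tendsto_log_atTop.comp tendsto_natCast_atTop_atTop).eventually_ge_atTop 1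
  have hmain := fun (h1 : (fun n => (k n : ℝ)) =o[atTop] fun n : ℕ => (n : ℝ))
    (h2 : (fun n => (m n : ℝ)) =o[atTop] fun n => globalRate τ n (k n)) h3 =>
    tendsto_minimaxRisk_of_isLittleO hint hsymm hθ hτ hflat h1 h2 h3
  simp only [globalRate_eq hτ] at hmain
  set p := (4 * (τ : ℝ) - 2) / (8 * (τ : ℝ) - 5) with hp
  have hlocal := localRate_isBigO hτ k
  set γ := 1 / (2 * (τ : ℝ) - 1) with hγ
  have hsq : ∀ n : ℕ, ((n : ℝ) ^ p) ^ (4 - γ) = (n : ℝ) ^ 2 := fun n => by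
    rw [← Real.rpow_mul (Nat.cast_nonneg n), hpγ]
    exact_mod_cast Real.rpow_natCast (n : ℝ) 2
  have hkk : ∀ n, (k n : ℝ) ^ (4 - γ) * (k n : ℝ) ^ (2 * γ - 4) = (k n : ℝ) ^ γ := fun n => by
    rw [← Real.rpow_add' (Nat.cast_nonneg _) (by linarith)]
    ring_nf
  refine ⟨fun hk1 hk2 hm => ?_, fun hk hm => ?_, fun hk hm => ?_⟩
  -- Above the crossing the global rate is `O(k ^ γ)`, so it implies the local condition.
  · refine hmain (hk2.trans_isLittleO (rpow_isLittleO_self hq1)) hm (hm.trans_isBigO ?_)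
    obtain ⟨C, hC0, hC⟩ := hk1.exists_pos
    refine IsBigO.of_bound (C ^ (4 - γ)) ?_
    filter_upwards [hC.bound, hlogn] with n h1 h2
    rw [Real.norm_of_nonneg (by positivity), Real.norm_natCast] at h1
    rw [Real.norm_of_nonneg (by positivity), Real.norm_of_nonneg (by positivity)]
    have h3 := Real.rpow_le_rpow (by positivity) h1 (by linarith : 0 ≤ 4 - γ)
    rw [hsq, Real.mul_rpow hC0.le (Nat.cast_nonneg _)] at h3
    calc _ ≤ C ^ (4 - γ) * (k n : ℝ) ^ (4 - γ) * (k n : ℝ) ^ (2 * γ - 4) := by gcongr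
      _ = C ^ (4 - γ) * ((k n : ℝ) ^ γ * 1) := by rw [mul_assoc, hkk, mul_one]
      _ ≤ _ := by gcongr
  · have hB := hm.trans_isBigO hlocal
    obtain ⟨C, hC0, hC⟩ := hk.exists_pos
    have hkn : (fun n => (k n : ℝ)) =O[atTop] fun n : ℕ => (n : ℝ) ^ p := by
      refine hk.trans (IsBigO.of_bound 1 ?_)
      filter_upwards [hlogn] with n h2
      rw [Real.norm_of_nonneg (by positivity), Real.norm_of_nonneg (by positivity), one_mul]
      exact div_le_self (by positivity) h2
    refine hmain (hkn.trans_isLittleO (rpow_isLittleO_self hp1)) (hB.trans_isBigO ?_) hB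
    refine IsBigO.of_bound (C ^ (4 - γ)) ?_
    filter_upwards [hC.bound, hlogn] with n h1 h2
    rw [Real.norm_natCast, Real.norm_of_nonneg (by positivity)] at h1
    rw [Real.norm_of_nonneg (by positivity), Real.norm_of_nonneg (by positivity)]
    have h3 := Real.rpow_le_rpow (by positivity) h1 (by linarith : 0 ≤ 4 - γ)
    rw [Real.mul_rpow hC0.le (by positivity), Real.div_rpow (by positivity) (by positivity),
      hsq] at h3
    -- The factor `1 / log n` in the bound on `k`, raised to the power `4 - γ ≥ 1`, pays for the
    -- `log n` of the local rate, which is thus dominated by the global one.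
    have h4 : Real.log n ≤ Real.log n ^ (4 - γ) := Real.self_le_rpow_of_one_le h2 (by linarith)
    have h5 : (k n : ℝ) ^ (4 - γ) * Real.log n ≤ C ^ (4 - γ) * (n : ℝ) ^ 2 := by
      calc _ ≤ C ^ (4 - γ) * ((n : ℝ) ^ 2 / Real.log n ^ (4 - γ)) * Real.log n ^ (4 - γ) := by
            gcongr
        _ = _ := by
            have : Real.log n ^ (4 - γ) ≠ 0 := by positivity
            field_simp
    calc _ = (k n : ℝ) ^ (4 - γ) * Real.log n * (k n : ℝ) ^ (2 * γ - 4) := by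
          rw [← hkk]; ring
      _ ≤ C ^ (4 - γ) * (n : ℝ) ^ 2 * (k n : ℝ) ^ (2 * γ - 4) := by gcongr
      _ = _ := by ring
  · have hl0 : ∀ n, 0 ≤ localRate τ n (k n) := fun n => localRate_nonneg n _
    refine hmain (hk.trans (rpow_isLittleO_self hp1)) (hm.trans_isBigO ?_)
      ((hm.trans_isBigO ?_).trans_isBigO hlocal)
    · refine IsBigO.of_bound 1 (Eventually.of_forall fun n => ?_)
      rw [one_mul, Real.norm_of_nonneg (le_min (hl0 n) (by positivity)),
        Real.norm_of_nonneg (by positivity)]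
      exact min_le_right _ _
    · refine IsBigO.of_bound 1 (Eventually.of_forall fun n => ?_)
      rw [one_mul, Real.norm_of_nonneg (le_min (hl0 n) (by positivity)),
        Real.norm_of_nonneg (hl0 n)]
      exact min_le_left _ _
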